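/- **Setting.** Let $G$ be a finite simple triconnected graph with $|V(G)|>6$. For a set $M\subset V(G)\cup E(G)$, $G-M$ is obtained by deleting the vertices and edges of $M$ and all edges incident to deleted vertices; components are regarded as vertex sets. A *3-cutset* is a set $S$ of three vertices such that $G-S$ is disconnected. A set $R\subset V(G)$ *splits* $X\subset V(G)$ if not all vertices of $X\setminus R$ lie in one component of $G-R$. Two 3-cutsets are *independent* if neither splits the other, otherwise *dependent*. A 3-cutset is *single* if it is independent with every other 3-cutset, and *trivial* if some component of $G-S$ is a single vertex. For a set $\mathfrak S$ of 3-cutsets, a *part* is an inclusion-maximal vertex set $A$ that no member of $\mathfrak S$ splits; $\mathcal P(\mathfrak S)$ is the set of parts, $\mathcal P(S)=\mathcal P(\{S\})$. The *boundary* of $A$ is the set of its vertices lying in members of $\mathfrak S$, and its *interior* is the set of its other vertices; $A$ is *empty* if its interior is. **Cuts.** For $0\le i\le 3$ let $\mathfrak M_i$ be the family of sets $M$ of $i$ edges and $3-i$ vertices with $G-M$ disconnected. A *cut* is an element of $\mathfrak M_1\cup\mathfrak M_2\cup\mathfrak M_3$; for a cut $M$, $G-M$ has exactly two components. $V(M)$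 is the set of vertices of $M$ and ends of edges of $M$. If $H_1,H_2$ are the components of $G-M$, the *parts* of $M$ are $V(G)\setminus H_2$ and $V(G)\setminus H_1$, and their intersections with $V(M)$ are the *boundaries* of $M$. A cut is *trivial* if $H_1$ or $H_2$ is a single vertex. $M$ *contains* $N$ if all vertices of $M$ are in $N$ and, for each edge of $M$, the edge or one of its ends is an element of $N$. A 3-cutset $S$ *can be complemented* by an edge $ab$ with $a\in S$ if $(S\setminus\{a\})\cup\{ab\}$ is a cut (the *resulting cut*). **Triple complexes.** Let $S$ be a 3-cutset with $|\mathcal P(S)|=3$, such that there are $a\in S$ and a 3-cutset $T$ for which $\{a\}$ is a component of $G-T$ and $T$ meets the interior of every part of $\mathcal P(S)$. Such an $S$ is the line of a *triple cut*. For $A\in\mathcal P(S)$ let $M_A$ be the cut obtained from $S$ by replacing every vertex of degree 3 in $S$ by the edge joining it to the interior of $A$. Let $M_A'$ be the cut in $\mathfrak M_3$ containing $M_A$ if there is one, and $M_A'=M_A$ otherwise. The *neighborhood* of the triple cut is $\bigcup_A V(M_A')$. Its *triple complex* consists of all 3-cutsets contained in this neighborhood, except the *boundaries* of the complex, which are,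 for each $A\in\mathcal P(S)$, the boundary of $M_A'$ belonging to that part of $M_A'$ which is contained in $A$. **Flower complexes.** A *flower* $F=(p;q_1,\dots,q_m)$, $m\ge4$, consists of distinct vertices, the $q_i$ (*petals*) being cyclically ordered, such that for some set $\mathfrak S$ of 3-cutsets of the form $\{p,q_i,q_j\}$ with $q_i,q_j$ distinct and non-neighboring in the cyclic order, $\mathcal P(\mathfrak S)$ consists of $m$ parts $G_{1,2},\dots,G_{m,1}$, where $G_{i,i+1}$ has boundary $\{p,q_i,q_{i+1}\}$. Put $V(F)=\{p,q_1,\dots,q_m\}$. $F$ is *maximal* if no flower with the same center $p$ has a strictly larger vertex set, and *nondegenerate* if $V(F)\not\subset V(M)$ for all $M\in\mathfrak M_3$. The *neighborhood* of a maximal nondegenerate flower $F$ consists of $V(F)$ and, for every $i$ for which $G_{i,i+1}$ contains exactly one vertex $u$ adjacent to $p$, this vertex $u$, provided that either $d(p)=3$ and $G_{i,i+1}$ is nonempty, or $d(p)\ne3$ and both $G_{i-1,i}$ and $G_{i+1,i+2}$ are empty. The *complex* $\mathfrak C(F)$ consists of all 3-cutsets that are contained in this neighborhood and split it; its *boundaries*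 are the boundaries of all parts of $\mathcal P(\mathfrak C(F))$ with at least three vertices. **Big cut complexes.** A nontrivial cut $M\in\mathfrak M_3$ is *big* if $V(M)$ is not contained in the neighborhood of any triple cut or any maximal nondegenerate flower. Its *complex* consists of all 3-cutsets contained in $V(M)$ except the two boundaries of $M$, which are called the *boundaries* of the complex. **Complexes.** The *big complexes* are the triple complexes, the complexes of maximal nondegenerate flowers and the complexes of big cuts. A cut $M\in\mathfrak M_1$ is *small* if both its boundaries are nonsingle 3-cutsets that belong to no big complex; its complex consists of its two boundaries. The *complexes* of $G$ are the big complexes, the complexes of small cuts, the sets $\{T\}$ for single cutsets $T$, and the sets $\{T\}$ for all 3-cutsets $T$ belonging neither to a big complex nor to the complex of a small cut. **Corollary.** Let a complex of $G$ consist of one cutset $T$. Then at least one of the following holds: 1. $T$ is a single cutset; 2. $T$ is a trivial cutset; 3. $T$ is a boundary of a big complex; 4. $T$ can be complemented by exactly one edge, and the boundary of the resulting cut other than $T$ is a single cutset. -/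

import Mathlib

namespace ThreeCuts

/-- A finite graph is `k`-connected if it has at least `k + 1` vertices and remains connected after
the deletion of any `k - 1` vertices. -/
def IsKConnected {V : Type*} (G : SimpleGraph V) (k : ℕ) : Prop :=
  k + 1 ≤ Nat.card V ∧ ∀ S : Set V, S.ncard + 1 = k → (G.induce Sᶜ).Connected

/-- A vertex has degree three. -/
def IsCubicVertex {V : Type*} (G : SimpleGraph V) (x : V) : Prop :=
  (G.neighborSet x).ncard = 3

/-! ### Deleting vertices and edges -/

/-- A set of vertices together with a set of (possible) edges. -/
@[ext]
structure MixedSet (V : Type*) where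
  verts : Set V
  edges : Set (Sym2 V)

/-- A set of vertices, seen as a mixed set without edges. -/
def vset {V : Type*} (S : Set V) : MixedSet V := ⟨S, ∅⟩

/-- The vertex set `V(M)`: the vertices of `M` and the ends of the edges of `M`. -/
def MixedSet.support {V : Type*} (M : MixedSet V) : Set V :=
  M.verts ∪ {v | ∃ e ∈ M.edges, v ∈ e}

/-- The graph `G - M`. -/
def remove {V : Type*} (G : SimpleGraph V) (M : MixedSet V) : SimpleGraph ↥(M.verts)ᶜ :=
  (G.deleteEdges M.edges).induce (M.verts)ᶜ

/-- `G - M` is disconnected. -/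
def Disconnects {V : Type*} (G : SimpleGraph V) (M : MixedSet V) : Prop :=
  ¬ (remove G M).Preconnected

/-- `H` is (the vertex set of) a connected component of `G - M`. -/
def IsComponent {V : Type*} (G : SimpleGraph V) (M : MixedSet V) (H : Set V) : Prop :=
  ∃ c : (remove G M).ConnectedComponent, H = Subtype.val '' c.supp

/-! ### Cutsets, dependence, decomposition into parts -/

/-- The set of all 3-vertex cutsets of `G`. -/
def threeCutsets {V : Type*} (G : SimpleGraph V) : Set (Set V) :=
  {S | S.ncard = 3 ∧ Disconnects G (vset S)}

/-- `R` splits `X`: not all vertices of `X \ R` are in the same connected component of `G - R`. -/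
def Splits {V : Type*} (G : SimpleGraph V) (R X : Set V) : Prop :=
  ∃ x y : ↥((vset R).verts)ᶜ, (x : V) ∈ X ∧ (y : V) ∈ X ∧ ¬ (remove G (vset R)).Reachable x y

/-- Two cutsets are independent if neither of them splits the other one. -/
def Independent {V : Type*} (G : SimpleGraph V) (S T : Set V) : Prop :=
  ¬ Splits G S T ∧ ¬ Splits G T S

/-- A single cutset: a 3-cutset which is independent with every other 3-cutset. -/
def IsSingle {V : Type*} (G : SimpleGraph V) (S : Set V) : Prop :=
  S ∈ threeCutsets G ∧ ∀ T ∈ threeCutsets G, T ≠ S → Independent G S T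

/-- A trivial cutset: a 3-cutset `S` such that some connected component of `G - S` consists of a
single vertex. -/
def IsTrivialCutset {V : Type*} (G : SimpleGraph V) (S : Set V) : Prop :=
  S ∈ threeCutsets G ∧ ∃ a : V, IsComponent G (vset S) {a}

/-- The parts of the decomposition of `G` by a family of cutsets: the inclusion-maximal vertex sets
that are split by no member of the family. -/
def parts {V : Type*} (G : SimpleGraph V) (F : Set (Set V)) : Set (Set V) :=
  {A | Maximal (fun B : Set V => ∀ S ∈ F, ¬ Splits G S B) A}

/-- The boundary of a part: its vertices which belong to a cutset of the family. -/
def partBoundary {V : Type*} (F : Set (Set V)) (A : Set V) : Set V := A ∩ ⋃₀ F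

/-- The interior of a part: its vertices which belong to no cutset of the family. -/
def partInterior {V : Type*} (F : Set (Set V)) (A : Set V) : Set V := A \ ⋃₀ F

/-! ### Vertex-edge cuts -/

/-- The cutting sets consisting of `i` edges and `3 - i` vertices. -/
def cutClass {V : Type*} (G : SimpleGraph V) (i : ℕ) : Set (MixedSet V) :=
  {M | M.edges ⊆ G.edgeSet ∧ M.edges.ncard = i ∧ M.verts.ncard + i = 3 ∧ Disconnects G M}

/-- The (vertex-edge) cuts: three-element cutting sets with at least one edge. -/
def cuts {V : Type*} (G : SimpleGraph V) : Set (MixedSet V) :=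
  {M | ∃ i : ℕ, 1 ≤ i ∧ i ≤ 3 ∧ M ∈ cutClass G i}

/-- `M` contains `N`: all vertices of `M` are in `N`, and for every edge of `M` either the edge
itself or an end of it is in `N`. -/
def MixedSet.Contains {V : Type*} (M N : MixedSet V) : Prop :=
  M.verts ⊆ N.verts ∧ ∀ e ∈ M.edges, e ∈ N.edges ∨ ∃ v ∈ N.verts, v ∈ e

/-- `M` can be complemented by the edge `e`, the resulting cut being `M'`: an end `a` of `e` belongs
to `M`, and replacing `a` by `e` in `M` yields the cut `M'`. -/
def ComplementedTo {V : Type*} (G : SimpleGraph V) (M : MixedSet V) (e : Sym2 V)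
    (M' : MixedSet V) : Prop :=
  ∃ a b : V, a ∈ M.verts ∧ G.Adj a b ∧ e = s(a, b) ∧
    M' = ⟨M.verts \ {a}, insert e M.edges⟩ ∧ M' ∈ cuts G

/-- A boundary of a cut `M`. If `H` and `H'` are the two components of `G - M`, the part of the
decomposition that contains `H'` is the complement of `H`; its boundary consists of those of its
vertices that are in `V(M)`. -/
def IsCutBoundary {V : Type*} (G : SimpleGraph V) (M : MixedSet V) (T : Set V) : Prop :=
  ∃ H : Set V, IsComponent G M H ∧ T = Hᶜ ∩ M.support

/-- A cutting set is trivial if a component of `G - M` consists of a single vertex. -/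
def IsTrivialCut {V : Type*} (G : SimpleGraph V) (M : MixedSet V) : Prop :=
  ∃ a : V, IsComponent G M {a}

/-! ### Triple cuts and triple complexes -/

/-- The trivial cutset `T`, separating a vertex `a` from all other vertices, is subordinated to the
cutset `S`. -/
def Subordinated {V : Type*} (G : SimpleGraph V) (T S : Set V) : Prop :=
  T ∈ threeCutsets G ∧ S ∈ threeCutsets G ∧ (parts G {S}).ncard = 3 ∧
    (∃ a ∈ S, IsComponent G (vset T) {a}) ∧
    ∀ A ∈ parts G {S}, (partInterior {S} A ∩ T).Nonempty

/-- The lines of triple cuts: the 3-cutsets which have a subordinated trivial cutset. -/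
def tripleLines {V : Type*} (G : SimpleGraph V) : Set (Set V) :=
  {S | ∃ T, Subordinated G T S}

/-- For a part `A` of the decomposition by the line `S`: the cut obtained from `S` by replacing
every vertex of degree three by the edge that joins it to the interior of `A`. -/
def lineCut {V : Type*} (G : SimpleGraph V) (S A : Set V) : MixedSet V where
  verts := {x | x ∈ S ∧ ¬ IsCubicVertex G x}
  edges := {e | ∃ x ∈ S, ∃ y ∈ partInterior {S} A, IsCubicVertex G x ∧ G.Adj x y ∧ e = s(x, y)}

/-- `M'` is the cut with three edges containing `M`, if there is one, and `M` itself otherwise. -/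
def IsExtendedCut {V : Type*} (G : SimpleGraph V) (M M' : MixedSet V) : Prop :=
  (M' ∈ cutClass G 3 ∧ M'.Contains M) ∨
    ((¬ ∃ N ∈ cutClass G 3, N.Contains M) ∧ M' = M)

/-- The neighborhood of the triple cut with line `S`. -/
def tripleNeighborhood {V : Type*} (G : SimpleGraph V) (S : Set V) : Set V :=
  {v | ∃ A ∈ parts G {S}, ∃ M', IsExtendedCut G (lineCut G S A) M' ∧ v ∈ M'.support}

/-- The boundaries of the neighborhood of the triple cut with line `S`: for every part `A` of the
decomposition by `S` with extended cut `M'`, the boundary of that part `Hᶜ` of the decomposition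
by `M'` which lies inside `A`. -/
def tripleBoundaries {V : Type*} (G : SimpleGraph V) (S : Set V) : Set (Set V) :=
  {T | ∃ A ∈ parts G {S}, ∃ M', IsExtendedCut G (lineCut G S A) M' ∧
    ∃ H, IsComponent G M' H ∧ Hᶜ ⊆ A ∧ T = Hᶜ ∩ M'.support}

/-- The triple complex with line `S`. -/
def tripleComplex {V : Type*} (G : SimpleGraph V) (S : Set V) : Set (Set V) :=
  {T | T ∈ threeCutsets G ∧ T ⊆ tripleNeighborhood G S ∧ T ∉ tripleBoundaries G S}

/-! ### Flowers and their complexes -/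

/-- The data of a flower: a center, a cyclically ordered tuple of `m` petals, and sets
`part i` (the part `G_{i,i+1}` between the petals `i` and `i + 1`). -/
structure FlowerData (V : Type*) where
  m : ℕ
  center : V
  petal : ZMod m → V
  part : ZMod m → Set V

/-- The vertex set of a flower. -/
def FlowerData.verts {V : Type*} (F : FlowerData V) : Set V :=
  insert F.center (Set.range F.petal)

/-- The sets `Q_{i,j}`. -/
def FlowerData.set {V : Type*} (F : FlowerData V) (i j : ZMod F.m) : Set V :=
  {F.petal i, F.petal j, F.center}

/-- The sets `Q_{i,j}` for distinct and non-neighboring `i`, `j`. -/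
def FlowerData.innerSets {V : Type*} (F : FlowerData V) : Set (Set V) :=
  {S | ∃ i j : ZMod F.m, j ≠ i ∧ j ≠ i + 1 ∧ i ≠ j + 1 ∧ S = F.set i j}

/-- `F` is a flower: it has at least four petals, and some family of 3-cutsets among the sets
`Q_{i,j}` with non-neighboring `i`, `j` decomposes `G` into the parts `F.part i`, where the boundary
of `F.part i` is `Q_{i,i+1}`. (The parts are thus determined by the center and the petals.) -/
def IsFlower {V : Type*} (G : SimpleGraph V) (F : FlowerData V) : Prop :=
  4 ≤ F.m ∧ Function.Injective F.petal ∧ (∀ i, F.petal i ≠ F.center) ∧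
    ∃ 𝔖 : Set (Set V), 𝔖 ⊆ F.innerSets ∧ 𝔖 ⊆ threeCutsets G ∧
      parts G 𝔖 = Set.range F.part ∧ ∀ i, partBoundary 𝔖 (F.part i) = F.set i (i + 1)

/-- The interior of the part between the petals `i` and `i + 1` (the cutsets generating a flower
cover exactly its vertex set). -/
def FlowerData.interior {V : Type*} (F : FlowerData V) (i : ZMod F.m) : Set V :=
  F.part i \ F.verts

/-- A maximal flower: no flower with the same center has a strictly larger vertex set. -/
def IsMaximalFlower {V : Type*} (G : SimpleGraph V) (F : FlowerData V) : Prop :=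
  IsFlower G F ∧ ∀ F' : FlowerData V, IsFlower G F' → F'.center = F.center →
    F.verts ⊆ F'.verts → F'.verts = F.verts

/-- A flower is nondegenerate if it is not contained in a cut with three edges. -/
def IsNondegenerateFlower {V : Type*} (G : SimpleGraph V) (F : FlowerData V) : Prop :=
  ∀ M ∈ cutClass G 3, ¬ F.verts ⊆ M.support

/-- `u` is the only vertex of the `i`-th part adjacent to the center, and either the flower is
singular (its center has degree three) and the part is nonempty, or the flower is nonsingular and
both neighboring parts are empty. -/
def IsFlowerNeighbor {V : Type*} (G : SimpleGraph V) (F : FlowerData V) (i : ZMod F.m)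
    (u : V) : Prop :=
  F.part i ∩ G.neighborSet F.center = {u} ∧
    ((IsCubicVertex G F.center ∧ (F.interior i).Nonempty) ∨
      (¬ IsCubicVertex G F.center ∧ F.interior (i - 1) = ∅ ∧ F.interior (i + 1) = ∅))

/-- The neighborhood of a (maximal nondegenerate) flower. -/
def flowerNeighborhood {V : Type*} (G : SimpleGraph V) (F : FlowerData V) : Set V :=
  F.verts ∪ {u | ∃ i, IsFlowerNeighbor G F i u}

/-- The complex of a flower: the 3-cutsets contained in its neighborhood and splitting it. -/
def flowerComplex {V : Type*} (G : SimpleGraph V) (F : FlowerData V) : Set (Set V) :=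
  {T | T ∈ threeCutsets G ∧ T ⊆ flowerNeighborhood G F ∧ Splits G T (flowerNeighborhood G F)}

/-- The boundaries of the complex of a flower: the boundaries of all parts with at least three
vertices of the decomposition by this complex. -/
def flowerBoundaries {V : Type*} (G : SimpleGraph V) (F : FlowerData V) : Set (Set V) :=
  {T | ∃ A ∈ parts G (flowerComplex G F), 3 ≤ A.ncard ∧ T = partBoundary (flowerComplex G F) A}

/-! ### Big cuts, big complexes, complexes -/

/-- A big cut: a nontrivial cut with three edges whose vertex set is not contained in the
neighborhood of a triple cut or of a maximal nondegenerate flower. -/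
def IsBigCut {V : Type*} (G : SimpleGraph V) (M : MixedSet V) : Prop :=
  M ∈ cutClass G 3 ∧ ¬ IsTrivialCut G M ∧
    (∀ S ∈ tripleLines G, ¬ M.support ⊆ tripleNeighborhood G S) ∧
    ∀ F : FlowerData V, IsMaximalFlower G F → IsNondegenerateFlower G F →
      ¬ M.support ⊆ flowerNeighborhood G F

/-- The complex of a big cut: the 3-cutsets contained in its vertex set, except its boundaries. -/
def bigCutComplex {V : Type*} (G : SimpleGraph V) (M : MixedSet V) : Set (Set V) :=
  {T | T ∈ threeCutsets G ∧ T ⊆ M.support ∧ ¬ IsCutBoundary G M T}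

/-- `IsBigComplex G C B`: `C` is a big complex of `G`, and `B` is the set of its boundaries. -/
inductive IsBigComplex {V : Type*} (G : SimpleGraph V) : Set (Set V) → Set (Set V) → Prop
  | triple (S : Set V) (hS : S ∈ tripleLines G) :
      IsBigComplex G (tripleComplex G S) (tripleBoundaries G S)
  | flower (F : FlowerData V) (hF : IsMaximalFlower G F) (hF' : IsNondegenerateFlower G F) :
      IsBigComplex G (flowerComplex G F) (flowerBoundaries G F)
  | bigCut (M : MixedSet V) (hM : IsBigCut G M) :
      IsBigComplex G (bigCutComplex G M) {T | IsCutBoundary G M T}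

/-- `T` belongs to some big complex. -/
def InBigComplex {V : Type*} (G : SimpleGraph V) (T : Set V) : Prop :=
  ∃ C B, IsBigComplex G C B ∧ T ∈ C

/-- `T` is a boundary of some big complex. -/
def IsBigComplexBoundary {V : Type*} (G : SimpleGraph V) (T : Set V) : Prop :=
  ∃ C B, IsBigComplex G C B ∧ T ∈ B

/-- A small cut: a cut with one edge whose boundaries are nonsingle 3-cutsets belonging to no big
complex. -/
def IsSmallCut {V : Type*} (G : SimpleGraph V) (M : MixedSet V) : Prop :=
  M ∈ cutClass G 1 ∧ ∀ T, IsCutBoundary G M T →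
    T ∈ threeCutsets G ∧ ¬ IsSingle G T ∧ ¬ InBigComplex G T

/-- The complex of a small cut consists of its boundaries. -/
def smallCutComplex {V : Type*} (G : SimpleGraph V) (M : MixedSet V) : Set (Set V) :=
  {T | IsCutBoundary G M T}

/-- The complexes of `G`. -/
inductive IsComplex {V : Type*} (G : SimpleGraph V) : Set (Set V) → Prop
  | big (C B : Set (Set V)) (hC : IsBigComplex G C B) : IsComplex G C
  | single (T : Set V) (hT : IsSingle G T) : IsComplex G {T}
  | smallCut (M : MixedSet V) (hM : IsSmallCut G M) : IsComplex G (smallCutComplex G M)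
  | other (T : Set V) (hT : T ∈ threeCutsets G) (hbig : ¬ InBigComplex G T)
      (hsmall : ∀ M, IsSmallCut G M → T ∉ smallCutComplex G M) : IsComplex G {T}

end ThreeCuts

/-! The proof distinguishes the kinds of complexes; the substance lies in the last kind. A big cut
is a matching of three edges a_i b_i, and its complex contains both {a_0, a_1, b_2} and {a_0, a_2,
b_1}. The complex of a flower contains the cutsets that generate the flower, and these cover more
than three vertices. The two boundaries of a one-edge cut differ. Hence none of these complexes is a
singleton. A triple complex contains the trivial cutset subordinated to its line, so T is trivial if
it is the only element.

Now let T belong to no big complex and to no complex of a small cut, and let T be neither single,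
nor trivial, nor a boundary of a big complex. Two dependent cutsets with a common vertex p generate
a flower with center p and four petals. A maximal flower above it is nondegenerate or lies in V(M)
for a three-edge cut M; either way T is in a big complex or is a boundary of one
(`TriCond.inBigComplex_or_boundary`). So T is independent with every cutset meeting it, and some
cutset S disjoint from T splits T, separating one vertex t₁ from the other two, t₂ and t₃. Every
component of G - T meets S, and S does not lie in a single one. In a component containing only one
vertex s of S, the only neighbor of t₁ is s, because {s, t₁} does not separate the graph. If there
are three components, the neighborhood of t₁ is S and T is the line of a triple cut, which is
excluded. If there are two, K₁ with one vertex s₁ of S and K₂ with two, then T is complemented by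
t₁s₁ (`Config`), and the second boundary is T' = {s₁, t₂, t₃}.

If T' were not single, it would have to lie in a big complex, since the cut is not small. The main
work, `Config.inBigComplex_or_boundary`, shows that T would then lie in the same complex or be one
of its boundaries. The engine is a contrast: in the component E = K₂ ∪ {t₁} of G - T' the vertices
t₂ and t₃ have at least two neighbors each, while s₁ has only t₁. For a big cut this forces T to be
a boundary of the cut; for a triple cut it forces t₁ into the neighborhood; for a flower it forces T
to consist of two consecutive petals and either the center or a neighborhood vertex between them
(`FlowerShape.boundaryShape`). Finally, a complementing edge at t₂ or t₃ would produce, in the same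
way, a single cutset that S splits, and a second edge at t₁ would leave t₁ with degree two.

Components are treated as minimal nonempty closed sets, where a closed set is a union of components,
so no paths are needed. Triconnectivity enters as: no pair separates, and each vertex of a
separating triple has neighbors on every side. -/

namespace ThreeCuts

variable {V : Type*} {G : SimpleGraph V}

/-! ### Closed sets -/

/-- `D` is a union of components of `G - M`. -/
def MClosed (G : SimpleGraph V) (M : MixedSet V) (D : Set V) : Prop :=
  (∀ x ∈ D, x ∉ M.verts) ∧
    ∀ x ∈ D, ∀ y, G.Adj x y → y ∉ M.verts → s(x, y) ∉ M.edges → y ∈ D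

/-- `D` is a union of components of `G - R`. -/
def Closed (G : SimpleGraph V) (R D : Set V) : Prop :=
  (∀ x ∈ D, x ∉ R) ∧ ∀ x ∈ D, ∀ y, G.Adj x y → y ∈ D ∨ y ∈ R

/-- `H` is a component of `G - M`, expressed by closed sets. -/
def MComp (G : SimpleGraph V) (M : MixedSet V) (H : Set V) : Prop :=
  H.Nonempty ∧ MClosed G M H ∧ ∀ Z ⊆ H, Z.Nonempty → MClosed G M Z → Z = H

/-- `H` is a component of `G - R`, expressed by closed sets. -/
def Comp (G : SimpleGraph V) (R H : Set V) : Prop :=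
  H.Nonempty ∧ Closed G R H ∧ ∀ Z ⊆ H, Z.Nonempty → Closed G R Z → Z = H

theorem mclosed_vset {R D : Set V} : MClosed G (vset R) D ↔ Closed G R D := by
  simp only [MClosed, Closed, vset, Set.mem_empty_iff_false, not_false_eq_true, true_imp_iff]
  grind

theorem mcomp_vset {R H : Set V} : MComp G (vset R) H ↔ Comp G R H := by
  simp only [MComp, Comp, mclosed_vset]

theorem MClosed.compl {M : MixedSet V} {D : Set V} (h : MClosed G M D) :
    MClosed G M (D ∪ M.verts)ᶜ := by
  refine ⟨fun x hx h' => hx (Or.inr h'), fun x hx y hxy hy he hy' => ?_⟩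
  rcases hy' with hy' | hy'
  · refine hx (Or.inl (h.2 y hy' x hxy.symm (fun h' => hx (Or.inr h')) ?_))
    rwa [Sym2.eq_swap]
  · exact hy hy'

theorem MClosed.inter {M : MixedSet V} {D D' : Set V} (h : MClosed G M D) (h' : MClosed G M D') :
    MClosed G M (D ∩ D') :=
  ⟨fun x hx => h.1 x hx.1, fun x hx y hxy hy he => ⟨h.2 x hx.1 y hxy hy he, h'.2 x hx.2 y hxy hy he⟩⟩

theorem MClosed.diff {M : MixedSet V} {D D' : Set V} (h : MClosed G M D) (h' : MClosed G M D') :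
    MClosed G M (D \ D') := by
  refine ⟨fun x hx => h.1 x hx.1, fun x hx y hxy hy he => ⟨h.2 x hx.1 y hxy hy he, fun hy' => ?_⟩⟩
  refine hx.2 (h'.2 y hy' x hxy.symm (h.1 x hx.1) ?_)
  rwa [Sym2.eq_swap]

theorem Closed.compl {R D : Set V} (h : Closed G R D) : Closed G R (D ∪ R)ᶜ :=
  mclosed_vset.1 (mclosed_vset.2 h).compl

/-- Minimality of H applied to H ∩ D. This replaces path arguments: connectedness is always used by
exhibiting a closed set and one common vertex. -/
theorem MComp.subset_or_disjoint {M : MixedSet V} {H D : Set V} (h : MComp G M H)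
    (hD : MClosed G M D) : H ⊆ D ∨ ∀ x ∈ H, x ∉ D := by
  by_cases hn : (H ∩ D).Nonempty
  · left
    have := h.2.2 _ Set.inter_subset_left hn (h.2.1.inter hD)
    rw [← this]; exact Set.inter_subset_right
  · right
    exact fun x hx hx' => hn ⟨x, hx, hx'⟩

theorem Comp.subset_or_disjoint {R H D : Set V} (h : Comp G R H) (hD : Closed G R D) :
    H ⊆ D ∨ ∀ x ∈ H, x ∉ D :=
  (mcomp_vset.2 h).subset_or_disjoint (mclosed_vset.2 hD)

theorem Comp.subset_of_mem {R H D : Set V} (h : Comp G R H) (hD : Closed G R D) {x : V}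
    (hx : x ∈ H) (hx' : x ∈ D) : H ⊆ D :=
  (h.subset_or_disjoint hD).resolve_right fun h' => h' x hx hx'

theorem Comp.eq_of_mem {R H D : Set V} (h : Comp G R H) (hD : Comp G R D) {x : V}
    (hx : x ∈ H) (hx' : x ∈ D) : H = D :=
  (h.subset_of_mem hD.2.1 hx hx').antisymm (hD.subset_of_mem h.2.1 hx' hx)

/-! ### Components and splitting in terms of closed sets -/

theorem MClosed.mem_of_reachable {M : MixedSet V} {D : Set V} (h : MClosed G M D)
    {x y : ↥(M.verts)ᶜ} (hxy : (remove G M).Reachable x y) (hx : (x : V) ∈ D) : (y : V) ∈ D := by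
  obtain ⟨w⟩ := hxy
  induction w with
  | nil => exact hx
  | @cons _ v _ hadj _ ih =>
    apply ih
    simp only [remove, SimpleGraph.comap_adj, Function.Embedding.subtype_apply,
      SimpleGraph.deleteEdges_adj] at hadj
    exact h.2 _ hx _ hadj.1 v.2 hadj.2

/-- The vertices reachable from a given one in `G - M`. -/
def reach (G : SimpleGraph V) (M : MixedSet V) (x : ↥(M.verts)ᶜ) : Set V :=
  {v | ∃ h : v ∈ (M.verts)ᶜ, (remove G M).Reachable x ⟨v, h⟩}

theorem mclosed_reach {M : MixedSet V} (x : ↥(M.verts)ᶜ) : MClosed G M (reach G M x) := by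
  refine ⟨fun v hv => hv.1, ?_⟩
  rintro v ⟨hv, hr⟩ y hvy hy he
  refine ⟨hy, hr.trans (SimpleGraph.Adj.reachable ?_)⟩
  simp only [remove, SimpleGraph.comap_adj, Function.Embedding.subtype_apply,
    SimpleGraph.deleteEdges_adj]
  exact ⟨hvy, he⟩

theorem mcomp_reach {M : MixedSet V} (x : ↥(M.verts)ᶜ) : MComp G M (reach G M x) := by
  refine ⟨⟨x, x.2, SimpleGraph.Reachable.refl _⟩, mclosed_reach x, fun Z hZ hne hZc => ?_⟩
  refine hZ.antisymm ?_
  rintro v ⟨hv, hr⟩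
  obtain ⟨z, hz⟩ := hne
  obtain ⟨hz', hrz⟩ := hZ hz
  exact hZc.mem_of_reachable (x := ⟨z, hz'⟩) (y := ⟨v, hv⟩) (hrz.symm.trans hr) hz

theorem MComp.reach_eq {M : MixedSet V} {H : Set V} (h : MComp G M H) (x : ↥(M.verts)ᶜ)
    (hx : (x : V) ∈ H) : reach G M x = H := by
  refine h.2.2 (reach G M x) ?_ ⟨x, x.2, SimpleGraph.Reachable.refl _⟩ (mclosed_reach x)
  rintro v ⟨hv, hr⟩
  exact h.2.1.mem_of_reachable hr hx

/-- The bridge from the reachability definition of components to minimal closed sets; the set of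
vertices reachable from a point is the minimal closed set around it. -/
theorem isComponent_iff {M : MixedSet V} {H : Set V} : IsComponent G M H ↔ MComp G M H := by
  have key : ∀ x : ↥(M.verts)ᶜ,
      Subtype.val '' ((remove G M).connectedComponentMk x).supp = reach G M x := by
    intro x
    ext v
    simp only [reach, Set.mem_image, SimpleGraph.ConnectedComponent.mem_supp_iff,
      SimpleGraph.ConnectedComponent.eq, Set.mem_ofPred_eq]
    constructor
    · rintro ⟨y, hy, rfl⟩
      exact ⟨y.2, hy.symm⟩
    · rintro ⟨hv, hr⟩
      exact ⟨⟨v, hv⟩, hr.symm, rfl⟩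
  constructor
  · rintro ⟨c, rfl⟩
    induction c using SimpleGraph.ConnectedComponent.ind with
    | h x => rw [key]; exact mcomp_reach x
  · intro h
    obtain ⟨x, hx⟩ := h.1
    refine ⟨(remove G M).connectedComponentMk ⟨x, h.2.1.1 x hx⟩, ?_⟩
    rw [key]
    exact (h.reach_eq _ hx).symm

theorem isComponent_vset_iff {R H : Set V} : IsComponent G (vset R) H ↔ Comp G R H :=
  isComponent_iff.trans mcomp_vset

theorem disconnects_iff {M : MixedSet V} :
    Disconnects G M ↔ ∃ D, MClosed G M D ∧ D.Nonempty ∧ ∃ z, z ∉ D ∧ z ∉ M.verts := by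
  constructor
  · intro h
    simp only [Disconnects, SimpleGraph.Preconnected, not_forall] at h
    obtain ⟨x, y, hxy⟩ := h
    exact ⟨reach G M x, mclosed_reach x, ⟨x, x.2, SimpleGraph.Reachable.refl _⟩, y,
      fun ⟨_, hr⟩ => hxy hr, y.2⟩
  · rintro ⟨D, hD, ⟨x, hx⟩, z, hz, hz'⟩ h
    exact hz (hD.mem_of_reachable (h ⟨x, hD.1 x hx⟩ ⟨z, hz'⟩) hx)

theorem splits_iff {R X : Set V} :
    Splits G R X ↔ ∃ D, Closed G R D ∧ (∃ x ∈ X, x ∈ D) ∧ ∃ y ∈ X, y ∉ D ∧ y ∉ R := by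
  simp only [← mclosed_vset]
  constructor
  · rintro ⟨x, y, hx, hy, hxy⟩
    exact ⟨reach G _ x, mclosed_reach x, ⟨x, hx, x.2, SimpleGraph.Reachable.refl _⟩, y, hy,
      fun ⟨_, hr⟩ => hxy hr, y.2⟩
  · rintro ⟨D, hD, ⟨x, hx, hxD⟩, y, hy, hyD, hyR⟩
    exact ⟨⟨x, hD.1 x hxD⟩, ⟨y, hyR⟩, hx, hy, fun h => hyD (hD.mem_of_reachable h hxD)⟩

theorem Splits.mono {R X Y : Set V} (h : Splits G R X) (hXY : X ⊆ Y) : Splits G R Y := by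
  obtain ⟨x, y, hx, hy, hxy⟩ := h
  exact ⟨x, y, hXY hx, hXY hy, hxy⟩

theorem not_splits_iff {R X : Set V} :
    ¬ Splits G R X ↔ ∀ D, Closed G R D → ∀ x ∈ X, x ∈ D → ∀ y ∈ X, y ∈ D ∨ y ∈ R := by
  rw [splits_iff]; grind

theorem mem_threeCutsets_iff {S : Set V} : S ∈ threeCutsets G ↔
    S.ncard = 3 ∧ ∃ D, Closed G S D ∧ D.Nonempty ∧ ∃ z, z ∉ D ∧ z ∉ S := by
  simp only [threeCutsets, Set.mem_ofPred_eq, disconnects_iff, mclosed_vset]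
  rfl

theorem exists_comp_mem {R : Set V} {x : V} (hx : x ∉ R) : ∃ H, Comp G R H ∧ x ∈ H :=
  ⟨reach G (vset R) ⟨x, hx⟩, mcomp_vset.1 (mcomp_reach _), hx, SimpleGraph.Reachable.refl _⟩

theorem exists_mcomp_mem {M : MixedSet V} {x : V} (hx : x ∉ M.verts) : ∃ H, MComp G M H ∧ x ∈ H :=
  ⟨reach G M ⟨x, hx⟩, mcomp_reach _, hx, SimpleGraph.Reachable.refl _⟩

/-! ### Consequences of triconnectivity -/

/-- No set of at most two vertices separates the graph, which has more than six vertices. -/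
structure TriCond (G : SimpleGraph V) : Prop where
  closed_univ : ∀ R D : Set V, R.ncard ≤ 2 → Closed G R D → D.Nonempty → ∀ z, z ∈ D ∨ z ∈ R
  card : 6 < Nat.card V

theorem Closed.insert {R D : Set V} (h : Closed G R D) (v : V) :
    Closed G (insert v R) (D \ {v}) := by
  refine ⟨fun x hx => ?_, fun x hx y hxy => ?_⟩
  · have := h.1 x hx.1; simp_all
  · have := h.2 x hx.1 y hxy; simp; grind

theorem exists_notMem_of_ncard [Finite V] {s : Set V} (h : s.ncard < Nat.card V) : ∃ v, v ∉ s := by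
  by_contra! hs
  rw [Set.eq_univ_of_forall hs, Set.ncard_univ] at h
  exact lt_irrefl _ h

/-- The definition of 3-connectivity tests only sets of exactly two vertices. A smaller separating
set is enlarged one vertex at a time, sparing one vertex on each side; there are enough vertices for
this. -/
theorem IsKConnected.triCond [Finite V] (hG : IsKConnected G 3) (hV : 6 < Nat.card V) :
    TriCond G := by
  have two : ∀ R D : Set V, R.ncard = 2 → Closed G R D → D.Nonempty → ∀ z, z ∈ D ∨ z ∈ R := by
    intro R D hR hD ⟨x, hx⟩ z
    by_contra! hz
    have hcon := (hG.2 R (by omega)).preconnected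
    have : Disconnects G (vset R) := disconnects_iff.2
      ⟨D, mclosed_vset.2 hD, ⟨x, hx⟩, z, hz⟩
    apply this
    have he : G.deleteEdges (vset R).edges = G := by simp [vset]
    unfold remove
    rw [he]
    exact hcon
  -- The induction runs over the number of vertices missing from R.
  have step : ∀ n : ℕ, ∀ R D : Set V, R.ncard + n = 2 → Closed G R D → D.Nonempty →
      ∀ z, z ∈ D ∨ z ∈ R := by
    intro n
    induction n with
    | zero => exact fun R D hR => two R D (by omega)
    | succ n ih =>
      intro R D hR hD ⟨x, hx⟩ z
      by_contra! hz
      have hxz : x ≠ z := fun h => hz.1 (h ▸ hx)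
      obtain ⟨v, hv⟩ : ∃ v, v ∉ insert x (insert z R) := by
        apply exists_notMem_of_ncard
        have := Set.ncard_insert_le x (insert z R)
        have := Set.ncard_insert_le z R
        omega
      simp only [Set.mem_insert_iff, not_or] at hv
      have := ih (insert v R) (D \ {v}) (by
        rw [Set.ncard_insert_of_notMem hv.2.2]; omega) (hD.insert v)
        ⟨x, hx, fun h => hv.1 h.symm⟩ z
      simp only [Set.mem_sdiff, Set.mem_insert_iff, Set.mem_singleton_iff] at this
      grind
  exact ⟨fun R D hR => step (2 - R.ncard) R D (by omega), hV⟩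

/-- The form in which 3-connectivity is mostly contradicted: D has all its outside neighbors among
a, b, yet z lies beyond. The vertices a and b may coincide. -/
theorem TriCond.pair (h : TriCond G) {D : Set V} {a b z x : V}
    (hD : ∀ x ∈ D, ∀ y, G.Adj x y → y ∈ D ∨ y = a ∨ y = b) (hx : x ∈ D) (ha : a ∉ D) (hb : b ∉ D)
    (hz : z ∉ D) (hza : z ≠ a) (hzb : z ≠ b) : False := by
  have h2 : ({a, b} : Set V).ncard ≤ 2 := by
    have := Set.ncard_insert_le a ({b} : Set V)
    rw [Set.ncard_singleton] at this
    exact this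
  have := h.closed_univ {a, b} D h2
    ⟨fun x hx => by simp only [Set.mem_insert_iff, Set.mem_singleton_iff]; grind,
      fun x hx y hy => by simpa using hD x hx y hy⟩ ⟨x, hx⟩ z
  simp only [Set.mem_insert_iff, Set.mem_singleton_iff] at this
  grind

/-- If three vertices separate a nonempty set, then each of them has a neighbor in it. -/
theorem TriCond.exists_adj (h : TriCond G) {D : Set V} {a b c x : V}
    (hD : ∀ x ∈ D, ∀ y, G.Adj x y → y ∈ D ∨ y = a ∨ y = b ∨ y = c) (hx : x ∈ D)
    (ha : a ∉ D) (hb : b ∉ D) (hc : c ∉ D) (hab : a ≠ b) (hac : a ≠ c) : ∃ y ∈ D, G.Adj a y := by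
  by_contra! hn
  refine h.pair (D := D) (a := b) (b := c) (z := a) (x := x) ?_ hx hb hc ha hab hac
  intro x hx y hxy
  rcases hD x hx y hxy with h1 | h1 | h1
  · exact Or.inl h1
  · exact absurd (h1 ▸ hxy.symm) (hn x hx)
  · exact Or.inr h1

/-- Minimum degree three: otherwise a and b would separate x from the rest. -/
theorem TriCond.exists_adj_ne (h : TriCond G) (x a b : V) : ∃ y, G.Adj x y ∧ y ≠ a ∧ y ≠ b := by
  have : Finite V := Nat.finite_of_card_ne_zero (by have := h.card; omega)
  have hne : ∀ s : Finset V, s.card ≤ 6 → ∃ z, z ∉ s := by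
    intro s hs
    obtain ⟨z, hz⟩ := exists_notMem_of_ncard (s := (s : Set V)) (by
      rw [Set.ncard_coe_finset]; have := h.card; omega)
    exact ⟨z, by simpa using hz⟩
  classical
  by_contra! hn
  have main : ∀ a b : V, a ≠ x → b ≠ x → (∀ y, G.Adj x y → y ≠ a → y = b) → False := by
    intro a b ha hb hn
    obtain ⟨z, hz⟩ := hne {x, a, b} (Finset.card_le_three.trans (by norm_num))
    simp only [Finset.mem_insert, Finset.mem_singleton, not_or] at hz
    refine h.pair (D := {x}) (a := a) (b := b) (z := z) (x := x) ?_ rfl ?_ ?_ ?_ hz.2.1 hz.2.2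
    · rintro y rfl y' hy
      by_cases h1 : y' = a
      · exact Or.inr (Or.inl h1)
      · exact Or.inr (Or.inr (hn y' hy h1))
    · simpa using ha
    · simpa using hb
    · simpa using hz.1
  obtain ⟨w, hw⟩ := hne {x} (by simp)
  simp only [Finset.mem_singleton] at hw
  -- A vertex equal to x excludes no neighbor and is replaced by an arbitrary w or by the other one
  -- of a, b, so that `main` applies.
  by_cases ha : a = x <;> by_cases hb : b = x
  · exact main w w hw hw fun y hy _ => absurd (hn y hy (ha ▸ hy.ne')) (hb ▸ hy.ne')
  · exact main w b hw hb fun y hy _ => hn y hy (ha ▸ hy.ne')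
  · exact main a w ha hw fun y hy h1 => absurd (hn y hy h1) (hb ▸ hy.ne')
  · exact main a b ha hb hn

/-- Every vertex of a 3-set that separates a nonempty set has a neighbor in it. -/
theorem TriCond.exists_adj_of_closed (h : TriCond G) {R D : Set V} (hR : R.ncard = 3)
    (hD : Closed G R D) (hne : D.Nonempty) {a : V} (ha : a ∈ R) : ∃ y ∈ D, G.Adj a y := by
  by_contra! hn
  obtain ⟨x, hx⟩ := hne
  have haD : a ∉ D := fun h' => hD.1 a h' ha
  have hfin : R.Finite := Set.finite_of_ncard_ne_zero (by omega)
  have hc : (R \ {a}).ncard ≤ 2 := by rw [Set.ncard_sdiff_singleton_of_mem ha]; omega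
  have := h.closed_univ (R \ {a}) D hc ⟨fun y hy h' => hD.1 y hy h'.1, fun y hy z hyz => by
    rcases hD.2 y hy z hyz with h1 | h1
    · exact Or.inl h1
    · refine Or.inr ⟨h1, ?_⟩
      rintro rfl
      exact hn y hy hyz.symm⟩ ⟨x, hx⟩ a
  rcases this with h1 | h1
  · exact haD h1
  · exact h1.2 rfl

/-- Dependence of cutsets is symmetric. -/
theorem TriCond.splits_symm (h : TriCond G) {S T : Set V}
    (hT : T ∈ threeCutsets G) (hST : Splits G S T) : Splits G T S := by
  by_contra hn
  rw [not_splits_iff] at hn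
  obtain ⟨D, hD, ⟨x, hxT, hxD⟩, y, hyT, hyD, hyS⟩ := splits_iff.1 hST
  obtain ⟨hT3, K, hK, hKne, z, hzK, hzT⟩ := mem_threeCutsets_iff.1 hT
  -- some closed set of `T` avoids `S`
  obtain ⟨K', hK', hK'ne, hK'S⟩ : ∃ K', Closed G T K' ∧ K'.Nonempty ∧ ∀ s ∈ S, s ∉ K' := by
    by_cases hKS : ∃ s ∈ S, s ∈ K
    · obtain ⟨s, hs, hsK⟩ := hKS
      refine ⟨(K ∪ T)ᶜ, hK.compl, ⟨z, by simp [hzK, hzT]⟩, fun s' hs' => ?_⟩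
      have := hn K hK s hs hsK s' hs'
      simp only [Set.mem_compl_iff, Set.mem_union, not_not]
      exact this
    · exact ⟨K, hK, hKne, fun s hs hsK => hKS ⟨s, hs, hsK⟩⟩
  -- Since K' avoids S, the neighbor k of x stays in D. Then K' ∩ D is a nonempty closed set of G -
  -- T, so y also has a neighbor in it, which drags y into D ∪ S.
  obtain ⟨k, hk, hxk⟩ := h.exists_adj_of_closed hT3 hK' hK'ne hxT
  have hkD : k ∈ D := by
    rcases hD.2 x hxD k hxk with h1 | h1
    · exact h1
    · exact absurd hk (hK'S k h1)
  have hyD' : y ∈ (D ∪ S)ᶜ := by simp [hyD, hyS]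
  have hcl : Closed G T (K' ∩ D) := by
    refine ⟨fun v hv => hK'.1 v hv.1, fun v hv w hvw => ?_⟩
    rcases hK'.2 v hv.1 w hvw with h1 | h1
    · rcases hD.2 v hv.2 w hvw with h2 | h2
      · exact Or.inl ⟨h1, h2⟩
      · exact absurd h1 (hK'S w h2)
    · exact Or.inr h1
  obtain ⟨k', hk', hyk'⟩ := h.exists_adj_of_closed hT3 hcl ⟨k, hk, hkD⟩ hyT
  have := hD.2 k' hk'.2 y hyk'.symm
  tauto


/-! ### Three-element cutsets, and cutsets complemented by an edge -/

theorem ncard_triple {a b c : V} (hab : a ≠ b) (hac : a ≠ c) (hbc : b ≠ c) :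
    ({a, b, c} : Set V).ncard = 3 :=
  Set.ncard_eq_three.2 ⟨a, b, c, hab, hac, hbc, rfl⟩

theorem mem_triple {a b c x : V} : x ∈ ({a, b, c} : Set V) ↔ x = a ∨ x = b ∨ x = c := by
  simp only [Set.mem_insert_iff, Set.mem_singleton_iff]

theorem triple_mem_threeCutsets {a b c x z : V} {D : Set V} (hab : a ≠ b) (hac : a ≠ c)
    (hbc : b ≠ c) (hD : Closed G {a, b, c} D) (hx : x ∈ D) (hz : z ∉ D)
    (hz' : z ∉ ({a, b, c} : Set V)) : ({a, b, c} : Set V) ∈ threeCutsets G :=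
  mem_threeCutsets_iff.2 ⟨ncard_triple hab hac hbc, D, hD, ⟨x, hx⟩, z, hz, hz'⟩

theorem closed_triple {a b c : V} {D : Set V} (ha : a ∉ D) (hb : b ∉ D) (hc : c ∉ D)
    (h : ∀ x ∈ D, ∀ y, G.Adj x y → y ∈ D ∨ y = a ∨ y = b ∨ y = c) : Closed G {a, b, c} D := by
  simp only [Closed, mem_triple]
  refine ⟨fun x hx h' => ?_, h⟩
  rcases h' with rfl | rfl | rfl <;> contradiction

/-- The situation where the cutset `T = {t₁, t₂, t₃}` can be complemented by the edge `t₁s₁`,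
`K₁` and `K₂` are the two components of `G - T`, and `T` is independent with all cutsets that
meet it. -/
structure Config (G : SimpleGraph V) (T K₁ K₂ : Set V) (t₁ t₂ t₃ s₁ : V) : Prop where
  tri : TriCond G
  eq : T = {t₁, t₂, t₃}
  ne12 : t₁ ≠ t₂
  ne13 : t₁ ≠ t₃
  ne23 : t₂ ≠ t₃
  comp1 : Comp G T K₁
  comp2 : Comp G T K₂
  cover : ∀ v, v ∈ T ∨ v ∈ K₁ ∨ v ∈ K₂
  disj : ∀ v ∈ K₁, v ∉ K₂
  mem : s₁ ∈ K₁
  adj : G.Adj t₁ s₁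
  uniq : ∀ y ∈ K₁, G.Adj t₁ y → y = s₁
  more : ∃ y ∈ K₁, y ≠ s₁
  indep : ∀ R ∈ threeCutsets G, (∃ x ∈ R, x ∈ T) → ¬ Splits G R T
  nontriv : ¬ IsTrivialCutset G T

namespace Config

variable {T K₁ K₂ : Set V} {t₁ t₂ t₃ s₁ : V} (h : Config G T K₁ K₂ t₁ t₂ t₃ s₁)
include h

theorem swap : Config G T K₁ K₂ t₁ t₃ t₂ s₁ :=
  { h with
    eq := by rw [h.eq, Set.pair_comm]
    ne12 := h.ne13
    ne13 := h.ne12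
    ne23 := h.ne23.symm }

theorem mem_T {x : V} : x ∈ T ↔ x = t₁ ∨ x = t₂ ∨ x = t₃ := by rw [h.eq, mem_triple]

theorem ncard_T : T.ncard = 3 := by rw [h.eq, ncard_triple h.ne12 h.ne13 h.ne23]

theorem ne_of_mem {x : V} (hx : x ∈ K₁ ∨ x ∈ K₂) : x ≠ t₁ ∧ x ≠ t₂ ∧ x ≠ t₃ := by
  have : x ∉ T := by
    rcases hx with hx | hx
    · exact h.comp1.2.1.1 x hx
    · exact h.comp2.2.1.1 x hx
  rw [h.mem_T] at this
  tauto

theorem t1_notMem : t₁ ∉ K₁ ∧ t₁ ∉ K₂ :=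
  ⟨fun h' => (h.ne_of_mem (Or.inl h')).1 rfl, fun h' => (h.ne_of_mem (Or.inr h')).1 rfl⟩

theorem t2_notMem : t₂ ∉ K₁ ∧ t₂ ∉ K₂ :=
  ⟨fun h' => (h.ne_of_mem (Or.inl h')).2.1 rfl, fun h' => (h.ne_of_mem (Or.inr h')).2.1 rfl⟩

theorem t3_notMem : t₃ ∉ K₁ ∧ t₃ ∉ K₂ := h.swap.t2_notMem

theorem s1_ne : s₁ ≠ t₁ ∧ s₁ ≠ t₂ ∧ s₁ ≠ t₃ := h.ne_of_mem (Or.inl h.mem)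

theorem s1_notMem : s₁ ∉ K₂ := h.disj _ h.mem

theorem not_adj {x y : V} (hx : x ∈ K₁) (hy : y ∈ K₂) : ¬ G.Adj x y := fun hxy => by
  rcases h.comp1.2.1.2 x hx y hxy with h1 | h1
  · exact h.disj y h1 hy
  · exact h.comp2.2.1.1 y hy h1

theorem adj_uniq {y : V} (hy : y = t₁ ∨ y ∈ K₂) (hs : G.Adj s₁ y) : y = t₁ :=
  hy.resolve_right fun h' => h.not_adj h.mem h' hs

theorem exists_adj1 {x : V} (hx : x ∈ T) : ∃ y ∈ K₁, G.Adj x y :=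
  h.tri.exists_adj_of_closed h.ncard_T h.comp1.2.1 h.comp1.1 hx

theorem exists_adj2 {x : V} (hx : x ∈ T) : ∃ y ∈ K₂, G.Adj x y :=
  h.tri.exists_adj_of_closed h.ncard_T h.comp2.2.1 h.comp2.1 hx

theorem t1_mem : t₁ ∈ T := h.mem_T.2 (Or.inl rfl)
theorem t2_mem : t₂ ∈ T := h.mem_T.2 (Or.inr (Or.inl rfl))
theorem t3_mem : t₃ ∈ T := h.mem_T.2 (Or.inr (Or.inr rfl))

/-- As s₁ is the only neighbor of t₁ in K₁, the vertex t₁ changes sides when s₁ takes its place in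
the cutset. The set K₂ ∪ {t₁} is denoted E in later comments, and {s₁, t₂, t₃} is denoted T'. -/
theorem closed_E : Closed G {s₁, t₂, t₃} (insert t₁ K₂) := by
  have h1 := h.t1_notMem
  have h2 := h.t2_notMem
  have h3 := h.t3_notMem
  have := h.s1_ne
  have := h.s1_notMem
  have := h.ne12
  have := h.ne13
  refine closed_triple (by simp; tauto) (by simp; tauto) (by simp; tauto) ?_
  intro x hx y hxy
  simp only [Set.mem_insert_iff] at hx ⊢
  rcases hx with rfl | hx
  · rcases h.cover y with hy | hy | hy
    · rw [h.mem_T] at hy; tauto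
    · exact Or.inr (Or.inl (h.uniq y hy hxy))
    · tauto
  · have := h.comp2.2.1.2 x hx y hxy
    rw [h.mem_T] at this; tauto

/-- A closed set Z inside E meets K₂ in a closed set of G - T, hence contains all of K₂, and then
t₁, which has a neighbor there. -/
theorem comp_E : Comp G {s₁, t₂, t₃} (insert t₁ K₂) := by
  refine ⟨⟨t₁, Set.mem_insert _ _⟩, h.closed_E, fun Z hZ hne hZc => ?_⟩
  have hcl : Closed G T (Z ∩ K₂) := by
    refine ⟨fun x hx => h.comp2.2.1.1 x hx.2, fun x hx y hxy => ?_⟩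
    rcases h.comp2.2.1.2 x hx.2 y hxy with h1 | h1
    · rcases hZc.2 x hx.1 y hxy with h2 | h2
      · exact Or.inl ⟨h2, h1⟩
      · rw [mem_triple] at h2
        rcases h2 with rfl | rfl | rfl
        · exact absurd h1 h.s1_notMem
        · exact Or.inr h.t2_mem
        · exact Or.inr h.t3_mem
    · exact Or.inr h1
  have hZT : ∀ y ∈ K₂, y ∉ ({s₁, t₂, t₃} : Set V) := fun y hy =>
    h.closed_E.1 y (Or.inr hy)
  have hne2 : (Z ∩ K₂).Nonempty := by
    obtain ⟨z, hz⟩ := hne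
    rcases hZ hz with rfl | hz2
    · obtain ⟨y, hy, hy'⟩ := h.exists_adj2 h.t1_mem
      exact ⟨y, (hZc.2 z hz y hy').resolve_right (hZT y hy), hy⟩
    · exact ⟨z, hz, hz2⟩
  have hK := h.comp2.2.2 _ Set.inter_subset_right hne2 hcl
  have hK2 : K₂ ⊆ Z := by rw [← hK]; exact Set.inter_subset_left
  refine hZ.antisymm (Set.insert_subset ?_ hK2)
  obtain ⟨y, hy, hy'⟩ := h.exists_adj2 h.t1_mem
  exact (hZc.2 y (hK2 hy) t₁ hy'.symm).resolve_right
    (h.closed_E.1 _ (Set.mem_insert _ _))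

theorem closed_K1 : Closed G {s₁, t₂, t₃} (K₁ \ {s₁}) := by
  refine closed_triple (by simp) (fun h' => h.t2_notMem.1 h'.1) (fun h' => h.t3_notMem.1 h'.1) ?_
  intro x hx y hxy
  have := h.comp1.2.1.2 x hx.1 y hxy
  rw [h.mem_T] at this
  rcases this with h1 | rfl | h1
  · by_cases hy : y = s₁
    · exact Or.inr (Or.inl hy)
    · exact Or.inl ⟨h1, hy⟩
  · exact absurd (h.uniq x hx.1 hxy.symm) hx.2
  · exact Or.inr (Or.inr h1)

theorem ncard_T' : ({s₁, t₂, t₃} : Set V).ncard = 3 :=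
  ncard_triple h.s1_ne.2.1 h.s1_ne.2.2 h.ne23

theorem T'_mem : ({s₁, t₂, t₃} : Set V) ∈ threeCutsets G := by
  obtain ⟨y, hy, hne⟩ := h.more
  refine mem_threeCutsets_iff.2 ⟨h.ncard_T', _, h.closed_E, ⟨t₁, Set.mem_insert _ _⟩, y, ?_, ?_⟩
  · rintro (rfl | h')
    · exact h.t1_notMem.1 hy
    · exact h.disj y hy h'
  · exact h.closed_K1.1 y ⟨hy, hne⟩

theorem T_mem : T ∈ threeCutsets G :=
  mem_threeCutsets_iff.2 ⟨h.ncard_T, K₁, h.comp1.2.1, h.comp1.1, by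
    obtain ⟨y, hy⟩ := h.comp2.1
    exact ⟨y, fun h' => h.disj y h' hy, h.comp2.2.1.1 y hy⟩⟩

theorem exists_adj_K1 {x : V} (hx : x = s₁ ∨ x = t₂ ∨ x = t₃) :
    ∃ y ∈ K₁, y ≠ s₁ ∧ G.Adj x y := by
  obtain ⟨y, hy, hne⟩ := h.more
  obtain ⟨z, hz, hxz⟩ := h.tri.exists_adj_of_closed h.ncard_T' h.closed_K1 ⟨y, hy, hne⟩
    (mem_triple.2 hx)
  exact ⟨z, hz.1, hz.2, hxz⟩

/-- Working form of `indep`: the triple {a, b, c} contains the vertex r of T and would separate the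
vertices x and y of T. -/
theorem false_of_closed {a b c : V} {Z : Set V} (hab : a ≠ b) (hac : a ≠ c) (hbc : b ≠ c)
    (hZ : Closed G {a, b, c} Z) {x y r : V} (hx : x ∈ Z) (hxT : x ∈ T) (hy : y ∉ Z) (hyT : y ∈ T)
    (hy' : y ∉ ({a, b, c} : Set V)) (hr : r ∈ T) (hr' : r = a ∨ r = b ∨ r = c) : False := by
  refine h.indep {a, b, c} (triple_mem_threeCutsets hab hac hbc hZ hx hy hy')
    ⟨r, mem_triple.2 hr', hr⟩ (splits_iff.2 ⟨Z, hZ, ⟨x, hxT, hx⟩, y, hyT, hy, hy'⟩)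

/-- The vertices of `T` other than `t₁` have at least two neighbors outside `T ∪ K₁ \ {t₁}`. -/
theorem exists_adj_t2 (w : V) : ∃ y, (y = t₁ ∨ y ∈ K₂) ∧ G.Adj t₂ y ∧ y ≠ w := by
  by_contra! hn
  obtain ⟨k, hk, hadj⟩ := h.exists_adj2 h.t2_mem
  have hkw : k = w := hn k (Or.inr hk) hadj
  subst hkw
  have h3 := h.t3_notMem
  have hne := h.ne_of_mem (Or.inr hk)
  have hs := h.s1_ne
  -- If k were the only neighbor of t₂ in E, then k could replace t₂ in T': the triple {s₁, k, t₃}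
  -- separates t₁ from t₂ and shares t₃ with T.
  refine h.false_of_closed (a := s₁) (b := k) (c := t₃) (Z := insert t₁ K₂ \ {k}) (x := t₁)
    (y := t₂) (r := t₃) (fun h' => h.s1_notMem (h' ▸ hk)) hs.2.2 hne.2.2 ?_
    ⟨Set.mem_insert _ _, hne.1.symm⟩ h.t1_mem ?_ h.t2_mem ?_ h.t3_mem (by simp)
  · have hE := h.closed_E
    have hs1 := h.s1_notMem
    refine closed_triple (fun h' => hE.1 _ h'.1 (by simp)) (by simp)
      (fun h' => hE.1 _ h'.1 (by simp)) ?_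
    intro x hx y hxy
    rcases hE.2 x hx.1 y hxy with h1 | h1
    · by_cases hy : y = k
      · tauto
      · exact Or.inl ⟨h1, hy⟩
    · rw [mem_triple] at h1
      rcases h1 with h1 | rfl | h1
      · tauto
      · exact absurd (hn x hx.1 hxy.symm) hx.2
      · tauto
  · exact fun h' => h.closed_E.1 _ h'.1 (by simp)
  · rw [mem_triple]
    have := h.ne23
    tauto

theorem exists_adj_t3 (w : V) : ∃ y, (y = t₁ ∨ y ∈ K₂) ∧ G.Adj t₃ y ∧ y ≠ w :=
  h.swap.exists_adj_t2 w

end Config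

/-! ### Cuts with three edges -/

theorem TriCond.finite (h : TriCond G) : Finite V :=
  Nat.finite_of_card_ne_zero (by have := h.card; omega)

theorem eq_of_ncard_three {α : Type*} {s : Set α} (hs : s.ncard = 3) {a b c d : α} (ha : a ∈ s)
    (hb : b ∈ s) (hc : c ∈ s) (hd : d ∈ s) (hab : a ≠ b) (hac : a ≠ c) (hbc : b ≠ c) :
    d = a ∨ d = b ∨ d = c := by
  have hfin : s.Finite := Set.finite_of_ncard_ne_zero (by omega)
  have : ({a, b, c} : Set α) = s := by
    refine Set.eq_of_subset_of_ncard_le ?_ ?_ hfin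
    · rintro x (rfl | rfl | rfl) <;> assumption
    · rw [hs, ncard_triple hab hac hbc]
  rw [← this, mem_triple] at hd
  exact hd

theorem cross_eq {Z : Set V} {x y x' y' : V} (hx : x ∈ Z) (hy' : y' ∉ Z)
    (h : s(x, y) = s(x', y')) : x = x' ∧ y = y' := by
  rcases Sym2.eq_iff.1 h with h | ⟨rfl, rfl⟩
  · exact h
  · contradiction

theorem verts_of_mem_cutClass_three [Finite V] {M : MixedSet V} (hM : M ∈ cutClass G 3) :
    M.verts = ∅ := by
  have := hM.2.2.1
  exact (Set.ncard_eq_zero).1 (by omega)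

theorem mclosed_iff_of_verts_eq {M : MixedSet V} (hM : M.verts = ∅) {Z : Set V} :
    MClosed G M Z ↔ ∀ x ∈ Z, ∀ y ∉ Z, G.Adj x y → s(x, y) ∈ M.edges := by
  simp only [MClosed, hM, Set.mem_empty_iff_false, not_false_eq_true, implies_true, true_and,
    true_imp_iff]
  grind

theorem MClosed.compl_of_verts_eq {M : MixedSet V} (hM : M.verts = ∅) {Z : Set V}
    (h : MClosed G M Z) : MClosed G M Zᶜ := by
  have := h.compl
  rwa [hM, Set.union_empty] at this

/-- The vertices of Z with neighbors outside Z separate z from w, so there are at least three of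
them. As only three edges are available, each of these vertices uses exactly one. -/
theorem TriCond.half_matching (h : TriCond G) {M : MixedSet V} (hM : M ∈ cutClass G 3) {Z : Set V}
    (hZ : MClosed G M Z) {z w : V} (hz : z ∈ Z) (hw : w ∉ Z) (hzn : ∀ y ∉ Z, ¬ G.Adj z y) :
    (∀ e ∈ M.edges, ∃ x ∈ Z, ∃ y ∉ Z, G.Adj x y ∧ e = s(x, y)) ∧
      ∀ x ∈ Z, ∀ y ∉ Z, ∀ y' ∉ Z, G.Adj x y → G.Adj x y' → y = y' := by
  have := h.finite
  have hZ' := (mclosed_iff_of_verts_eq (verts_of_mem_cutClass_three hM)).1 hZ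
  set A : Set V := {x | x ∈ Z ∧ ∃ y ∉ Z, G.Adj x y} with hA
  have h3 : 2 < A.ncard := by
    by_contra! hle
    have hcl : Closed G A (Z \ A) := by
      refine ⟨fun x hx => hx.2, fun x hx y hxy => ?_⟩
      by_cases hy : y ∈ Z
      · by_cases hyA : y ∈ A
        · exact Or.inr hyA
        · exact Or.inl ⟨hy, hyA⟩
      · exact absurd ⟨hx.1, y, hy, hxy⟩ hx.2
    rcases h.closed_univ A (Z \ A) hle hcl ⟨z, hz, fun ⟨_, y, hy, hzy⟩ => hzn y hy hzy⟩ w with h1 | h1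
    · exact hw h1.1
    · exact hw h1.1
  obtain ⟨x₁, x₂, x₃, ⟨hx₁, y₁, hy₁, ha₁⟩, ⟨hx₂, y₂, hy₂, ha₂⟩, ⟨hx₃, y₃, hy₃, ha₃⟩, h12, h13, h23⟩ :=
    (Set.two_lt_ncard_iff).1 h3
  have ne : ∀ {a b c d : V}, a ∈ Z → d ∉ Z → a ≠ c → s(a, b) ≠ s(c, d) :=
    fun ha hd hac he => hac (cross_eq ha hd he).1
  have key : ∀ e ∈ M.edges, e = s(x₁, y₁) ∨ e = s(x₂, y₂) ∨ e = s(x₃, y₃) := fun e he =>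
    eq_of_ncard_three hM.2.1 (hZ' _ hx₁ _ hy₁ ha₁) (hZ' _ hx₂ _ hy₂ ha₂) (hZ' _ hx₃ _ hy₃ ha₃) he
      (ne hx₁ hy₂ h12) (ne hx₁ hy₃ h13) (ne hx₂ hy₃ h23)
  constructor
  · intro e he
    rcases key e he with rfl | rfl | rfl
    · exact ⟨_, hx₁, _, hy₁, ha₁, rfl⟩
    · exact ⟨_, hx₂, _, hy₂, ha₂, rfl⟩
    · exact ⟨_, hx₃, _, hy₃, ha₃, rfl⟩
  · have uq : ∀ x ∈ Z, ∀ y ∉ Z, G.Adj x y → (x = x₁ ∧ y = y₁) ∨ (x = x₂ ∧ y = y₂) ∨ (x = x₃ ∧ y = y₃) := by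
      intro x hx y hy hxy
      rcases key _ (hZ' x hx y hy hxy) with h1 | h1 | h1
      · exact Or.inl (cross_eq hx hy₁ h1)
      · exact Or.inr (Or.inl (cross_eq hx hy₂ h1))
      · exact Or.inr (Or.inr (cross_eq hx hy₃ h1))
    intro x hx y hy y' hy' hxy hxy'
    have h1 := uq x hx y hy hxy
    have h2 := uq x hx y' hy' hxy'
    grind

/-- The edges of a three-edge cut are the edges leaving `Z`, for any proper union `Z` of
components, and they form a matching unless `Z` or its complement is a single vertex. -/
theorem TriCond.cut_structure (h : TriCond G) {M : MixedSet V} (hM : M ∈ cutClass G 3) {Z : Set V}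
    (hZ : MClosed G M Z) {z w : V} (hz : z ∈ Z) (hw : w ∉ Z) :
    (∀ e ∈ M.edges, ∃ x ∈ Z, ∃ y ∉ Z, G.Adj x y ∧ e = s(x, y)) ∧
      (Z = {z} ∨ Zᶜ = {w} ∨
        ((∀ x ∈ Z, ∀ y ∉ Z, ∀ y' ∉ Z, G.Adj x y → G.Adj x y' → y = y') ∧
          ∀ y ∉ Z, ∀ x ∈ Z, ∀ x' ∈ Z, G.Adj x y → G.Adj x' y → x = x')) := by
  have := h.finite
  have hv := verts_of_mem_cutClass_three hM
  have key : ∀ {Z : Set V}, MClosed G M Z → ∀ {z w z₀ : V}, z ∈ Z → w ∉ Z → z₀ ∈ Z →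
      (∀ y ∉ Z, ¬ G.Adj z₀ y) →
      (∀ e ∈ M.edges, ∃ x ∈ Z, ∃ y ∉ Z, G.Adj x y ∧ e = s(x, y)) ∧
      (Zᶜ = {w} ∨
        ((∀ x ∈ Z, ∀ y ∉ Z, ∀ y' ∉ Z, G.Adj x y → G.Adj x y' → y = y') ∧
          ∀ y ∉ Z, ∀ x ∈ Z, ∀ x' ∈ Z, G.Adj x y → G.Adj x' y → x = x')) := by
    intro Z hZ z w z₀ hz hw hz₀ hzn
    have h1 := h.half_matching hM hZ hz₀ hw hzn
    refine ⟨h1.1, ?_⟩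
    have hZ' := (mclosed_iff_of_verts_eq hv).1 hZ
    by_cases hc : ∃ w₀ ∉ Z, ∀ x ∈ Z, ¬ G.Adj w₀ x
    · obtain ⟨w₀, hw₀, hwn⟩ := hc
      have h2 := h.half_matching hM (hZ.compl_of_verts_eq hv) hw₀ (not_not.2 hz)
        (fun y hy => hwn y (not_not.1 hy))
      refine Or.inr ⟨h1.2, fun y hy x hx x' hx' hxy hxy' => ?_⟩
      exact h2.2 y hy x (not_not.2 hx) x' (not_not.2 hx') hxy.symm hxy'.symm
    -- Here every vertex outside Z has a neighbor in Z. If two cut edges met in y outside Z, the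
    -- third edge would end in y₂, the complement of Z would be {y, y₂}, and y₂ would have degree at
    -- most two.
    · push Not at hc
      by_cases hs : Zᶜ = {w}
      · exact Or.inl hs
      refine Or.inr ⟨h1.2, fun y hy x hx x' hx' hxy hxy' => ?_⟩
      by_contra hne
      obtain ⟨y₂, hy₂, hyy₂⟩ : ∃ y₂ ∉ Z, y₂ ≠ y := by
        by_contra! hall
        refine hs (Set.eq_singleton_iff_unique_mem.2 ⟨hw, fun v hv => ?_⟩)
        rw [hall v hv, hall w hw]
      obtain ⟨x₂, hx₂, hxy₂⟩ := hc y₂ hy₂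
      have ee : ∀ {a b c d : V}, a ∈ Z → d ∉ Z → s(a, b) = s(c, d) → a = c ∧ b = d :=
        fun ha hd he => cross_eq ha hd he
      have four : ∀ a ∈ Z, ∀ b ∉ Z, G.Adj a b → b = y ∨ (a = x₂ ∧ b = y₂) := by
        intro a ha b hb hab
        rcases eq_of_ncard_three hM.2.1 (hZ' x hx y hy hxy) (hZ' x' hx' y hy hxy')
          (hZ' x₂ hx₂ y₂ hy₂ hxy₂.symm) (hZ' a ha b hb hab)
          (fun he => hne (ee hx hy he).1) (fun he => hyy₂ (ee hx hy₂ he).2.symm)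
          (fun he => hyy₂ (ee hx' hy₂ he).2.symm) with he | he | he
        · exact Or.inl (ee ha hy he).2
        · exact Or.inl (ee ha hy he).2
        · exact Or.inr (ee ha hy₂ he)
      have hB : ∀ b ∉ Z, b = y ∨ b = y₂ := by
        intro b hb
        obtain ⟨a, ha, hab⟩ := hc b hb
        rcases four a ha b hb hab.symm with h1 | h1
        · exact Or.inl h1
        · exact Or.inr h1.2
      obtain ⟨v, hv, hvy, hvx⟩ := h.exists_adj_ne y₂ y x₂
      by_cases hvZ : v ∈ Z
      · rcases four v hvZ y₂ hy₂ hv.symm with h1 | h1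
        · exact hyy₂ h1
        · exact hvx h1.1
      · rcases hB v hvZ with h1 | h1
        · exact hvy h1
        · exact hv.ne h1.symm
  -- If every vertex had a neighbor across, each side would have at most three vertices, one per
  -- edge; this is where more than six vertices are needed.
  have hcases : (∃ z₀ ∈ Z, ∀ y ∉ Z, ¬ G.Adj z₀ y) ∨ (∃ w₀ ∉ Z, ∀ x ∈ Z, ¬ G.Adj w₀ x) := by
    by_contra! hno
    have hZ' := (mclosed_iff_of_verts_eq hv).1 hZ
    have bound : ∀ (Z : Set V), (∀ x ∈ Z, ∃ y ∉ Z, s(x, y) ∈ M.edges) → Z.ncard ≤ 3 := by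
      intro Z hZ
      choose! f hf hf' using hZ
      rw [← hM.2.1]
      refine Set.ncard_le_ncard_of_injOn (fun x => s(x, f x)) hf' ?_ (Set.toFinite _)
      intro x hx y hy he
      exact (cross_eq hx (hf y hy) he).1
    have h1 := bound Z fun x hx => by
      obtain ⟨y, hy, hxy⟩ := hno.1 x hx
      exact ⟨y, hy, hZ' x hx y hy hxy⟩
    have h2 := bound Zᶜ fun x hx => by
      obtain ⟨y, hy, hxy⟩ := hno.2 x hx
      refine ⟨y, not_not.2 hy, ?_⟩
      rw [Sym2.eq_swap]
      exact hZ' y hy x hx hxy.symm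
    have h3 := Set.ncard_add_ncard_compl Z
    have := h.card
    omega
  rcases hcases with ⟨z₀, hz₀, hzn⟩ | ⟨w₀, hw₀, hwn⟩
  · have := key hZ hz hw hz₀ hzn
    tauto
  · have := key (hZ.compl_of_verts_eq hv) (z := w) (w := z) hw (not_not.2 hz) hw₀
      (fun y hy => hwn y (not_not.1 hy))
    refine ⟨fun e he => ?_, ?_⟩
    · obtain ⟨x, hx, y, hy, hxy, rfl⟩ := this.1 e he
      exact ⟨y, not_not.1 hy, x, hx, hxy.symm, Sym2.eq_swap⟩
    · rcases this.2 with h1 | ⟨h1, h2⟩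
      · left; rwa [compl_compl] at h1
      · refine Or.inr (Or.inr ⟨fun x hx y hy y' hy' hxy hxy' => ?_, fun y hy x hx x' hx' hxy hxy' => ?_⟩)
        · exact h2 x (not_not.2 hx) y hy y' hy' hxy.symm hxy'.symm
        · exact h1 y hy x (not_not.2 hx) x' (not_not.2 hx') hxy.symm hxy'.symm

/-- `M` is a cut consisting of the three edges `aᵢbᵢ` of a matching between `Z` and its
complement. -/
structure CutMatching (G : SimpleGraph V) (M : MixedSet V) (Z : Set V) (a b : Fin 3 → V) : Prop where
  tri : TriCond G
  cut : M ∈ cutClass G 3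
  closed : MClosed G M Z
  a_mem : ∀ i, a i ∈ Z
  b_notMem : ∀ i, b i ∉ Z
  a_inj : Function.Injective a
  b_inj : Function.Injective b
  adj : ∀ i, G.Adj (a i) (b i)
  cross : ∀ x ∈ Z, ∀ y ∉ Z, G.Adj x y → ∃ i, x = a i ∧ y = b i
  support : ∀ v, v ∈ M.support ↔ ∃ i, v = a i ∨ v = b i

theorem TriCond.exists_cutMatching (h : TriCond G) {M : MixedSet V} (hM : M ∈ cutClass G 3)
    (hnt : ¬ IsTrivialCut G M) : ∃ Z a b, CutMatching G M Z a b := by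
  have := h.finite
  have hv := verts_of_mem_cutClass_three hM
  obtain ⟨Z, hZ, ⟨z, hz⟩, w, hw, -⟩ := disconnects_iff.1 hM.2.2.2
  have single : ∀ {Z : Set V} {z : V}, MClosed G M Z → Z = {z} → False := by
    intro Z z hZ hs
    refine hnt ⟨z, isComponent_iff.2 ⟨⟨z, rfl⟩, hs ▸ hZ, fun Y hY hne _ => ?_⟩⟩
    exact hne.subset_singleton_iff.1 hY
  obtain ⟨h1, h2⟩ := h.cut_structure hM hZ hz hw
  have h2 := (h2.resolve_left (single hZ)).resolve_left (single (hZ.compl_of_verts_eq hv))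
  obtain ⟨e₁, e₂, e₃, h12, h13, h23, he⟩ := Set.ncard_eq_three.1 hM.2.1
  have hmem : ∀ e, e ∈ M.edges ↔ e = e₁ ∨ e = e₂ ∨ e = e₃ := fun e => by rw [he, mem_triple]
  obtain ⟨e, he'⟩ : ∃ e : Fin 3 → Sym2 V, e = ![e₁, e₂, e₃] := ⟨_, rfl⟩
  have hinj : Function.Injective e := by
    intro i j
    fin_cases i <;> fin_cases j <;> simp [he', h12, h13, h23, h12.symm, h13.symm, h23.symm]
  have hrange : ∀ f, f ∈ M.edges ↔ ∃ i, f = e i := by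
    intro f
    rw [hmem]
    simp [he', Fin.exists_fin_succ]
  choose a ha b hb hab heq using fun i => h1 (e i) ((hrange _).2 ⟨i, rfl⟩)
  refine ⟨Z, a, b, h, hM, hZ, ha, hb, fun i j hij => ?_, fun i j hij => ?_, hab, ?_, ?_⟩
  · apply hinj
    rw [heq i, heq j, hij, h2.1 (a j) (ha j) (b i) (hb i) (b j) (hb j) (hij ▸ hab i) (hab j)]
  · apply hinj
    rw [heq i, heq j, hij, h2.2 (b j) (hb j) (a i) (ha i) (a j) (ha j) (hij ▸ hab i) (hab j)]
  · intro x hx y hy hxy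
    obtain ⟨i, hi⟩ := (hrange _).1 ((mclosed_iff_of_verts_eq hv).1 hZ x hx y hy hxy)
    rw [heq i] at hi
    exact ⟨i, cross_eq hx (hb i) hi⟩
  · intro v
    simp only [MixedSet.support, hv, Set.empty_union, Set.mem_ofPred_eq, hrange]
    constructor
    · rintro ⟨_, ⟨i, rfl⟩, hvi⟩
      rw [heq i, Sym2.mem_iff] at hvi
      exact ⟨i, hvi⟩
    · rintro ⟨i, hvi⟩
      exact ⟨e i, ⟨i, rfl⟩, by rw [heq i, Sym2.mem_iff]; exact hvi⟩

namespace CutMatching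

variable {M : MixedSet V} {Z : Set V} {a b : Fin 3 → V} (h : CutMatching G M Z a b)
include h

theorem verts : M.verts = ∅ := by
  have := h.tri.finite
  exact verts_of_mem_cutClass_three h.cut

theorem swap : CutMatching G M Zᶜ b a where
  tri := h.tri
  cut := h.cut
  closed := h.closed.compl_of_verts_eq h.verts
  a_mem := h.b_notMem
  b_notMem := fun i => not_not.2 (h.a_mem i)
  a_inj := h.b_inj
  b_inj := h.a_inj
  adj := fun i => (h.adj i).symm
  cross := fun x hx y hy hxy => by
    obtain ⟨i, hi⟩ := h.cross y (not_not.1 hy) x hx hxy.symm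
    exact ⟨i, hi.2, hi.1⟩
  support := fun v => by rw [h.support]; simp only [or_comm]

theorem edge_mem (i : Fin 3) : s(a i, b i) ∈ M.edges :=
  (mclosed_iff_of_verts_eq h.verts).1 h.closed _ (h.a_mem i) _ (h.b_notMem i) (h.adj i)

/-- By `cut_structure` for Y, every edge of M leaves Y, whatever proper nonempty closed set Y is. -/
theorem mem_of_closed {Y : Set V} (hY : MClosed G M Y) {y z : V} (hy : y ∈ Y) (hz : z ∉ Y)
    (i : Fin 3) : (a i ∈ Y ∧ b i ∉ Y) ∨ (a i ∉ Y ∧ b i ∈ Y) := by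
  obtain ⟨x, hx, w, hw, -, he⟩ := (h.tri.cut_structure h.cut hY hy hz).1 _ (h.edge_mem i)
  rcases Sym2.eq_iff.1 he with ⟨h1, h2⟩ | ⟨h1, h2⟩
  · exact Or.inl ⟨h1 ▸ hx, h2 ▸ hw⟩
  · exact Or.inr ⟨h1 ▸ hw, h2 ▸ hx⟩

/-- Two disjoint nonempty closed subsets of Z would both have to contain the end a 0 of the same
edge. -/
theorem mcomp : MComp G M Z := by
  refine ⟨⟨_, h.a_mem 0⟩, h.closed, fun Y hY hne hYc => hY.antisymm fun x hx => ?_⟩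
  by_contra hxY
  obtain ⟨y, hy⟩ := hne
  have hb0 := h.b_notMem 0
  rcases h.mem_of_closed hYc hy hxY 0 with h1 | h1
  · rcases h.mem_of_closed (h.closed.diff hYc) ⟨hx, hxY⟩ (z := y) (fun h' => h'.2 hy) 0 with h2 | h2
    · exact h2.1.2 h1.1
    · exact hb0 h2.2.1
  · exact hb0 (hY h1.2)

theorem isCutBoundary : IsCutBoundary G M (Set.range b) := by
  refine ⟨Z, isComponent_iff.2 h.mcomp, ?_⟩
  ext v
  simp only [Set.mem_range, Set.mem_inter_iff, Set.mem_compl_iff, h.support]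
  constructor
  · rintro ⟨i, rfl⟩
    exact ⟨h.b_notMem i, i, Or.inr rfl⟩
  · rintro ⟨hv, i, rfl | rfl⟩
    · exact absurd (h.a_mem i) hv
    · exact ⟨i, rfl⟩

theorem a_ne_b (i j : Fin 3) : a i ≠ b j := fun h' => h.b_notMem j (h' ▸ h.a_mem i)

/-- The triple covers all three edges, so it cuts the rest of Z, which contains a k, off from b i.
It is no boundary, because it takes ends from both sides. Different choices of k give different
members of the complex. -/
theorem mixed_mem {i j k : Fin 3} (hij : i ≠ j) (hik : i ≠ k) (hjk : j ≠ k) :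
    ({a i, a j, b k} : Set V) ∈ bigCutComplex G M := by
  have h1 : ({a i, a j, b k} : Set V) ∈ threeCutsets G := by
    refine triple_mem_threeCutsets (D := Z \ {a i, a j}) (x := a k) (z := b i)
      (h.a_inj.ne hij) (h.a_ne_b i k) (h.a_ne_b j k) ?_ ?_ ?_ ?_
    · refine closed_triple (by simp) (by simp) (fun h' => h.b_notMem k h'.1) ?_
      intro x hx y hxy
      by_cases hy : y ∈ Z
      · simp only [Set.mem_sdiff, Set.mem_insert_iff, Set.mem_singleton_iff]; tauto
      · obtain ⟨l, rfl, rfl⟩ := h.cross x hx.1 y hy hxy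
        have : l = i ∨ l = j ∨ l = k := by omega
        have := hx.2
        simp only [Set.mem_insert_iff, Set.mem_singleton_iff] at this
        grind
    · simp only [Set.mem_sdiff, Set.mem_insert_iff, Set.mem_singleton_iff, h.a_mem, true_and, not_or]
      exact ⟨h.a_inj.ne hik.symm, h.a_inj.ne hjk.symm⟩
    · exact fun h' => h.b_notMem i h'.1
    · rw [mem_triple]
      have := (h.a_ne_b i i).symm
      have := (h.a_ne_b j i).symm
      have := h.b_inj.ne hik
      tauto
  refine ⟨h1, ?_, ?_⟩
  · intro v hv
    rw [mem_triple] at hv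
    rw [h.support]
    rcases hv with rfl | rfl | rfl
    exacts [⟨i, Or.inl rfl⟩, ⟨j, Or.inl rfl⟩, ⟨k, Or.inr rfl⟩]
  · rintro ⟨H, hH, hT⟩
    rw [isComponent_iff] at hH
    have hmem : ∀ v, v ∈ ({a i, a j, b k} : Set V) ↔ v ∉ H ∧ v ∈ M.support := fun v => by rw [hT]; rfl
    have hi := (hmem (a i)).1 (by simp)
    have hk := (hmem (b k)).1 (by simp)
    obtain ⟨x, hx⟩ := hH.1
    have e1 := h.mem_of_closed hH.2.1 hx hi.1 i
    have e2 := h.mem_of_closed hH.2.1 hx hi.1 k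
    rcases hH.subset_or_disjoint h.closed with h2 | h2
    · have := h2 (e1.resolve_left fun h' => hi.1 h'.1).2
      exact h.b_notMem i this
    · exact h2 _ (e2.resolve_right fun h' => hk.1 h'.2).1 (h.a_mem k)

/-- A 3-cutset inside `V(M)` contains no edge of `M`. -/
theorem false_of_pair {i j k : Fin 3} (hij : i ≠ j) (hik : i ≠ k) (hjk : j ≠ k) {c : V}
    (hc : c = a j ∨ c = b j) (hR : ({a i, b i, c} : Set V) ∈ threeCutsets G) : False := by
  obtain ⟨-, D, hD, hDne, z, hz, hzR⟩ := mem_threeCutsets_iff.1 hR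
  -- the closed set not containing `a k` has no vertices on either side
  have key : ∀ {M : MixedSet V} {Z : Set V} {a b : Fin 3 → V} (_ : CutMatching G M Z a b) (D : Set V),
      (c = a j ∨ c = b j) → Closed G {a i, b i, c} D → a k ∉ D → b k ∉ D → ∀ x ∈ D, x ∉ Z := by
    intro M Z a b h D hc hD hak hbk x hx hxZ
    have hcD : c ∉ D := fun h' => hD.1 c h' (by simp)
    have haD : a i ∉ D := fun h' => hD.1 _ h' (by simp)
    have hbZ := h.b_notMem
    have hne1 : b i ≠ a i := (h.a_ne_b i i).symm
    refine h.tri.pair (D := D ∩ Z) (a := a i) (b := c) (z := b i) ?_ ⟨hx, hxZ⟩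
      (fun h' => haD h'.1) (fun h' => hcD h'.1) (fun h' => hbZ i h'.2) hne1 ?_
    · intro u hu v huv
      by_cases hv : v ∈ Z
      · rcases hD.2 u hu.1 v huv with h1 | h1
        · exact Or.inl ⟨h1, hv⟩
        · rw [mem_triple] at h1
          rcases h1 with rfl | rfl | rfl
          · tauto
          · exact absurd hv (hbZ i)
          · tauto
      · obtain ⟨l, rfl, rfl⟩ := h.cross u hu.2 v hv huv
        have hl : l = i ∨ l = j ∨ l = k := by omega
        rcases hl with rfl | rfl | rfl
        · exact absurd hu.1 haD
        · rcases hc with rfl | rfl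
          · exact absurd hu.1 hcD
          · tauto
        · exact absurd hu.1 hak
    · rcases hc with rfl | rfl
      · exact (h.a_ne_b j i).symm
      · exact h.b_inj.ne hij
  have hakR : a k ∉ ({a i, b i, c} : Set V) := by
    rw [mem_triple]
    have := h.a_inj.ne hik
    have := h.a_inj.ne hjk
    have := h.a_ne_b k i
    have := h.a_ne_b k j
    grind
  have hbkR : b k ∉ ({a i, b i, c} : Set V) := by
    rw [mem_triple]
    have := h.b_inj.ne hik
    have := h.b_inj.ne hjk
    have := h.a_ne_b i k
    have := h.a_ne_b j k
    grind
  -- The edge a k b k survives, so both its ends avoid D; `key` for the matching and for its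
  -- reversal then empties D on both sides.
  have main : ∀ D : Set V, Closed G {a i, b i, c} D → a k ∉ D → ∀ x ∈ D, False := by
    intro D hD hak x hx
    have hbk : b k ∉ D := fun h' =>
      (hD.2 _ h' _ (h.adj k).symm).elim hak hakR
    have hxZ := key h D hc hD hak hbk x hx
    refine key h.swap D hc.symm ?_ hbk hak x hx hxZ
    rwa [Set.insert_comm]
  by_cases hak : a k ∈ D
  · exact main _ hD.compl (fun h' => h' (Or.inl hak)) z (fun h' => h'.elim hz hzR)
  · obtain ⟨x, hx⟩ := hDne
    exact main D hD hak x hx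

end CutMatching

/-- Three edges with a common end have only four ends altogether. -/
theorem TriCond.not_isTrivialCut (h : TriCond G) {M : MixedSet V} (hM : M ∈ cutClass G 3)
    {s : Finset V} (hs : 5 ≤ s.card) (hsM : ∀ x ∈ s, x ∈ M.support) : ¬ IsTrivialCut G M := by
  classical
  rintro ⟨c, hc⟩
  have := h.finite
  have hv := verts_of_mem_cutClass_three hM
  rw [isComponent_iff] at hc
  obtain ⟨w, hw⟩ := exists_notMem_of_ncard (s := {c}) (by
    rw [Set.ncard_singleton]; have := h.card; omega)
  have h1 := (h.cut_structure hM hc.2.1 (Set.mem_singleton c) hw).1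
  obtain ⟨e₁, e₂, e₃, -, -, -, he⟩ := Set.ncard_eq_three.1 hM.2.1
  have hend : ∀ e ∈ M.edges, ∃ y, e = s(c, y) := by
    intro e he
    obtain ⟨x, hx, y, -, -, rfl⟩ := h1 e he
    exact ⟨y, by rw [Set.mem_singleton_iff.1 hx]⟩
  obtain ⟨y₁, rfl⟩ := hend e₁ (by simp [he])
  obtain ⟨y₂, rfl⟩ := hend e₂ (by simp [he])
  obtain ⟨y₃, rfl⟩ := hend e₃ (by simp [he])
  have : s ⊆ {c, y₁, y₂, y₃} := by
    intro x hx
    have := hsM x hx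
    simp only [MixedSet.support, hv, he, Set.empty_union, Set.mem_ofPred_eq,
      Set.mem_insert_iff, Set.mem_singleton_iff] at this
    simp only [Finset.mem_insert, Finset.mem_singleton]
    obtain ⟨e, rfl | rfl | rfl, hx⟩ := this <;> rw [Sym2.mem_iff] at hx <;> tauto
  have := (Finset.card_le_card this).trans Finset.card_le_four
  omega

/-- The complex of a big cut has at least two elements. -/
theorem TriCond.bigCutComplex_ne_singleton (h : TriCond G) {M : MixedSet V} (hM : IsBigCut G M)
    (T : Set V) : bigCutComplex G M ≠ {T} := by
  intro hT
  obtain ⟨Z, a, b, hc⟩ := h.exists_cutMatching hM.1 hM.2.1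
  have h1 := hc.mixed_mem (i := 0) (j := 1) (k := 2) (by decide) (by decide) (by decide)
  have h2 := hc.mixed_mem (i := 0) (j := 2) (k := 1) (by decide) (by decide) (by decide)
  rw [hT, Set.mem_singleton_iff] at h1 h2
  have h3 : a 2 ∈ ({a 0, a 1, b 2} : Set V) := by rw [h1, ← h2]; simp
  rw [mem_triple] at h3
  rcases h3 with h3 | h3 | h3
  · exact absurd (hc.a_inj h3) (by decide)
  · exact absurd (hc.a_inj h3) (by decide)
  · exact hc.a_ne_b _ _ h3

/-- A complemented cutset whose other boundary belongs to the complex of a big cut. -/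
theorem Config.boundary_of_bigCut {T K₁ K₂ : Set V} {t₁ t₂ t₃ s₁ : V}
    (h : Config G T K₁ K₂ t₁ t₂ t₃ s₁) {M : MixedSet V} (hM : IsBigCut G M)
    (hT : ({s₁, t₂, t₃} : Set V) ∈ bigCutComplex G M) : IsCutBoundary G M T := by
  obtain ⟨Z, a, b, hc⟩ := h.tri.exists_cutMatching hM.1 hM.2.1
  obtain ⟨hT3, hTM, hTb⟩ := hT
  have idx : ∀ v, v = s₁ ∨ v = t₂ ∨ v = t₃ → ∃ i, v = a i ∨ v = b i := fun v hv =>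
    (hc.support v).1 (hTM (mem_triple.2 hv))
  obtain ⟨i, hi⟩ := idx s₁ (Or.inl rfl)
  obtain ⟨j, hj⟩ := idx t₂ (Or.inr (Or.inl rfl))
  obtain ⟨k, hk⟩ := idx t₃ (Or.inr (Or.inr rfl))
  have hs := h.s1_ne
  -- no two of the three vertices belong to the same edge
  have pair : ∀ x y z : V, x ≠ y → x ≠ z → y ≠ z → ({x, y, z} : Set V) = {s₁, t₂, t₃} →
      ∀ i j l : Fin 3, (x = a i ∨ x = b i) → (y = a j ∨ y = b j) → (z = a l ∨ z = b l) → i ≠ j := by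
    intro x y z hxy hxz hyz hS i j l hx hy hz hij
    subst hij
    have hset : ({a i, b i, z} : Set V) = {s₁, t₂, t₃} := by
      rw [← hS]
      rcases hx with rfl | rfl <;> rcases hy with rfl | rfl
      · exact absurd rfl hxy
      · rfl
      · exact Set.insert_comm _ _ _
      · exact absurd rfl hxy
    have hil : i ≠ l := by
      rintro rfl
      grind
    obtain ⟨m, him, hlm⟩ :=
      (by decide : ∀ i l : Fin 3, i ≠ l → ∃ m, i ≠ m ∧ l ≠ m) i l hil
    exact hc.false_of_pair hil him hlm hz (hset ▸ hT3)
  have hij : i ≠ j := pair s₁ t₂ t₃ hs.2.1 hs.2.2 h.ne23 rfl i j k hi hj hk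
  have hik : i ≠ k := pair s₁ t₃ t₂ hs.2.2 hs.2.1 h.ne23.symm (by rw [Set.pair_comm]) i k j hi hk hj
  have hjk : j ≠ k := pair t₂ t₃ s₁ h.ne23 hs.2.1.symm hs.2.2.symm
    (by ext; simp only [mem_triple]; tauto) j k i hj hk hi
  have hno : ∀ l, ¬ (a l ∈ ({s₁, t₂, t₃} : Set V) ∧ b l ∈ ({s₁, t₂, t₃} : Set V)) := by
    intro l ⟨h1, h2⟩
    rw [mem_triple] at h1 h2
    have ha := hc.a_inj
    have hb := hc.b_inj
    have hab := hc.a_ne_b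
    have h3 := hab l l
    have h4 : ∀ v m, (v = a m ∨ v = b m) → (a l = v ∨ b l = v) → m = l := by
      intro v m hv hl
      rcases hv with rfl | rfl <;> rcases hl with hl | hl
      · exact (ha hl).symm
      · exact absurd hl.symm (hab _ _)
      · exact absurd hl (hab _ _)
      · exact (hb hl).symm
    have h5 := h4 _ _ hi
    have h6 := h4 _ _ hj
    have h7 := h4 _ _ hk
    grind
  -- Here Z is the side avoiding E. A vertex a l has at most one neighbor in E, so t₂ and t₃, with
  -- two each, are b-ends. If s₁ were one too, T' would be a boundary; hence s₁ = a i, its neighbor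
  -- t₁ is b i, and T consists of all b-ends.
  have key : ∀ {Z : Set V} {a b : Fin 3 → V} (_ : CutMatching G M Z a b),
      (s₁ = a i ∨ s₁ = b i) → (t₂ = a j ∨ t₂ = b j) → (t₃ = a k ∨ t₃ = b k) →
      (∀ x ∈ insert t₁ K₂, x ∉ Z) → IsCutBoundary G M T := by
    intro Z a b hc hi hj hk hE
    have hone : ∀ l y, y ∈ insert t₁ K₂ → G.Adj (a l) y → y = b l := by
      intro l y hy hadj
      obtain ⟨m, hm, hm'⟩ := hc.cross _ (hc.a_mem l) y (hE y hy) hadj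
      rw [hm', hc.a_inj hm]
    have hj' : t₂ = b j := by
      refine hj.resolve_left fun h' => ?_
      obtain ⟨y, hy, hadj, hne⟩ := h.exists_adj_t2 (b j)
      exact hne (hone j y (by simpa using hy) (h' ▸ hadj))
    have hk' : t₃ = b k := by
      refine hk.resolve_left fun h' => ?_
      obtain ⟨y, hy, hadj, hne⟩ := h.exists_adj_t3 (b k)
      exact hne (hone k y (by simpa using hy) (h' ▸ hadj))
    have hrange : ({b i, b j, b k} : Set V) = Set.range b := by
      ext v
      simp only [mem_triple, Set.mem_range]
      constructor
      · rintro (rfl | rfl | rfl) <;> exact ⟨_, rfl⟩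
      · rintro ⟨l, rfl⟩
        have : l = i ∨ l = j ∨ l = k := by omega
        rcases this with rfl | rfl | rfl <;> simp
    rcases hi with hi' | hi'
    · have ht : t₁ = b i := hone i t₁ (Set.mem_insert _ _) (hi' ▸ h.adj.symm)
      rw [h.eq, ht, hj', hk', hrange]
      exact hc.isCutBoundary
    · exfalso
      apply hTb
      rw [hi', hj', hk', hrange]
      exact hc.isCutBoundary
  -- Every edge of M has an end in T', so the component E of G - T' lies entirely on one side of the
  -- cut.
  have hE := h.comp_E
  have hcl : Closed G {s₁, t₂, t₃} (Z \ {s₁, t₂, t₃}) := by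
    refine ⟨fun x hx => hx.2, fun x hx y hxy => ?_⟩
    by_cases hy : y ∈ ({s₁, t₂, t₃} : Set V)
    · exact Or.inr hy
    refine Or.inl ⟨?_, hy⟩
    by_contra hyZ
    obtain ⟨l, rfl, rfl⟩ := hc.cross x hx.1 y hyZ hxy
    have hl : l = i ∨ l = j ∨ l = k := by omega
    have h1 := hx.2
    rw [mem_triple] at h1 hy
    grind
  rcases hE.subset_or_disjoint hcl with h1 | h1
  · exact key hc.swap hi.symm hj.symm hk.symm fun x hx => not_not.2 (h1 hx).1
  · exact key hc hi hj hk fun x hx hxZ => h1 x hx ⟨hxZ, hE.2.1.1 x hx⟩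


/-! ### Triple cuts -/

theorem Comp.not_splits {S H : Set V} (h : Comp G S H) : ¬ Splits G S (H ∪ S) := by
  rw [not_splits_iff]
  intro D hD x hx hxD y hy
  have hxH : x ∈ H := hx.resolve_right (hD.1 x hxD)
  exact hy.imp_left fun hy => h.subset_of_mem hD hxH hxD hy

theorem subset_of_not_splits {S X H : Set V} (h : Comp G S H) (hX : ¬ Splits G S X) {x : V}
    (hx : x ∈ X) (hxH : x ∈ H) : X ⊆ H ∪ S :=
  fun y hy => (not_splits_iff.1 hX) H h.2.1 x hx hxH y hy

/-- A vertex of the part outside S determines its component. The hypothesis on S guarantees that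
there is a component at all, so that no subset of S is maximal. -/
theorem mem_parts_singleton {S A : Set V} (hS : S ≠ Set.univ) :
    A ∈ parts G {S} ↔ ∃ H, Comp G S H ∧ A = H ∪ S := by
  simp only [parts, Set.mem_ofPred_eq, Set.mem_singleton_iff, forall_eq]
  constructor
  · intro hA
    obtain ⟨H, hH, hAH⟩ : ∃ H, Comp G S H ∧ A ⊆ H ∪ S := by
      by_cases hAS : A ⊆ S
      · obtain ⟨z, hz⟩ := (Set.ne_univ_iff_exists_notMem S).1 hS
        obtain ⟨H, hH, -⟩ := exists_comp_mem (G := G) hz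
        exact ⟨H, hH, hAS.trans Set.subset_union_right⟩
      · obtain ⟨x, hx, hxS⟩ := Set.not_subset.1 hAS
        obtain ⟨H, hH, hxH⟩ := exists_comp_mem (G := G) hxS
        exact ⟨H, hH, subset_of_not_splits hH hA.1 hx hxH⟩
    exact ⟨H, hH, hA.eq_of_subset hH.not_splits hAH⟩
  · rintro ⟨H, hH, rfl⟩
    refine ⟨hH.not_splits, fun B hB hHB => ?_⟩
    obtain ⟨x, hx⟩ := hH.1
    exact subset_of_not_splits hH hB (hHB (Or.inl hx)) hx

theorem partInterior_singleton {S H : Set V} (h : Comp G S H) :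
    partInterior {S} (H ∪ S) = H := by
  ext x
  have := h.2.1.1 x
  simp only [partInterior, Set.sUnion_singleton, Set.mem_sdiff, Set.mem_union]
  tauto

theorem TriCond.ne_univ (h : TriCond G) {S : Set V} (hS : S.ncard = 3) : S ≠ Set.univ := by
  rintro rfl
  rw [Set.ncard_univ] at hS
  have := h.card
  omega

/-- A 3-set `S` whose removal leaves exactly the three components `H i`, and which contains the
vertex `a` of degree three. -/
structure TripleLine (G : SimpleGraph V) (S : Set V) (H : Fin 3 → Set V) (a : V) : Prop where
  tri : TriCond G
  card : S.ncard = 3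
  comp : ∀ i, Comp G S (H i)
  inj : Function.Injective H
  all : ∀ A, Comp G S A → ∃ i, A = H i
  mem : a ∈ S
  cubic : IsCubicVertex G a

/-- Every vertex of `S` has at most one neighbor in `A`. -/
def OneNeighbor (G : SimpleGraph V) (S A : Set V) : Prop :=
  ∀ x ∈ S, ∀ y ∈ A, ∀ y' ∈ A, G.Adj x y → G.Adj x y' → y = y'

/-- The edges between `S` and `A`. -/
def edgesBetween (G : SimpleGraph V) (S A : Set V) : Set (Sym2 V) :=
  {e | ∃ x ∈ S, ∃ y ∈ A, G.Adj x y ∧ e = s(x, y)}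

theorem fin_three_others (i : Fin 3) : ∃ j k : Fin 3, j ≠ i ∧ k ≠ i ∧ j ≠ k := by
  revert i; decide

theorem parts_ncard_eq {S : Set V} (hS : S ≠ Set.univ) {H : Fin 3 → Set V}
    (hcomp : ∀ i, Comp G S (H i)) (hinj : Function.Injective H)
    (hall : ∀ A, Comp G S A → ∃ i, A = H i) : (parts G {S}).ncard = 3 := by
  have : parts G {S} = Set.range fun i => H i ∪ S := by
    ext A
    rw [mem_parts_singleton hS]
    constructor
    · rintro ⟨B, hB, rfl⟩
      obtain ⟨i, rfl⟩ := hall B hB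
      exact ⟨i, rfl⟩
    · rintro ⟨i, rfl⟩
      exact ⟨_, hcomp i, rfl⟩
  rw [this, ← Set.image_univ, Set.ncard_image_of_injective, Set.ncard_univ, Nat.card_fin]
  intro i j hij
  apply hinj
  obtain ⟨x, hx⟩ := (hcomp i).1
  have : x ∈ H j ∪ S := by
    rw [← show H i ∪ S = H j ∪ S from hij]
    exact Or.inl hx
  exact (hcomp i).eq_of_mem (hcomp j) hx (this.resolve_right ((hcomp i).2.1.1 x hx))

/-- The vertex a isolated by T has all its neighbors in T, and each vertex of T has a neighbor in
{a}. So T is the neighborhood of a, and a has degree three. -/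
theorem TriCond.exists_tripleLine (h : TriCond G) {S T : Set V} (hST : Subordinated G T S) :
    ∃ H a, TripleLine G S H a ∧ T = G.neighborSet a := by
  obtain ⟨hT, hS, hcard, ⟨a, ha, haT⟩, hmeet⟩ := hST
  have hS3 := (mem_threeCutsets_iff.1 hS).1
  have hT3 := (mem_threeCutsets_iff.1 hT).1
  have hu := h.ne_univ hS3
  obtain ⟨A₁, A₂, A₃, h12, h13, h23, hA⟩ := Set.ncard_eq_three.1 hcard
  obtain ⟨A, hA'⟩ : ∃ A : Fin 3 → Set V, A = ![A₁, A₂, A₃] := ⟨_, rfl⟩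
  have hAinj : Function.Injective A := by
    intro i j
    fin_cases i <;> fin_cases j <;> simp [hA', h12, h13, h23, h12.symm, h13.symm, h23.symm]
  have hrange : ∀ B, B ∈ parts G {S} ↔ ∃ i, B = A i := by
    intro B
    rw [hA]
    simp [hA', Fin.exists_fin_succ]
  choose H hH hAH using fun i => (mem_parts_singleton hu).1 ((hrange (A i)).2 ⟨i, rfl⟩)
  have hN : T = G.neighborSet a := by
    rw [isComponent_vset_iff] at haT
    ext t
    rw [SimpleGraph.mem_neighborSet]
    constructor
    · intro ht
      obtain ⟨y, hy, hty⟩ := h.exists_adj_of_closed hT3 haT.2.1 haT.1 ht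
      rw [Set.mem_singleton_iff.1 hy] at hty
      exact hty.symm
    · intro hat
      rcases haT.2.1.2 a rfl t hat with h1 | h1
      · exact absurd h1 hat.ne'
      · exact h1
  refine ⟨H, a, ⟨h, hS3, hH, fun i j hij => hAinj ?_, ?_, ha, ?_⟩, hN⟩
  · rw [hAH i, hAH j, hij]
  · intro B hB
    obtain ⟨i, hi⟩ := (hrange (B ∪ S)).1 ((mem_parts_singleton hu).2 ⟨B, hB, rfl⟩)
    refine ⟨i, ?_⟩
    rw [hAH i] at hi
    obtain ⟨x, hx⟩ := hB.1
    have : x ∈ H i ∪ S := hi ▸ Or.inl hx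
    exact hB.eq_of_mem (hH i) hx (this.resolve_right (hB.2.1.1 x hx))
  · rw [IsCubicVertex, ← hN, hT3]

namespace TripleLine

variable {S : Set V} {H : Fin 3 → Set V} {a : V} (h : TripleLine G S H a)
include h

theorem cover (v : V) : v ∈ S ∨ ∃ i, v ∈ H i := by
  by_cases hv : v ∈ S
  · exact Or.inl hv
  · obtain ⟨A, hA, hvA⟩ := exists_comp_mem (G := G) hv
    obtain ⟨i, rfl⟩ := h.all A hA
    exact Or.inr ⟨i, hvA⟩

theorem notMem {i : Fin 3} {v : V} (hv : v ∈ H i) : v ∉ S := (h.comp i).2.1.1 v hv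

theorem idx_eq {i j : Fin 3} {v : V} (hi : v ∈ H i) (hj : v ∈ H j) : i = j :=
  h.inj ((h.comp i).eq_of_mem (h.comp j) hi hj)

theorem exists_adj {x : V} (hx : x ∈ S) (i : Fin 3) : ∃ y ∈ H i, G.Adj x y :=
  h.tri.exists_adj_of_closed h.card (h.comp i).2.1 (h.comp i).1 hx

/-- A vertex of S has a neighbor in each of the three components; with degree three it has exactly
one in each and no others. -/
theorem cubic_adj {x y : V} (hx : x ∈ S) (hc : IsCubicVertex G x) (hxy : G.Adj x y) :
    ∃ i, y ∈ H i ∧ ∀ z ∈ H i, G.Adj x z → z = y := by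
  choose f hf hxf using fun i => h.exists_adj hx i
  have hne : ∀ i j, i ≠ j → f i ≠ f j := fun i j hij he => hij (h.idx_eq (hf i) (he ▸ hf j))
  have key : ∀ y, G.Adj x y → y = f 0 ∨ y = f 1 ∨ y = f 2 := fun y hy =>
    eq_of_ncard_three hc (hxf 0) (hxf 1) (hxf 2) hy (hne _ _ (by decide)) (hne _ _ (by decide))
      (hne _ _ (by decide))
  have key' : ∀ y, G.Adj x y → ∃ i, y = f i := fun y hy => by
    rcases key y hy with h1 | h1 | h1 <;> exact ⟨_, h1⟩
  obtain ⟨i, rfl⟩ := key' y hxy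
  refine ⟨i, hf i, fun z hz hxz => ?_⟩
  obtain ⟨j, rfl⟩ := key' z hxz
  rw [h.idx_eq hz (hf j)]

theorem cubic_unique {x y y' : V} {i : Fin 3} (hx : x ∈ S) (hc : IsCubicVertex G x) (hy : y ∈ H i)
    (hy' : y' ∈ H i) (hxy : G.Adj x y) (hxy' : G.Adj x y') : y = y' := by
  obtain ⟨j, hj, hu⟩ := h.cubic_adj hx hc hxy'
  exact hu y (h.idx_eq hy' hj ▸ hy) hxy

theorem mem_parts {A : Set V} : A ∈ parts G {S} ↔ ∃ i, A = H i ∪ S := by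
  rw [mem_parts_singleton (h.tri.ne_univ h.card)]
  constructor
  · rintro ⟨B, hB, rfl⟩
    obtain ⟨i, rfl⟩ := h.all B hB
    exact ⟨i, rfl⟩
  · rintro ⟨i, rfl⟩
    exact ⟨_, h.comp i, rfl⟩

theorem lineCut_edges (i : Fin 3) : (lineCut G S (H i ∪ S)).edges =
    {e | ∃ x ∈ S, ∃ y ∈ H i, IsCubicVertex G x ∧ G.Adj x y ∧ e = s(x, y)} := by
  simp only [lineCut, partInterior_singleton (h.comp i)]

/-- A three-edge cut containing the line cut towards `H i` consists of the edges between `S` and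
`H i`. -/
theorem of_contains {i : Fin 3} {M : MixedSet V} (hM : M ∈ cutClass G 3)
    (hc : M.Contains (lineCut G S (H i ∪ S))) :
    OneNeighbor G S (H i) ∧ M.edges = edgesBetween G S (H i) := by
  have := h.tri.finite
  have hv := verts_of_mem_cutClass_three hM
  have hend : ∀ e ∈ M.edges, (∃ x ∈ S, ∃ y ∈ H i, IsCubicVertex G x ∧ G.Adj x y ∧ e = s(x, y)) ∨
      ∃ v ∈ S, ¬ IsCubicVertex G v ∧ v ∈ e := by
    intro e he
    rcases hc.2 e he with h1 | ⟨v, hv, hve⟩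
    · rw [h.lineCut_edges] at h1
      exact Or.inl h1
    · exact Or.inr ⟨v, hv.1, hv.2, hve⟩
  obtain ⟨Z, hZ, ⟨z, hz⟩, w, hw, haZ⟩ : ∃ Z, MClosed G M Z ∧ Z.Nonempty ∧ ∃ w, w ∉ Z ∧ a ∉ Z := by
    obtain ⟨Z, hZ, ⟨z, hz⟩, w, hw, -⟩ := disconnects_iff.1 hM.2.2.2
    by_cases ha : a ∈ Z
    · exact ⟨Zᶜ, hZ.compl_of_verts_eq hv, ⟨w, hw⟩, z, not_not.2 hz, not_not.2 ha⟩
    · exact ⟨Z, hZ, ⟨z, hz⟩, w, hw, ha⟩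
  have hZ' := (mclosed_iff_of_verts_eq hv).1 hZ
  -- Every edge of M has an end in S, so M cuts no component of G - S apart.
  have hsub : ∀ j, H j ⊆ Z ∨ ∀ x ∈ H j, x ∉ Z := by
    intro j
    have hcl : Closed G S (Z ∩ H j) := by
      refine ⟨fun x hx => h.notMem hx.2, fun x hx y hxy => ?_⟩
      rcases (h.comp j).2.1.2 x hx.2 y hxy with hy | hy
      · refine Or.inl ⟨?_, hy⟩
        by_contra hyZ
        rcases hend _ (hZ' x hx.1 y hyZ hxy) with ⟨u, hu, v, -, -, -, he⟩ | ⟨v, hvS, -, hve⟩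
        · have : u ∈ s(x, y) := he ▸ Sym2.mem_mk_left u v
          rcases Sym2.mem_iff.1 this with rfl | rfl
          · exact h.notMem hx.2 hu
          · exact h.notMem hy hu
        · rcases Sym2.mem_iff.1 hve with rfl | rfl
          · exact h.notMem hx.2 hvS
          · exact h.notMem hy hvS
      · exact Or.inr hy
    rcases (h.comp j).subset_or_disjoint hcl with h1 | h1
    · exact Or.inl fun x hx => (h1 hx).1
    · exact Or.inr fun x hx hxZ => h1 x hx ⟨hxZ, hx⟩
  -- edges of `M` from a vertex of degree three in `S` lead to `H i`
  have hcub : ∀ x ∈ S, IsCubicVertex G x → ∀ j, j ≠ i → ∀ y ∈ H j, s(x, y) ∉ M.edges := by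
    intro x hx hxc j hj y hy he
    rcases hend _ he with ⟨u, hu, v, hv, -, -, he⟩ | ⟨v, hvS, hvc, hve⟩
    · rcases Sym2.eq_iff.1 he with ⟨-, rfl⟩ | ⟨rfl, -⟩
      · exact hj (h.idx_eq hy hv)
      · exact h.notMem hv hx
    · rcases Sym2.mem_iff.1 hve with rfl | rfl
      · exact hvc hxc
      · exact h.notMem hy hvS
  -- The edge from the cubic vertex a into H j is not in M, so H j lies on the side of a.
  have hother : ∀ j, j ≠ i → ∀ x ∈ H j, x ∉ Z := by
    intro j hj
    refine (hsub j).resolve_left fun hsub => ?_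
    obtain ⟨y, hy, hay⟩ := h.exists_adj h.mem j
    refine hcub a h.mem h.cubic j hj y hy ?_
    rw [Sym2.eq_swap]
    exact hZ' y (hsub hy) a haZ hay.symm
  obtain ⟨j, k, hji, hki, hjk⟩ := fin_three_others i
  obtain ⟨hs1, hs2⟩ := h.tri.cut_structure hM hZ hz hw
  have hcompl : Zᶜ ≠ {w} := by
    intro he
    obtain ⟨x, hx⟩ := (h.comp j).1
    have h1 : x ∈ Zᶜ := hother j hji x hx
    rw [he] at h1
    have h2 : a ∈ Zᶜ := haZ
    rw [he, ← Set.mem_singleton_iff.1 h1] at h2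
    exact h.notMem hx (Set.mem_singleton_iff.1 h2 ▸ h.mem)
  -- A vertex x of S in Z would send edges of M to both other components. This contradicts the
  -- matching property; in the exceptional case Z = {x} the vertex x is cubic and `hcub` applies.
  have hZS : ∀ x ∈ S, x ∉ Z := by
    intro x hx hxZ
    obtain ⟨y, hy, hxy⟩ := h.exists_adj hx j
    obtain ⟨y', hy', hxy'⟩ := h.exists_adj hx k
    have hyZ := hother j hji y hy
    have hyZ' := hother k hki y' hy'
    rcases hs2 with hs2 | hs2 | hs2
    · have hzx : z = x := by rw [hs2] at hxZ; exact (Set.mem_singleton_iff.1 hxZ).symm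
      subst hzx
      refine hcub z hx ?_ j hji y hy (hZ' z hxZ y hyZ hxy)
      have : M.edges = (fun y => s(z, y)) '' G.neighborSet z := by
        ext e
        constructor
        · intro he
          obtain ⟨u, hu, v, hv, huv, rfl⟩ := hs1 e he
          rw [hs2, Set.mem_singleton_iff] at hu
          subst hu
          exact ⟨v, huv, rfl⟩
        · rintro ⟨v, hv, rfl⟩
          refine hZ' z hxZ v ?_ hv
          rw [hs2, Set.mem_singleton_iff]
          exact fun h' => G.loopless.irrefl z (h' ▸ hv)
      have hcard := hM.2.1
      rw [this, Set.ncard_image_of_injective _ (fun u v he => by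
        rcases Sym2.eq_iff.1 he with h1 | h1
        exacts [h1.2, h1.2.trans h1.1])] at hcard
      exact hcard
    · exact hcompl hs2
    · have := hs2.1 x hxZ y hyZ y' hyZ' hxy hxy'
      subst this
      exact hjk (h.idx_eq hy hy')
  have hZi : Z = H i := by
    have hZH : Z ⊆ H i := by
      intro x hx
      rcases h.cover x with h1 | ⟨l, hl⟩
      · exact absurd hx (hZS x h1)
      · by_cases hli : l = i
        · exact hli ▸ hl
        · exact absurd hx (hother l hli x hl)
    exact hZH.antisymm ((hsub i).resolve_right fun h1 => h1 z (hZH hz) hz)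
  have hadjS : ∀ x ∈ Z, ∀ y ∉ Z, G.Adj x y → y ∈ S := by
    rw [hZi]
    exact fun x hx y hy hxy => ((h.comp i).2.1.2 x hx y hxy).resolve_left hy
  constructor
  · intro x hx y hy y' hy' hxy hxy'
    rw [← hZi] at hy hy'
    rcases hs2 with hs2 | hs2 | hs2
    · rw [hs2] at hy hy'
      rw [Set.mem_singleton_iff.1 hy, Set.mem_singleton_iff.1 hy']
    · exact absurd hs2 hcompl
    · exact hs2.2 x (hZS x hx) y hy y' hy' hxy.symm hxy'.symm
  · ext e
    constructor
    · intro he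
      obtain ⟨x, hx, y, hy, hxy, rfl⟩ := hs1 e he
      exact ⟨y, hadjS x hx y hy hxy, x, hZi ▸ hx, hxy.symm, Sym2.eq_swap⟩
    · rintro ⟨x, hx, y, hy, hxy, rfl⟩
      rw [Sym2.eq_swap]
      exact hZ' y (hZi ▸ hy) x (hZS x hx) hxy.symm

theorem mclosed_edgesBetween (i : Fin 3) : MClosed G ⟨∅, edgesBetween G S (H i)⟩ (H i) := by
  refine (mclosed_iff_of_verts_eq rfl).2 fun x hx y hy hxy => ?_
  exact ⟨y, ((h.comp i).2.1.2 x hx y hxy).resolve_left hy, x, hx, hxy.symm, Sym2.eq_swap⟩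

/-- Sending each vertex of S to its unique neighbor in H i puts these edges in bijection with S, so
there are three. -/
theorem edgesBetween_mem {i : Fin 3} (hi : OneNeighbor G S (H i)) :
    (⟨∅, edgesBetween G S (H i)⟩ : MixedSet V) ∈ cutClass G 3 := by
  refine ⟨?_, ?_, by simp, disconnects_iff.2 ⟨_, h.mclosed_edgesBetween i, (h.comp i).1, a,
    fun h' => h.notMem h' h.mem, by simp⟩⟩
  · rintro e ⟨x, -, y, -, hxy, rfl⟩
    exact hxy
  · choose! f hf hxf using fun x (hx : x ∈ S) => h.exists_adj hx i
    have : edgesBetween G S (H i) = (fun x => s(x, f x)) '' S := by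
      ext e
      constructor
      · rintro ⟨x, hx, y, hy, hxy, rfl⟩
        exact ⟨x, hx, by rw [hi x hx y hy (f x) (hf x hx) hxy (hxf x hx)]⟩
      · rintro ⟨x, hx, rfl⟩
        exact ⟨x, hx, f x, hf x hx, hxf x hx, rfl⟩
    rw [this, Set.InjOn.ncard_image, h.card]
    intro x hx y hy he
    exact (cross_eq hx (h.notMem (hf y hy)) he).1

theorem edgesBetween_contains (i : Fin 3) :
    (⟨∅, edgesBetween G S (H i)⟩ : MixedSet V).Contains (lineCut G S (H i ∪ S)) := by
  refine ⟨by simp, ?_⟩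
  rintro e ⟨x, hx, y, hy, hxy, rfl⟩
  by_cases hc : IsCubicVertex G x
  · left
    rw [h.lineCut_edges]
    exact ⟨x, hx, y, hy, hc, hxy, rfl⟩
  · exact Or.inr ⟨x, ⟨hx, hc⟩, Sym2.mem_mk_left x y⟩

/-- The extended cut towards `H i`. -/
theorem isExtendedCut_iff {i : Fin 3} {M : MixedSet V} :
    IsExtendedCut G (lineCut G S (H i ∪ S)) M ↔
      (OneNeighbor G S (H i) ∧ M = ⟨∅, edgesBetween G S (H i)⟩) ∨
        (¬ OneNeighbor G S (H i) ∧ M = lineCut G S (H i ∪ S)) := by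
  have := h.tri.finite
  constructor
  · rintro (⟨hM, hc⟩ | ⟨hno, rfl⟩)
    · have := h.of_contains hM hc
      refine Or.inl ⟨this.1, ?_⟩
      ext1
      · exact verts_of_mem_cutClass_three hM
      · exact this.2
    · exact Or.inr ⟨fun hi => hno ⟨_, h.edgesBetween_mem hi, h.edgesBetween_contains i⟩, rfl⟩
  · rintro (⟨hi, rfl⟩ | ⟨hi, rfl⟩)
    · exact Or.inl ⟨h.edgesBetween_mem hi, h.edgesBetween_contains i⟩
    · exact Or.inr ⟨fun ⟨N, hN, hc⟩ => hi (h.of_contains hN hc).1, rfl⟩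

/-- Explicit form of the neighborhood: S, the neighbors of cubic vertices of S, and all neighbors of
S inside those components where the extended cut has three edges. -/
theorem mem_neighborhood {v : V} : v ∈ tripleNeighborhood G S ↔ v ∈ S ∨ ∃ i, v ∈ H i ∧
    ∃ x ∈ S, G.Adj x v ∧ (IsCubicVertex G x ∨ OneNeighbor G S (H i)) := by
  have hsup : ∀ i, ∃ M, IsExtendedCut G (lineCut G S (H i ∪ S)) M ∧ ∀ v, v ∈ M.support ↔
      (v ∈ S ∨ v ∈ H i ∧ ∃ x ∈ S, G.Adj x v ∧ (IsCubicVertex G x ∨ OneNeighbor G S (H i))) := by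
    intro i
    by_cases hi : OneNeighbor G S (H i)
    · refine ⟨_, h.isExtendedCut_iff.2 (Or.inl ⟨hi, rfl⟩), fun v => ?_⟩
      simp only [MixedSet.support, Set.empty_union, Set.mem_ofPred_eq]
      constructor
      · rintro ⟨e, ⟨x, hx, y, hy, hxy, rfl⟩, hv⟩
        rcases Sym2.mem_iff.1 hv with rfl | rfl
        · exact Or.inl hx
        · exact Or.inr ⟨hy, x, hx, hxy, Or.inr hi⟩
      · rintro (hv | ⟨hv, x, hx, hxv, -⟩)
        · obtain ⟨y, hy, hvy⟩ := h.exists_adj hv i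
          exact ⟨_, ⟨v, hv, y, hy, hvy, rfl⟩, Sym2.mem_mk_left v y⟩
        · exact ⟨_, ⟨x, hx, v, hv, hxv, rfl⟩, Sym2.mem_mk_right x v⟩
    · refine ⟨_, h.isExtendedCut_iff.2 (Or.inr ⟨hi, rfl⟩), fun v => ?_⟩
      simp only [MixedSet.support, h.lineCut_edges, Set.mem_union, Set.mem_ofPred_eq]
      constructor
      · rintro (hv | ⟨e, ⟨x, hx, y, hy, hc, hxy, rfl⟩, hv⟩)
        · exact Or.inl hv.1
        · rcases Sym2.mem_iff.1 hv with rfl | rfl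
          · exact Or.inl hx
          · exact Or.inr ⟨hy, x, hx, hxy, Or.inl hc⟩
      · rintro (hv | ⟨hv, x, hx, hxv, hc | hc⟩)
        · by_cases hc : IsCubicVertex G v
          · obtain ⟨y, hy, hvy⟩ := h.exists_adj hv i
            exact Or.inr ⟨_, ⟨v, hv, y, hy, hc, hvy, rfl⟩, Sym2.mem_mk_left v y⟩
          · exact Or.inl ⟨hv, hc⟩
        · exact Or.inr ⟨_, ⟨x, hx, v, hv, hc, hxv, rfl⟩, Sym2.mem_mk_right x v⟩
        · exact absurd hc hi
  have huniq : ∀ i M M', IsExtendedCut G (lineCut G S (H i ∪ S)) M →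
      IsExtendedCut G (lineCut G S (H i ∪ S)) M' → M = M' := by
    intro i M M' h1 h2
    rw [h.isExtendedCut_iff] at h1 h2
    rcases h1 with ⟨h1, rfl⟩ | ⟨h1, rfl⟩ <;> rcases h2 with ⟨h2, rfl⟩ | ⟨h2, rfl⟩
    · rfl
    · exact absurd h1 h2
    · exact absurd h2 h1
    · rfl
  constructor
  · rintro ⟨A, hA, M, hM, hv⟩
    obtain ⟨i, rfl⟩ := h.mem_parts.1 hA
    obtain ⟨M', hM', hs⟩ := hsup i
    rw [huniq i M M' hM hM', hs] at hv
    exact hv.imp_right fun h' => ⟨i, h'⟩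
  · rintro (hv | ⟨i, hv⟩)
    · obtain ⟨M, hM, hs⟩ := hsup 0
      exact ⟨_, h.mem_parts.2 ⟨0, rfl⟩, M, hM, (hs v).2 (Or.inl hv)⟩
    · obtain ⟨M, hM, hs⟩ := hsup i
      exact ⟨_, h.mem_parts.2 ⟨i, rfl⟩, M, hM, (hs v).2 (Or.inr hv)⟩

/-- The boundary of the triple complex inside `H i ∪ S`. -/
theorem boundary_mem (i : Fin 3) :
    {v | (v ∈ S ∧ ¬ IsCubicVertex G v ∧ ¬ OneNeighbor G S (H i)) ∨ (v ∈ H i ∧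
      ∃ x ∈ S, G.Adj x v ∧ (IsCubicVertex G x ∨ OneNeighbor G S (H i)))} ∈ tripleBoundaries G S := by
  by_cases hi : OneNeighbor G S (H i)
  · refine ⟨_, h.mem_parts.2 ⟨i, rfl⟩, _, h.isExtendedCut_iff.2 (Or.inl ⟨hi, rfl⟩), (H i)ᶜ, ?_, ?_, ?_⟩
    · rw [isComponent_iff]
      refine ⟨⟨a, fun h' => h.notMem h' h.mem⟩, (h.mclosed_edgesBetween i).compl_of_verts_eq rfl, ?_⟩
      intro Y hY ⟨y, hy⟩ hYc
      refine hY.antisymm fun x hx => ?_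
      by_contra hxY
      obtain ⟨b, hb, hab⟩ := h.exists_adj h.mem i
      -- The cut edge ab must leave Y, and b lies in H i, so Y contains a. The same holds for the
      -- rest of the complement of H i, a contradiction.
      have key : ∀ Y ⊆ (H i)ᶜ, MClosed G ⟨∅, edgesBetween G S (H i)⟩ Y → ∀ y ∈ Y, ∀ z ∉ Y, a ∈ Y := by
        intro Y hY hYc y hy z hz
        obtain ⟨u, hu, v, hv, -, he⟩ := (h.tri.cut_structure (h.edgesBetween_mem hi) hYc hy hz).1
          s(a, b) ⟨a, h.mem, b, hb, hab, rfl⟩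
        rcases Sym2.eq_iff.1 he with ⟨rfl, -⟩ | ⟨-, rfl⟩
        · exact hu
        · exact absurd hb (hY hu)
      have h1 := key Y hY hYc y hy x hxY
      have h2 := key ((H i)ᶜ \ Y) Set.sdiff_subset
        (((h.mclosed_edgesBetween i).compl_of_verts_eq rfl).diff hYc) x ⟨hx, hxY⟩ y (fun h' => h'.2 hy)
      exact h2.2 h1
    · rw [compl_compl]; exact Set.subset_union_left
    · ext v
      rw [compl_compl]
      simp only [MixedSet.support, Set.empty_union, Set.mem_ofPred_eq, Set.mem_inter_iff, hi,
        not_true, and_false, false_or, or_true, and_true]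
      constructor
      · rintro ⟨hv, x, hx, hxv⟩
        exact ⟨hv, _, ⟨x, hx, v, hv, hxv, rfl⟩, Sym2.mem_mk_right x v⟩
      · rintro ⟨hv, e, ⟨x, hx, y, hy, hxy, rfl⟩, hve⟩
        rcases Sym2.mem_iff.1 hve with rfl | rfl
        · exact absurd hx (h.notMem hv)
        · exact ⟨hv, x, hx, hxy⟩
  · refine ⟨_, h.mem_parts.2 ⟨i, rfl⟩, _, h.isExtendedCut_iff.2 (Or.inr ⟨hi, rfl⟩),
      {v | v ∉ H i ∧ (v ∈ S → IsCubicVertex G v)}, ?_, ?_, ?_⟩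
    · rw [isComponent_iff]
      refine ⟨⟨a, fun h' => h.notMem h' h.mem, fun _ => h.cubic⟩, ⟨?_, ?_⟩, ?_⟩
      · exact fun x hx hx' => hx'.2 (hx.2 hx'.1)
      · intro x hx y hxy hyv hye
        refine ⟨fun hy => ?_, fun hy => ?_⟩
        · have hxS : x ∈ S := ((h.comp i).2.1.2 y hy x hxy.symm).resolve_left hx.1
          apply hye
          rw [h.lineCut_edges]
          exact ⟨x, hxS, y, hy, hx.2 hxS, hxy, rfl⟩
        · by_contra hc
          exact hyv ⟨hy, hc⟩
      · intro Y hY ⟨y, hy⟩ hYc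
        have hedge : ∀ x y, x ∉ H i → y ∉ H i → s(x, y) ∉ (lineCut G S (H i ∪ S)).edges := by
          intro x y hx hy he
          rw [h.lineCut_edges] at he
          obtain ⟨u, hu, v, hv, -, -, he⟩ := he
          rcases Sym2.eq_iff.1 he with ⟨rfl, rfl⟩ | ⟨rfl, rfl⟩
          · exact hy hv
          · exact hx hv
        -- `Y` contains or avoids every other component
        have hsub : ∀ j, j ≠ i → ∀ x ∈ H j, x ∈ Y → H j ⊆ Y := by
          intro j hj x hx hxY
          have hcl : Closed G S (Y ∩ H j) := by
            refine ⟨fun x hx => h.notMem hx.2, fun x hx y hxy => ?_⟩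
            rcases (h.comp j).2.1.2 x hx.2 y hxy with hyj | hyj
            · refine Or.inl ⟨hYc.2 x hx.1 y hxy (fun h' => h.notMem hyj h'.1) ?_, hyj⟩
              exact hedge _ _ (fun h' => hj (h.idx_eq hx.2 h')) (fun h' => hj (h.idx_eq hyj h'))
            · exact Or.inr hyj
          exact fun u hu => ((h.comp j).subset_of_mem hcl hx ⟨hxY, hx⟩ hu).1
        -- A cubic vertex of S keeps its edges into the components other than H i. In particular a
        -- joins these two components, which makes the set connected.
        have hcubY : ∀ x ∈ S, IsCubicVertex G x → ∀ j, j ≠ i → (x ∈ Y ↔ H j ⊆ Y) := by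
          intro x hx hc j hj
          obtain ⟨y, hy, hxy⟩ := h.exists_adj hx j
          have hyi : y ∉ H i := fun h' => hj (h.idx_eq hy h')
          have hxi : x ∉ H i := fun h' => h.notMem h' hx
          constructor
          · intro hxY
            exact hsub j hj y hy (hYc.2 x hxY y hxy (fun h' => h.notMem hy h'.1) (hedge _ _ hxi hyi))
          · intro hsub
            exact hYc.2 y (hsub hy) x hxy.symm (fun h' => h'.2 hc) (hedge _ _ hyi hxi)
        have haY : a ∈ Y := by
          have hyY := hY hy
          obtain ⟨j, k, hji, hki, hjk⟩ := fin_three_others i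
          rcases h.cover y with h1 | ⟨l, hl⟩
          · have h2 := (hcubY y h1 (hyY.2 h1) j hji).1 hy
            exact (hcubY a h.mem h.cubic j hji).2 h2
          · have hli : l ≠ i := by
              rintro rfl
              exact hyY.1 hl
            exact (hcubY a h.mem h.cubic l hli).2 (hsub l hli y hl hy)
        refine hY.antisymm fun x hx => ?_
        have hall := fun j hj => (hcubY a h.mem h.cubic j hj).1 haY
        rcases h.cover x with h1 | ⟨l, hl⟩
        · obtain ⟨j, k, hji, hki, hjk⟩ := fin_three_others i
          exact (hcubY x h1 (hx.2 h1) j hji).2 (hall j hji)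
        · exact hall l (by rintro rfl; exact hx.1 hl) hl
    · intro v hv
      simp only [Set.mem_compl_iff, Set.mem_ofPred_eq, not_and_or, not_not, Classical.not_imp] at hv
      exact hv.imp_right fun h' => h'.1
    · ext v
      have hvi := fun hv : v ∈ H i => h.notMem hv
      simp only [MixedSet.support, h.lineCut_edges, Set.mem_ofPred_eq, Set.mem_inter_iff, hi,
        not_false_eq_true, and_true, or_false, Set.mem_compl_iff, Set.mem_union]
      constructor
      · rintro (hv | ⟨hv, x, hx, hxv, hc⟩)
        · exact ⟨fun h' => hv.2 (h'.2 hv.1), Or.inl hv⟩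
        · exact ⟨fun h' => h'.1 hv, Or.inr ⟨_, ⟨x, hx, v, hv, hc, hxv, rfl⟩, Sym2.mem_mk_right x v⟩⟩
      · rintro ⟨hn, hv | ⟨e, ⟨x, hx, y, hy, hc, hxy, rfl⟩, hve⟩⟩
        · exact Or.inl hv
        · rcases Sym2.mem_iff.1 hve with rfl | rfl
          · exact absurd ⟨fun h' => h.notMem h' hx, fun _ => hc⟩ hn
          · exact Or.inr ⟨hy, x, hx, hxy, hc⟩

/-- The boundary inside H i ∪ S is contained in an image of S, hence has at most three vertices, so
a three-element subset is the whole boundary. -/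
theorem subset_boundary_eq {i : Fin 3} {T : Set V} (hT : T.ncard = 3)
    (hsub : ∀ v ∈ T, (v ∈ S ∧ ¬ IsCubicVertex G v ∧ ¬ OneNeighbor G S (H i)) ∨ (v ∈ H i ∧
      ∃ x ∈ S, G.Adj x v ∧ (IsCubicVertex G x ∨ OneNeighbor G S (H i)))) :
    T ∈ tripleBoundaries G S := by
  have := h.tri.finite
  classical
  choose! f hf hxf using fun x (hx : x ∈ S) => h.exists_adj hx i
  have key := h.boundary_mem i
  rwa [← Set.eq_of_subset_of_ncard_le hsub ?_] at key
  rw [hT, ← h.card]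
  refine (Set.ncard_le_ncard (t := (fun x => if IsCubicVertex G x ∨ OneNeighbor G S (H i) then f x
    else x) '' S) ?_).trans (Set.ncard_image_le)
  rintro v (⟨hv, hc, ho⟩ | ⟨hv, x, hx, hxv, hc⟩)
  · exact ⟨v, hv, by simp [hc, ho]⟩
  · refine ⟨x, hx, ?_⟩
    simp only [hc, if_true]
    rcases hc with hc | hc
    · exact h.cubic_unique hx hc (hf x hx) hv (hxf x hx) hxv
    · exact hc x hx _ (hf x hx) _ hv (hxf x hx) hxv

end TripleLine

/-! ### Triple complexes and complemented cutsets -/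

theorem mem_tripleComplex_or_boundary {S T : Set V} (hT : T ∈ threeCutsets G)
    (hsub : T ⊆ tripleNeighborhood G S) : T ∈ tripleComplex G S ∨ T ∈ tripleBoundaries G S := by
  by_cases hb : T ∈ tripleBoundaries G S
  · exact Or.inr hb
  · exact Or.inl ⟨hT, hsub, hb⟩


/-- The trivial cutset subordinated to the line of a triple cut belongs to the triple complex. -/
theorem TriCond.subordinated_mem (h : TriCond G) {S T : Set V} (hST : Subordinated G T S) :
    T ∈ tripleComplex G S := by
  obtain ⟨H, a, hl, rfl⟩ := h.exists_tripleLine hST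
  refine ⟨hST.1, fun v hv => ?_, ?_⟩
  · obtain ⟨i, hi, -⟩ := hl.cubic_adj hl.mem hl.cubic hv
    exact hl.mem_neighborhood.2 (Or.inr ⟨i, hi, a, hl.mem, hv, Or.inl hl.cubic⟩)
  · rintro ⟨A, hA, M, -, K, -, hKA, hT⟩
    obtain ⟨i, rfl⟩ := hl.mem_parts.1 hA
    obtain ⟨j, -, hj, -, -⟩ := fin_three_others i
    obtain ⟨y, hy, hay⟩ := hl.exists_adj hl.mem j
    have : y ∈ Kᶜ ∩ M.support := hT ▸ hay
    rcases hKA this.1 with h1 | h1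
    · exact hj (hl.idx_eq hy h1)
    · exact hl.notMem hy h1

theorem TriCond.trivial_of_tripleComplex_eq (h : TriCond G) {S T : Set V} (hS : S ∈ tripleLines G)
    (hT : tripleComplex G S = {T}) : IsTrivialCutset G T := by
  obtain ⟨T', hT'⟩ := hS
  have h1 := h.subordinated_mem hT'
  rw [hT, Set.mem_singleton_iff] at h1
  subst h1
  obtain ⟨a, -, ha⟩ := hT'.2.2.2.1
  exact ⟨hT'.1, a, ha⟩

/-- A complemented nontrivial cutset is independent with the lines of triple cuts. -/
theorem Config.not_splits_line {T K₁ K₂ : Set V} {t₁ t₂ t₃ s₁ : V}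
    (h : Config G T K₁ K₂ t₁ t₂ t₃ s₁) {S : Set V} {H : Fin 3 → Set V} {a : V}
    (hl : TripleLine G S H a) (hS3 : S ∈ threeCutsets G) : ¬ Splits G S T := by
  have := h.tri.finite
  intro hsp
  have hdisj : ∀ x ∈ S, x ∉ T := fun x hx hxT => h.indep S hS3 ⟨x, hx, hxT⟩ hsp
  -- A component H i missing T would stay connected in G - T and be adjacent to all of S, so T would
  -- not split S.
  have hmeet : ∀ i, ∃ t ∈ T, t ∈ H i := by
    intro i
    by_contra! hno
    obtain ⟨D, hD, ⟨x, hx, hxD⟩, y, hy, hyD, hyS⟩ :=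
      splits_iff.1 (h.tri.splits_symm h.T_mem hsp)
    obtain ⟨u, hu, hxu⟩ := hl.exists_adj hx i
    obtain ⟨v, hv, hyv⟩ := hl.exists_adj hy i
    have hcl : Closed G S (D ∩ H i) := by
      refine ⟨fun x hx => hl.notMem hx.2, fun x hx y hxy => ?_⟩
      rcases (hl.comp i).2.1.2 x hx.2 y hxy with h1 | h1
      · exact Or.inl ⟨(hD.2 x hx.1 y hxy).resolve_right fun h' => hno y h' h1, h1⟩
      · exact Or.inr h1
    have huD : u ∈ D := (hD.2 x hxD u hxu).resolve_right fun h' => hno u h' hu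
    have hvD := ((hl.comp i).subset_of_mem hcl hu ⟨huD, hu⟩ hv).1
    exact (hD.2 v hvD y hyv.symm).elim hyD hyS
  choose t ht htH using hmeet
  have htT : ∀ x ∈ T, ∃ i, x = t i := by
    intro x hx
    have hne : ∀ i j, i ≠ j → t i ≠ t j := fun i j hij he => hij (hl.idx_eq (htH i) (he ▸ htH j))
    rcases eq_of_ncard_three h.ncard_T (ht 0) (ht 1) (ht 2) hx (hne _ _ (by decide))
      (hne _ _ (by decide)) (hne _ _ (by decide)) with h1 | h1 | h1 <;> exact ⟨_, h1⟩
  -- a component of `G - T` with one vertex of `S` is a single vertex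
  have hone : ∀ K s, Comp G T K → s ∈ S → s ∈ K → (∀ s' ∈ S, s' ∈ K → s' = s) → False := by
    intro K s hK hs hsK hu
    refine h.nontriv ⟨h.T_mem, s, isComponent_vset_iff.2 ?_⟩
    have hKs : K = {s} := by
      refine Set.eq_singleton_iff_unique_mem.2 ⟨hsK, fun x hx => ?_⟩
      by_contra hxs
      obtain ⟨i, hi⟩ : ∃ i, x ∈ H i := (hl.cover x).resolve_left fun h' => hxs (hu x h' hx)
      obtain ⟨j, -, hj, -, -⟩ := fin_three_others i
      refine h.tri.pair (D := K ∩ H i) (a := s) (b := t i) (z := t j) ?_ ⟨hx, hi⟩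
        (fun h' => hl.notMem h'.2 hs) (fun h' => hK.2.1.1 _ h'.1 (ht i))
        (fun h' => hK.2.1.1 _ h'.1 (ht j)) (fun h' => hdisj s hs (h' ▸ ht j))
        (fun h' => hj (hl.idx_eq (htH j) (h' ▸ htH i)))
      intro u hu' v huv
      rcases hK.2.1.2 u hu'.1 v huv with h1 | h1
      · rcases (hl.comp i).2.1.2 u hu'.2 v huv with h2 | h2
        · exact Or.inl ⟨h1, h2⟩
        · exact Or.inr (Or.inl (hu v h2 h1))
      · rcases (hl.comp i).2.1.2 u hu'.2 v huv with h2 | h2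
        · obtain ⟨k, rfl⟩ := htT v h1
          rw [hl.idx_eq h2 (htH k)]
          exact Or.inr (Or.inr rfl)
        · exact absurd h1 (hdisj v h2)
    rwa [← hKs]
  -- T separates x from y in S. Wherever the third vertex s lies, one of K₁, K₂ contains exactly one
  -- vertex of S, and `hone` makes T trivial.
  obtain ⟨D, hD, ⟨x, hx, hxD⟩, y, hy, hyD, hyT⟩ := splits_iff.1 (h.tri.splits_symm h.T_mem hsp)
  have hKS : ∀ s ∈ S, s ∈ K₁ ∨ s ∈ K₂ := fun s hs => (h.cover s).resolve_left (hdisj s hs)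
  obtain ⟨s, hs, hsx, hsy⟩ : ∃ s ∈ S, s ≠ x ∧ s ≠ y := by
    by_contra! hno
    have : S.ncard ≤ ({x, y} : Set V).ncard := Set.ncard_le_ncard fun s hs => by
      by_cases hsx : s = x
      · exact Or.inl hsx
      · exact Or.inr (hno s hs hsx)
    have := Set.ncard_insert_le x {y}
    rw [Set.ncard_singleton] at this
    have := hl.card
    omega
  have hxy : x ≠ y := fun h' => hyD (h' ▸ hxD)
  have hall : ∀ v ∈ S, v = x ∨ v = y ∨ v = s := fun v hv =>
    eq_of_ncard_three hl.card hx hy hs hv hxy hsx.symm hsy.symm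
  have hopp : ∀ K, Comp G T K → x ∈ K → y ∉ K := fun K hK hxK hyK =>
    hyD (hK.subset_of_mem hD hxK hxD hyK)
  have honly : ∀ (K K' : Set V) (u v : V), Comp G T K → (∀ w ∈ K, w ∉ K') → (∀ w ∈ S, w = u ∨ w = v ∨ w = s) →
      u ∈ S → u ∈ K → v ∈ K' → s ∈ K' → False := by
    intro K K' u v hK hKK' hall hu huK hv hs'
    refine hone K u hK hu huK fun w hw hwK => ?_
    rcases hall w hw with rfl | rfl | rfl
    · rfl
    · exact absurd hv (hKK' _ hwK)
    · exact absurd hs' (hKK' _ hwK)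
  have hall' : ∀ v ∈ S, v = y ∨ v = x ∨ v = s := fun v hv => by
    rcases hall v hv with h1 | h1 | h1 <;> simp [h1]
  have hdisj' : ∀ v ∈ K₂, v ∉ K₁ := fun v hv hv' => h.disj v hv' hv
  rcases hKS s hs with hs' | hs' <;> rcases hKS x hx with hx' | hx'
  · exact honly K₂ K₁ y x h.comp2 hdisj' hall' hy ((hKS y hy).resolve_left (hopp _ h.comp1 hx'))
      hx' hs'
  · exact honly K₂ K₁ x y h.comp2 hdisj' hall hx hx'
      ((hKS y hy).resolve_right (hopp _ h.comp2 hx')) hs'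
  · exact honly K₁ K₂ x y h.comp1 h.disj hall hx hx'
      ((hKS y hy).resolve_left (hopp _ h.comp1 hx')) hs'
  · exact honly K₁ K₂ y x h.comp1 h.disj hall' hy
      ((hKS y hy).resolve_right (hopp _ h.comp2 hx')) hx' hs'

/-- A complemented cutset whose other boundary belongs to a triple complex. -/
theorem Config.mem_or_boundary_of_triple {T K₁ K₂ : Set V} {t₁ t₂ t₃ s₁ : V}
    (h : Config G T K₁ K₂ t₁ t₂ t₃ s₁) {S : Set V} (hS : S ∈ tripleLines G)
    (hT : ({s₁, t₂, t₃} : Set V) ∈ tripleComplex G S) :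
    T ∈ tripleComplex G S ∨ T ∈ tripleBoundaries G S := by
  obtain ⟨T₀, hT₀⟩ := hS
  obtain ⟨H, a, hl, -⟩ := h.tri.exists_tripleLine hT₀
  have hS3 := hT₀.2.1
  have := h.tri.finite
  obtain ⟨-, hTn, hTb⟩ := hT
  have nbh : ∀ v, v = s₁ ∨ v = t₂ ∨ v = t₃ → v ∈ tripleNeighborhood G S := fun v hv =>
    hTn (mem_triple.2 hv)
  -- it suffices to find `t₁` in the neighborhood
  suffices hmain : t₁ ∈ tripleNeighborhood G S by
    refine mem_tripleComplex_or_boundary h.T_mem fun v hv => ?_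
    rcases h.mem_T.1 hv with rfl | hv
    · exact hmain
    · exact nbh v (Or.inr hv)
  by_contra ht₁
  have ht₁S : t₁ ∉ S := fun h' => ht₁ (hl.mem_neighborhood.2 (Or.inl h'))
  have hind := h.not_splits_line hl hS3
  -- the component of the line which contains `t₁`
  obtain ⟨i, hi⟩ := (hl.cover t₁).resolve_left ht₁S
  have hTi : ∀ t ∈ T, t ∈ H i ∨ t ∈ S := fun t ht =>
    subset_of_not_splits (hl.comp i) hind h.t1_mem hi ht
  obtain ⟨b, hb, hbT⟩ : ∃ b ∈ S, b ∉ T := by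
    by_contra! hno
    refine ht₁S ((Set.eq_of_subset_of_ncard_le hno ?_).symm ▸ h.t1_mem)
    rw [h.ncard_T, hl.card]
  -- all other components lie on the side of `b`
  have hside : ∀ K, Comp G T K → b ∈ K → ∀ j, j ≠ i → H j ⊆ K := by
    intro K hK hbK j hj
    obtain ⟨y, hy, hby⟩ := hl.exists_adj hb j
    have hno : ∀ t ∈ T, t ∉ H j := by
      intro t ht htj
      rcases hTi t ht with h1 | h1
      · exact hj (hl.idx_eq htj h1)
      · exact hl.notMem htj h1
    have hcl : Closed G S (K ∩ H j) := by
      refine ⟨fun x hx => hl.notMem hx.2, fun x hx y hxy => ?_⟩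
      rcases (hl.comp j).2.1.2 x hx.2 y hxy with h1 | h1
      · exact Or.inl ⟨(hK.2.1.2 x hx.1 y hxy).resolve_right fun h' => hno y h' h1, h1⟩
      · exact Or.inr h1
    have hyK : y ∈ K := (hK.2.1.2 b hbK y hby).resolve_right fun h' => hno y h' hy
    exact fun u hu => ((hl.comp j).subset_of_mem hcl hy ⟨hyK, hy⟩ hu).1
  have hsideS : ∀ K, Comp G T K → b ∈ K → ∀ x ∈ S, x ∉ T → x ∈ K := by
    intro K hK hbK x hx hxT
    obtain ⟨j, k, hji, hki, hjk⟩ := fin_three_others i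
    obtain ⟨y, hy, hxy⟩ := hl.exists_adj hx j
    exact (hK.2.1.2 y (hside K hK hbK j hji hy) x hxy.symm).resolve_right hxT
  have hfar : ∀ K, Comp G T K → b ∈ K → ∀ x, x ∉ K → x ∉ T → x ∈ H i := by
    intro K hK hbK x hx hxT
    rcases hl.cover x with h1 | ⟨j, hj⟩
    · exact absurd (hsideS K hK hbK x h1 hxT) hx
    · by_cases hji : j = i
      · exact hji ▸ hj
      · exact absurd (hside K hK hbK j hji hj) hx
  -- neighbors in the neighborhood inside `H i`
  have hy : ∀ v, v = s₁ ∨ v = t₂ ∨ v = t₃ → v ∈ H i → ∃ x ∈ S, G.Adj x v ∧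
      (IsCubicVertex G x ∨ OneNeighbor G S (H i)) ∧ ∀ z ∈ H i, G.Adj x z → z = v := by
    intro v hv hvi
    rcases hl.mem_neighborhood.1 (nbh v hv) with h1 | ⟨j, hj, x, hx, hxv, hc⟩
    · exact absurd h1 (hl.notMem hvi)
    · obtain rfl := hl.idx_eq hj hvi
      refine ⟨x, hx, hxv, hc, fun z hz hxz => ?_⟩
      rcases hc with hc | hc
      · exact hl.cubic_unique hx hc hz hvi hxz hxv
      · exact hc x hx z hz v hvi hxz hxv
  rcases (h.cover b).resolve_left hbT with hbK | hbK
  · -- `K₂` lies inside `H i`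
    have hK₂ : ∀ x ∈ K₂, x ∈ H i := fun x hx =>
      hfar K₁ h.comp1 hbK x (fun h' => h.disj x h' hx) (h.comp2.2.1.1 x hx)
    have hE : ∀ y, (y = t₁ ∨ y ∈ K₂) → y ∈ H i := by
      rintro y (rfl | hy)
      · exact hi
      · exact hK₂ y hy
    have hs : s₁ ∈ H i ∨ s₁ ∈ S := (hl.comp i).2.1.2 t₁ hi s₁ h.adj
    -- For s₁ the alternative would put its neighbor t₁ into the neighborhood; t₂ and t₃ have two
    -- neighbors in E, which lies in H i. Hence T' turns out to be a boundary of the triple complex,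
    -- contrary to assumption.
    have hS' : ∀ x, x = s₁ ∨ x = t₂ ∨ x = t₃ → x ∈ S →
        ¬ IsCubicVertex G x ∧ ¬ OneNeighbor G S (H i) := by
      intro x hx hxS
      by_cases hxs : x = s₁
      · subst hxs
        constructor
        · exact fun hc => ht₁ (hl.mem_neighborhood.2 (Or.inr ⟨i, hi, x, hxS, h.adj.symm, Or.inl hc⟩))
        · exact fun hc => ht₁ (hl.mem_neighborhood.2 (Or.inr ⟨i, hi, x, hxS, h.adj.symm, Or.inr hc⟩))
      · obtain ⟨u, hu, hxu, -⟩ : ∃ y, (y = t₁ ∨ y ∈ K₂) ∧ G.Adj x y ∧ y ≠ x := by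
          rcases hx.resolve_left hxs with rfl | rfl
          · exact h.exists_adj_t2 _
          · exact h.exists_adj_t3 _
        obtain ⟨v, hv, hxv, hvu⟩ : ∃ y, (y = t₁ ∨ y ∈ K₂) ∧ G.Adj x y ∧ y ≠ u := by
          rcases hx.resolve_left hxs with rfl | rfl
          · exact h.exists_adj_t2 _
          · exact h.exists_adj_t3 _
        exact ⟨fun hc => hvu (hl.cubic_unique hxS hc (hE v hv) (hE u hu) hxv hxu),
          fun hc => hvu (hc x hxS v (hE v hv) u (hE u hu) hxv hxu)⟩
    apply hTb
    refine hl.subset_boundary_eq (i := i) h.ncard_T' fun v hv => ?_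
    rw [mem_triple] at hv
    have hvi : v ∈ H i ∨ v ∈ S := by
      rcases hv with rfl | rfl | rfl
      · exact hs
      · exact hTi _ h.t2_mem
      · exact hTi _ h.t3_mem
    rcases hvi with hvi | hvi
    · obtain ⟨x, hx, hxv, hc, -⟩ := hy v hv hvi
      exact Or.inr ⟨hvi, x, hx, hxv, hc⟩
    · exact Or.inl ⟨hvi, hS' v hv hvi⟩
  · -- `K₁` lies inside `H i`
    have hK₁ : ∀ x ∈ K₁, x ∈ H i := fun x hx =>
      hfar K₂ h.comp2 hbK x (h.disj x hx) (h.comp1.2.1.1 x hx)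
    -- Some x in S has s₁ as its only neighbor in H i. It is not in T', whose vertices have another
    -- neighbor in K₁; it is not t₁, which is outside S; it is not in K₁, which lies in H i; and K₂
    -- is not adjacent to s₁.
    obtain ⟨x, hx, hxs, -, hu⟩ := hy s₁ (Or.inl rfl) (hK₁ _ h.mem)
    have hxT' : ¬ (x = s₁ ∨ x = t₂ ∨ x = t₃) := by
      intro hx'
      obtain ⟨y, hy, hys, hxy⟩ := h.exists_adj_K1 hx'
      exact hys (hu y (hK₁ y hy) hxy)
    rcases h.cover x with h1 | h1 | h1
    · rw [h.mem_T] at h1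
      have : x = t₁ := by tauto
      exact ht₁S (this ▸ hx)
    · exact hl.notMem (hK₁ x h1) hx
    · exact h.not_adj h.mem h1 hxs.symm


/-! ### The cyclic structure of a flower -/

/-- The structure of a flower with center `p`, petals `q i`, interiors `I i` between the petals
`q i` and `q (σ i)`, and neighborhood `W`. -/
structure FlowerShape (G : SimpleGraph V) {ι : Type*} (σ : Equiv.Perm ι) (p : V) (q : ι → V)
    (I : ι → Set V) (W : Set V) : Prop where
  tri : TriCond G
  cyc : ∀ J : Set ι, J.Nonempty → (∀ j ∈ J, σ j ∈ J) → ∀ k, k ∈ J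
  ne1 : ∀ i, σ i ≠ i
  ne2 : ∀ i, σ (σ i) ≠ i
  ne3 : ∀ i, σ (σ (σ i)) ≠ i
  q_inj : Function.Injective q
  q_ne : ∀ i, q i ≠ p
  p_notMem : ∀ i, p ∉ I i
  q_notMem : ∀ i j, q j ∉ I i
  idx : ∀ i j v, v ∈ I i → v ∈ I j → i = j
  cover : ∀ v, v = p ∨ (∃ i, v = q i) ∨ ∃ i, v ∈ I i
  I_adj : ∀ i, ∀ x ∈ I i, ∀ y, G.Adj x y → y ∈ I i ∨ y = p ∨ y = q i ∨ y = q (σ i)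
  q_adj : ∀ i j, G.Adj (q i) (q j) → j = σ i ∨ i = σ j
  W_p : p ∈ W
  W_q : ∀ i, q i ∈ W
  W_adj : ∀ i, ∀ u ∈ I i, u ∈ W → G.Adj p u
  W_uniq : ∀ i, ∀ u ∈ I i, u ∈ W → ∀ y, G.Adj p y → (y ∈ I i ∨ y = q i ∨ y = q (σ i)) → y = u
  W_cond : ∀ i, ∀ u ∈ I i, u ∈ W → IsCubicVertex G p ∨ (I (σ.symm i) = ∅ ∧ I (σ i) = ∅)
  W_mem : ∀ i, ∀ u ∈ I i, IsCubicVertex G p → G.Adj p u →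
    (∀ y, G.Adj p y → (y ∈ I i ∨ y = q i ∨ y = q (σ i)) → y = u) → u ∈ W

namespace FlowerShape

variable {ι : Type*} {σ : Equiv.Perm ι} {p : V} {q : ι → V} {I : ι → Set V} {W : Set V}

/-- Reversing the cyclic order: the part following q i becomes the one formerly preceding it. The
cyclic order enters only through the single-orbit permutation σ, so every one-directional argument
transfers to its mirror image. -/
theorem rev (h : FlowerShape G σ p q I W) :
    FlowerShape G σ.symm p q (fun i => I (σ.symm i)) W where
  tri := h.tri
  cyc := by
    intro J ⟨j, hj⟩ hJ k
    by_contra hk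
    refine h.cyc Jᶜ ⟨k, hk⟩ (fun i hi hi' => hi ?_) j hj
    have := hJ _ hi'
    rwa [Equiv.symm_apply_apply] at this
  ne1 := fun i e => h.ne1 i (by nth_rw 1 [← e, Equiv.apply_symm_apply])
  ne2 := fun i e => h.ne2 i (by nth_rw 1 [← e, Equiv.apply_symm_apply, Equiv.apply_symm_apply])
  ne3 := fun i e => h.ne3 i (by
    nth_rw 1 [← e, Equiv.apply_symm_apply, Equiv.apply_symm_apply, Equiv.apply_symm_apply])
  q_inj := h.q_inj
  q_ne := h.q_ne
  p_notMem := fun i => h.p_notMem _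
  q_notMem := fun i => h.q_notMem _
  idx := fun i j v hi hj => σ.symm.injective (h.idx _ _ v hi hj)
  cover := fun v => (h.cover v).imp_right fun h1 => h1.imp_right fun ⟨i, hi⟩ =>
    ⟨σ i, by rwa [Equiv.symm_apply_apply]⟩
  I_adj := fun i x hx y hxy => by
    have := h.I_adj _ x hx y hxy
    rw [Equiv.apply_symm_apply] at this
    tauto
  q_adj := fun i j hij => by
    rcases h.q_adj i j hij with rfl | rfl
    · exact Or.inr (by rw [Equiv.symm_apply_apply])
    · exact Or.inl (by rw [Equiv.symm_apply_apply])
  W_p := h.W_p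
  W_q := h.W_q
  W_adj := fun i => h.W_adj _
  W_uniq := fun i u hu hW y hy hyi => h.W_uniq _ u hu hW y hy (by
    rw [Equiv.apply_symm_apply]; tauto)
  W_cond := fun i u hu hW => by
    have := h.W_cond _ u hu hW
    rw [Equiv.apply_symm_apply] at this
    rw [Equiv.symm_symm, Equiv.symm_apply_apply]
    tauto
  W_mem := fun i u hu hc hpu hy => h.W_mem _ u hu hc hpu (fun y hpy hyi => hy y hpy (by
    rw [Equiv.apply_symm_apply] at hyi; tauto))

variable (h : FlowerShape G σ p q I W)
include h

theorem q_ne_succ (i : ι) : q i ≠ q (σ i) := h.q_inj.ne (h.ne1 i).symm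

/-- If `p`, `q i` and `q (σ i)` separate a subset of `I i`, then they all have neighbors there. -/
theorem exists_adj_of_subset {i : ι} {X : Set V} (hX : X ⊆ I i) {x : V} (hx : x ∈ X)
    (hcl : ∀ x ∈ X, ∀ y, G.Adj x y → y ∈ X ∨ y = p ∨ y = q i ∨ y = q (σ i)) :
    (∃ y ∈ X, G.Adj p y) ∧ (∃ y ∈ X, G.Adj (q i) y) ∧ ∃ y ∈ X, G.Adj (q (σ i)) y := by
  have hp : p ∉ X := fun h' => h.p_notMem i (hX h')
  have hq : q i ∉ X := fun h' => h.q_notMem i i (hX h')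
  have hq' : q (σ i) ∉ X := fun h' => h.q_notMem i _ (hX h')
  have e1 := h.q_ne i
  have e2 := h.q_ne (σ i)
  have e3 := h.q_ne_succ i
  refine ⟨h.tri.exists_adj (b := q i) (c := q (σ i)) hcl hx hp hq hq' e1.symm e2.symm,
    h.tri.exists_adj (b := p) (c := q (σ i)) ?_ hx hq hp hq' e1 e3,
    h.tri.exists_adj (b := p) (c := q i) ?_ hx hq' hp hq e2 e3.symm⟩
  · intro x hx y hy
    have := hcl x hx y hy
    tauto
  · intro x hx y hy
    have := hcl x hx y hy
    tauto

theorem exists_adj_interior {i : ι} (hi : (I i).Nonempty) :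
    (∃ y ∈ I i, G.Adj p y) ∧ (∃ y ∈ I i, G.Adj (q i) y) ∧ ∃ y ∈ I i, G.Adj (q (σ i)) y := by
  obtain ⟨x, hx⟩ := hi
  exact h.exists_adj_of_subset subset_rfl hx (h.I_adj i)

theorem adj_petal {i : ι} {y : V} (hy : G.Adj (q i) y) :
    y = p ∨ y = q (σ i) ∨ y = q (σ.symm i) ∨ y ∈ I i ∨ y ∈ I (σ.symm i) := by
  rcases h.cover y with h1 | ⟨j, rfl⟩ | ⟨j, hj⟩
  · exact Or.inl h1
  · rcases h.q_adj i j hy with rfl | rfl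
    · tauto
    · rw [Equiv.symm_apply_apply]; tauto
  · rcases h.I_adj j y hj (q i) hy.symm with h1 | h1 | h1 | h1
    · exact absurd h1 (h.q_notMem _ _)
    · exact absurd h1 (h.q_ne i)
    · rw [h.q_inj h1]; tauto
    · rw [h.q_inj h1, Equiv.symm_apply_apply]; tauto

/-- Consecutive petals with nothing between them are adjacent. -/
theorem link {i : ι} (hi : ∀ x, x ∉ I i) : G.Adj (q i) (q (σ i)) := by
  by_contra hn
  -- Without this edge, q (σ i) and the interior after it would be separated from q i by the center
  -- and the next petal alone.
  refine h.tri.pair (D := insert (q (σ i)) (I (σ i))) (a := p) (b := q (σ (σ i))) (z := q i)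
    ?_ (Set.mem_insert _ _) ?_ ?_ ?_ (h.q_ne i) (h.q_inj.ne (h.ne2 i).symm)
  · rintro x (rfl | hx) y hxy
    · rcases h.adj_petal hxy with h1 | h1 | h1 | h1 | h1
      · exact Or.inr (Or.inl h1)
      · exact Or.inr (Or.inr h1)
      · rw [Equiv.symm_apply_apply] at h1
        exact absurd (h1 ▸ hxy.symm) hn
      · exact Or.inl (Or.inr h1)
      · rw [Equiv.symm_apply_apply] at h1
        exact absurd h1 (hi y)
    · rcases h.I_adj _ x hx y hxy with h1 | h1 | h1 | h1
      · exact Or.inl (Or.inr h1)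
      · exact Or.inr (Or.inl h1)
      · exact Or.inl (Or.inl h1)
      · exact Or.inr (Or.inr h1)
  · rintro (h1 | h1)
    · exact h.q_ne _ h1.symm
    · exact h.p_notMem _ h1
  · rintro (h1 | h1)
    · exact h.ne1 _ (h.q_inj h1)
    · exact h.q_notMem _ _ h1
  · rintro (h1 | h1)
    · exact h.q_ne_succ i h1
    · exact h.q_notMem _ _ h1

theorem link_symm {i : ι} (hi : ∀ x, x ∉ I (σ.symm i)) : G.Adj (q i) (q (σ.symm i)) :=
  h.rev.link hi

theorem adj_of_notMem {i : ι} {x y : V} (hx : ¬ (x ∈ I i ∨ x = p ∨ x = q i ∨ x = q (σ i)))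
    (hxy : G.Adj x y) : y ∉ I i := fun hy => hx (h.I_adj i y hy x hxy.symm)

/-- Passing from a petal to the next one inside a closed set. -/
theorem step {R X : Set V} (hX : Closed G R X) {j : ι} (hj : q j ∈ X) (hI : ∀ x ∈ I j, x ∉ R)
    (hq : q (σ j) ∉ R) : q (σ j) ∈ X := by
  by_cases hne : ∀ x, x ∉ I j
  · exact (hX.2 _ hj _ (h.link hne)).resolve_right hq
  · push Not at hne
    obtain ⟨y, hy, hjy⟩ := (h.exists_adj_interior hne).2.1
    have hyX : y ∈ X := (hX.2 _ hj y hjy).resolve_right (hI y hy)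
    obtain ⟨-, -, z, hz, hqz⟩ := h.exists_adj_of_subset (X := X ∩ I j) Set.inter_subset_right
      ⟨hyX, hy⟩ (fun x hx y hxy => by
        rcases h.I_adj j x hx.2 y hxy with h1 | h1
        · exact Or.inl ⟨(hX.2 x hx.1 y hxy).resolve_right (hI y h1), h1⟩
        · exact Or.inr h1)
    exact (hX.2 z hz.1 _ hqz.symm).resolve_right hq

/-- The graph outside a part is not divided by subsets of this part. -/
theorem outside {R X : Set V} {i : ι} (hR : ∀ x ∈ R, x ∈ I i ∨ x = p ∨ x = q i ∨ x = q (σ i))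
    (hX : Closed G R X) {v w : V} (hv : v ∈ X) (hvi : ¬ (v ∈ I i ∨ v = p ∨ v = q i ∨ v = q (σ i)))
    (hwi : ¬ (w ∈ I i ∨ w = p ∨ w = q i ∨ w = q (σ i))) : w ∈ X := by
  have hqR : ∀ j, j ≠ i → j ≠ σ i → q j ∉ R := by
    intro j hj hj' hjR
    rcases hR _ hjR with h1 | h1 | h1 | h1
    · exact h.q_notMem _ _ h1
    · exact h.q_ne _ h1
    · exact hj (h.q_inj h1)
    · exact hj' (h.q_inj h1)
  have hIR : ∀ j, j ≠ i → ∀ x ∈ I j, x ∉ R := by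
    intro j hj x hx hxR
    rcases hR _ hxR with h1 | rfl | rfl | rfl
    · exact hj (h.idx _ _ x hx h1)
    · exact h.p_notMem _ hx
    · exact h.q_notMem _ _ hx
    · exact h.q_notMem _ _ hx
  have fwd : ∀ j, q j ∈ X → j ≠ i → σ j ≠ i → q (σ j) ∈ X := fun j hj hji hji' =>
    h.step hX hj (hIR j hji) (hqR _ hji' (fun e => hji (σ.injective e)))
  have bwd : ∀ j, q (σ j) ∈ X → j ≠ i → j ≠ σ i → q j ∈ X := fun j hj hji hji' => by
    have := h.rev.step hX hj (by rw [Equiv.symm_apply_apply]; exact hIR j hji)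
      (by rw [Equiv.symm_apply_apply]; exact hqR _ hji hji')
    rwa [Equiv.symm_apply_apply] at this
  have hI : ∀ j, j ≠ i → ∀ x ∈ I j, ∃ l, (l = j ∨ l = σ j) ∧ l ≠ i ∧ l ≠ σ i := by
    intro j hj _ _
    by_cases hj' : j = σ i
    · exact ⟨σ j, Or.inr rfl, by rw [hj']; exact h.ne2 i, by rw [hj']; exact h.ne1 _⟩
    · exact ⟨j, Or.inl rfl, hj, hj'⟩
  -- From the first petal found, membership in X travels backwards to q (σ (σ i)) and from there
  -- forwards to all petals outside the part; interiors follow because a piece of one is attached to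
  -- both its petals.
  obtain ⟨j₀, hj₀, hj₀i, hj₀i'⟩ : ∃ j, q j ∈ X ∧ j ≠ i ∧ j ≠ σ i := by
    rcases h.cover v with rfl | ⟨j, rfl⟩ | ⟨j, hj⟩
    · tauto
    · exact ⟨j, hv, fun e => hvi (by rw [e]; tauto), fun e => hvi (by rw [e]; tauto)⟩
    · have hji : j ≠ i := fun e => hvi (Or.inl (e ▸ hj))
      obtain ⟨-, ⟨y, hy, hy'⟩, z, hz, hz'⟩ := h.exists_adj_of_subset (X := X ∩ I j)
        Set.inter_subset_right ⟨hv, hj⟩ (fun x hx y hxy => by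
          rcases h.I_adj j x hx.2 y hxy with h1 | h1
          · exact Or.inl ⟨(hX.2 x hx.1 y hxy).resolve_right (hIR j hji y h1), h1⟩
          · exact Or.inr h1)
      obtain ⟨l, rfl | rfl, hl, hl'⟩ := hI j hji v hj
      · exact ⟨_, (hX.2 y hy.1 _ hy'.symm).resolve_right (hqR _ hl hl'), hl, hl'⟩
      · exact ⟨_, (hX.2 z hz.1 _ hz'.symm).resolve_right (hqR _ hl hl'), hl, hl'⟩
  have hstart : q (σ (σ i)) ∈ X := by
    by_contra hn
    have := h.cyc {k | k = i ∨ k = σ i ∨ q k ∉ X} ⟨i, Or.inl rfl⟩ (by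
      rintro k (rfl | rfl | hk)
      · exact Or.inr (Or.inl rfl)
      · exact Or.inr (Or.inr hn)
      · by_cases hki : k = i
        · exact Or.inr (Or.inl (by rw [hki]))
        · by_cases hki' : k = σ i
          · exact Or.inr (Or.inr (by rw [hki']; exact hn))
          · exact Or.inr (Or.inr fun h' => hk (bwd k h' hki hki'))) j₀
    rcases this with h1 | h1 | h1 <;> contradiction
  have hall : ∀ k, k ≠ i → k ≠ σ i → q k ∈ X := by
    intro k hk hk'
    have := h.cyc {k | k = i ∨ k = σ i ∨ q k ∈ X} ⟨i, Or.inl rfl⟩ (by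
      rintro k (rfl | rfl | hk)
      · exact Or.inr (Or.inl rfl)
      · exact Or.inr (Or.inr hstart)
      · by_cases hki : k = i
        · exact Or.inr (Or.inl (by rw [hki]))
        · by_cases hki' : σ k = i
          · exact Or.inl hki'
          · exact Or.inr (Or.inr (fwd k hk hki hki'))) k
    rcases this with h1 | h1 | h1
    · contradiction
    · contradiction
    · exact h1
  rcases h.cover w with rfl | ⟨j, rfl⟩ | ⟨j, hj⟩
  · tauto
  · exact hall j (fun e => hwi (by rw [e]; tauto)) (fun e => hwi (by rw [e]; tauto))
  · have hji : j ≠ i := fun e => hwi (Or.inl (e ▸ hj))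
    by_contra hwX
    obtain ⟨-, ⟨y, hy, hy'⟩, z, hz, hz'⟩ := h.exists_adj_of_subset (X := I j \ X)
      Set.sdiff_subset ⟨hj, hwX⟩ (fun x hx y hxy => by
        rcases h.I_adj j x hx.1 y hxy with h1 | h1
        · refine Or.inl ⟨h1, fun hyX => hx.2 ?_⟩
          exact (hX.2 y hyX x hxy.symm).resolve_right (hIR j hji x hx.1)
        · exact Or.inr h1)
    obtain ⟨l, rfl | rfl, hl, hl'⟩ := hI j hji w hj
    · exact hy.2 ((hX.2 _ (hall _ hl hl') y hy').resolve_right (hIR _ hji y hy.1))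
    · exact hz.2 ((hX.2 _ (hall _ hl hl') z hz').resolve_right (hIR _ hji z hz.1))

theorem exists_outside (i : ι) : ∃ v, ¬ (v ∈ I i ∨ v = p ∨ v = q i ∨ v = q (σ i)) := by
  refine ⟨q (σ (σ i)), ?_⟩
  rintro (h1 | h1 | h1 | h1)
  · exact h.q_notMem _ _ h1
  · exact h.q_ne _ h1
  · exact h.ne2 i (h.q_inj h1)
  · exact h.ne1 _ (h.q_inj h1)

/-- The center has a neighbor outside every part. -/
theorem center_adj_outside (i : ι) :
    ∃ v, ¬ (v ∈ I i ∨ v = p ∨ v = q i ∨ v = q (σ i)) ∧ G.Adj p v := by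
  obtain ⟨x, hx⟩ := h.exists_outside i
  have := h.tri.exists_adj (D := {v | ¬ (v ∈ I i ∨ v = p ∨ v = q i ∨ v = q (σ i))}) (a := p)
    (b := q i) (c := q (σ i)) (x := x) (fun x hx y hxy => by
      have := h.adj_of_notMem hx hxy
      simp only [Set.mem_ofPred_eq]
      tauto) hx (by simp) (by simp) (by simp) (h.q_ne i).symm (h.q_ne _).symm
  exact this

/-- The vertices of the neighborhood lying in the same interior coincide. -/
theorem W_eq {i : ι} {u v : V} (hu : u ∈ I i) (huW : u ∈ W) (hv : v ∈ I i) (hvW : v ∈ W) : u = v :=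
  h.W_uniq i v hv hvW u (h.W_adj i u hu huW) (Or.inl hu)

/-- Within I k the center is adjacent only to u, and u is in T. So Z ∩ I k is separated by u and the
two petals, each of which has a neighbor there. -/
theorem ends_mem {T : Set V} (hTW : ∀ v ∈ T, v ∈ W) {k : ι} {u : V} (hu : u ∈ I k) (huT : u ∈ T)
    {Z : Set V} (hZ : Closed G T Z) {x : V} (hx : x ∈ I k) (hxZ : x ∈ Z) :
    (q k ∈ Z ∨ q k ∈ T) ∧ (q (σ k) ∈ Z ∨ q (σ k) ∈ T) := by
  have hcl : ∀ x ∈ Z ∩ I k, ∀ y, G.Adj x y → y ∈ Z ∩ I k ∨ y = u ∨ y = q k ∨ y = q (σ k) := by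
    intro x hx y hxy
    rcases h.I_adj k x hx.2 y hxy with h1 | h1 | h1
    · rcases hZ.2 x hx.1 y hxy with h2 | h2
      · exact Or.inl ⟨h2, h1⟩
      · exact Or.inr (Or.inl (h.W_eq h1 (hTW y h2) hu (hTW u huT)))
    · subst h1
      have := h.W_uniq k u hu (hTW u huT) x hxy.symm (Or.inl hx.2)
      exact absurd huT (hZ.1 u (this ▸ hx.1))
    · exact Or.inr (Or.inr h1)
  have e1 : q k ≠ u := fun e => h.q_notMem k k (e ▸ hu)
  have e2 : q (σ k) ≠ u := fun e => h.q_notMem k _ (e ▸ hu)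
  have n1 : u ∉ Z ∩ I k := fun h' => hZ.1 u h'.1 huT
  have n2 : q k ∉ Z ∩ I k := fun h' => h.q_notMem k k h'.2
  have n3 : q (σ k) ∉ Z ∩ I k := fun h' => h.q_notMem k _ h'.2
  constructor
  · obtain ⟨y, hy, hqy⟩ := h.tri.exists_adj (D := Z ∩ I k) (a := q k) (b := u) (c := q (σ k)) (x := x)
      (fun x hx y hxy => by have := hcl x hx y hxy; tauto) ⟨hxZ, hx⟩ n2 n1 n3 e1 (h.q_ne_succ k)
    exact hZ.2 y hy.1 _ hqy.symm
  · obtain ⟨y, hy, hqy⟩ := h.tri.exists_adj (D := Z ∩ I k) (a := q (σ k)) (b := u) (c := q k) (x := x)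
      (fun x hx y hxy => by have := hcl x hx y hxy; tauto) ⟨hxZ, hx⟩ n3 n1 n2 e2
      (h.q_ne_succ k).symm
    exact hZ.2 y hy.1 _ hqy.symm

/-- If a vertex `u` of a cutset is the only neighbor of the center in `I k` and has neighbors on
both sides, then `I k = {u}`. -/
theorem single_of_adj {T : Set V} (hTW : ∀ v ∈ T, v ∈ W) {k : ι} {u : V} (hu : u ∈ I k)
    (huT : u ∈ T) {E : Set V} (hE : Closed G T E) {y z : V} (hy : y ∈ E) (huy : G.Adj u y)
    (hyp : y ≠ p) (hz : z ∉ E) (hzT : z ∉ T) (huz : G.Adj u z) (hzp : z ≠ p) :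
    (q k ∈ T ∧ q (σ k) ∈ T) ∨ ((∀ x ∈ I k, x = u) ∧
      (∀ w, G.Adj u w → w = p ∨ w = q k ∨ w = q (σ k)) ∧
      ((q k ∈ E ∧ q (σ k) ∉ E ∧ q (σ k) ∉ T) ∨ (q (σ k) ∈ E ∧ q k ∉ E ∧ q k ∉ T))) := by
  have h1 := fun x hx hxZ => h.ends_mem hTW hu huT hE (x := x) hx hxZ
  have h2 := fun x hx hxZ => h.ends_mem hTW hu huT hE.compl (x := x) hx hxZ
  have hz' : z ∈ (E ∪ T)ᶜ := fun h' => h'.elim hz hzT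
  simp only [Set.mem_compl_iff, Set.mem_union, not_or] at h2
  have hd := hE.1
  have ay := h.I_adj k u hu y huy
  have az := h.I_adj k u hu z huz
  -- If I k meets E, both petals lie in E ∪ T; if I k meets the far side, both lie in the far side
  -- or T. Meeting both puts the petals into T, meeting only one conflicts with y or z, and meeting
  -- neither leaves I k = {u}.
  by_cases hx1 : ∃ x ∈ I k, x ∈ E
  · obtain ⟨x, hx, hxE⟩ := hx1
    have e1 := h1 x hx hxE
    by_cases hx2 : ∃ x ∈ I k, x ∉ E ∧ x ∉ T
    · obtain ⟨x', hx', hxE'⟩ := hx2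
      have e2 := h2 x' hx' hxE'
      left
      tauto
    · have : z ∉ I k := fun h' => hx2 ⟨z, h', hz, hzT⟩
      exfalso
      rcases az with h3 | h3 | h3 | h3
      · contradiction
      · contradiction
      · rw [← h3] at e1; tauto
      · rw [← h3] at e1; tauto
  · push Not at hx1
    have hyI : y ∉ I k := fun h' => hx1 y h' hy
    by_cases hx2 : ∃ x ∈ I k, x ∉ E ∧ x ∉ T
    · obtain ⟨x', hx', hxE'⟩ := hx2
      have e2 := h2 x' hx' hxE'
      have := hd y hy
      exfalso
      rcases ay with h3 | h3 | h3 | h3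
      · contradiction
      · contradiction
      · rw [← h3] at e2; tauto
      · rw [← h3] at e2; tauto
    · have hall : ∀ x ∈ I k, x = u := fun x hx => by
        by_cases hxT : x ∈ T
        · exact h.W_eq hx (hTW x hxT) hu (hTW u huT)
        · exact absurd ⟨x, hx, hx1 x hx, hxT⟩ hx2
      right
      refine ⟨hall, fun w hw => ?_, ?_⟩
      · rcases h.I_adj k u hu w hw with h3 | h3
        · exact absurd (hall w h3 ▸ hw) (G.loopless.irrefl u)
        · exact h3
      · have hzI : z ∉ I k := fun h' => hx2 ⟨z, h', hz, hzT⟩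
        have hyz : y ≠ z := fun e => hz (e ▸ hy)
        rcases ay with h3 | h3 | h3 | h3
        · contradiction
        · contradiction
        · rcases az with h4 | h4 | h4 | h4
          · contradiction
          · contradiction
          · exact absurd (h3.trans h4.symm) hyz
          · left; rw [← h3, ← h4]; exact ⟨hy, hz, hzT⟩
        · rcases az with h4 | h4 | h4 | h4
          · contradiction
          · contradiction
          · right; rw [← h3, ← h4]; exact ⟨hy, hz, hzT⟩
          · exact absurd (h3.trans h4.symm) hyz

/-- The neighborhood is not split by a set `{u, q k, q (σ k)}`. -/
theorem not_splits_of_subset {T : Set V} {k : ι} {u : V} (hu : u ∈ I k) (huW : u ∈ W)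
    (huT : u ∈ T) (hq : q k ∈ T) (hq' : q (σ k) ∈ T) (hp : p ∉ T)
    (hT : ∀ v ∈ T, v = u ∨ v = q k ∨ v = q (σ k)) : ¬ Splits G T W := by
  rw [not_splits_iff]
  obtain ⟨o, ho, hpo⟩ := h.center_adj_outside k
  have hTk : ∀ x ∈ T, x ∈ I k ∨ x = p ∨ x = q k ∨ x = q (σ k) := fun x hx => by
    rcases hT x hx with rfl | h1
    · exact Or.inl hu
    · exact Or.inr (Or.inr h1)
  have hW : ∀ v ∈ W, v ∉ T → v = p ∨ ¬ (v ∈ I k ∨ v = p ∨ v = q k ∨ v = q (σ k)) := by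
    intro v hv hvT
    by_cases hvp : v = p
    · exact Or.inl hvp
    · refine Or.inr ?_
      rintro (h1 | h1 | h1 | h1)
      · exact hvT (h.W_eq hu huW h1 hv ▸ huT)
      · exact hvp h1
      · exact hvT (h1 ▸ hq)
      · exact hvT (h1 ▸ hq')
  have hoT : o ∉ T := fun h' => ho (hTk o h')
  intro D hD x hx hxD y hy
  by_cases hyT : y ∈ T
  · exact Or.inr hyT
  refine Or.inl ?_
  have hpD : p ∈ D ↔ o ∈ D :=
    ⟨fun h' => (hD.2 p h' o hpo).resolve_right hoT, fun h' => (hD.2 o h' p hpo.symm).resolve_right hp⟩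
  have hoD : o ∈ D := by
    rcases hW x hx (hD.1 x hxD) with rfl | h1
    · exact hpD.1 hxD
    · exact h.outside hTk hD hxD h1 ho
  rcases hW y hy hyT with rfl | h1
  · exact hpD.2 hoD
  · exact h.outside hTk hD hoD ho h1

/-- If `{p, q k, q (σ k)}` splits the neighborhood, then `I k` meets the neighborhood. -/
theorem exists_mem_of_splits {T : Set V} {k : ι} (hT : ∀ v, v ∈ T ↔ v = p ∨ v = q k ∨ v = q (σ k))
    (hs : Splits G T W) : ∃ u ∈ I k, u ∈ W := by
  by_contra! hno
  obtain ⟨D, hD, ⟨x, hx, hxD⟩, y, hy, hyD, hyT⟩ := splits_iff.1 hs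
  have hout : ∀ v ∈ W, v ∉ T → ¬ (v ∈ I k ∨ v = p ∨ v = q k ∨ v = q (σ k)) := by
    intro v hv hvT h1
    rcases h1 with h1 | h1
    · exact hno v h1 hv
    · exact hvT ((hT v).2 h1)
  exact hyD (h.outside (fun v hv => Or.inr ((hT v).1 hv)) hD hxD (hout x hx (hD.1 x hxD))
    (hout y hy hyT))

/-- If T missed I l, then E ∩ I l would be separated by p and two petals, hence contain a neighbor
of p, and p would lie in E ∪ T. -/
theorem interior_of_closed {T E : Set V} (hE : Closed G T E) (hp : p ∉ E) (hpT : p ∉ T) {l : ι}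
    {x : V} (hx : x ∈ I l) (hxE : x ∈ E) : ∃ u ∈ I l, u ∈ T := by
  by_contra! hno
  obtain ⟨⟨y, hy, hpy⟩, -⟩ := h.exists_adj_of_subset (X := E ∩ I l) Set.inter_subset_right
    ⟨hxE, hx⟩ (fun x hx y hxy => by
      rcases h.I_adj l x hx.2 y hxy with h1 | h1
      · exact Or.inl ⟨(hE.2 x hx.1 y hxy).resolve_right (hno y h1), h1⟩
      · exact Or.inr h1)
  exact (hE.2 y hy.1 p hpy.symm).elim hp hpT

theorem interior_of_petal {T E : Set V} (hE : Closed G T E) (hp : p ∉ E) (hpT : p ∉ T) {l : ι}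
    {x : V} (hx : x ∈ I l) (hl : q l ∈ E) : ∃ u ∈ I l, u ∈ T := by
  obtain ⟨-, ⟨y, hy, hqy⟩, -⟩ := h.exists_adj_interior ⟨x, hx⟩
  rcases hE.2 _ hl y hqy with h1 | h1
  · exact h.interior_of_closed hE hp hpT hy h1
  · exact ⟨y, hy, h1⟩

theorem interior_of_petal_symm {T E : Set V} (hE : Closed G T E) (hp : p ∉ E) (hpT : p ∉ T) {l : ι}
    {x : V} (hx : x ∈ I (σ.symm l)) (hl : q l ∈ E) : ∃ u ∈ I (σ.symm l), u ∈ T :=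
  h.rev.interior_of_petal hE hp hpT hx hl

/-- A petal has degree at least three, and apart from the center only two petals are possible
neighbors outside the adjacent interiors. -/
theorem petal_interior {i : ι} (hp : ¬ G.Adj p (q i)) :
    (∃ y ∈ I i, G.Adj (q i) y) ∨ ∃ y ∈ I (σ.symm i), G.Adj (q i) y := by
  obtain ⟨y, hy, h1, h2⟩ := h.tri.exists_adj_ne (q i) (q (σ i)) (q (σ.symm i))
  rcases h.adj_petal hy with h3 | h3 | h3 | h3 | h3
  · exact absurd (h3 ▸ hy.symm) hp
  · contradiction
  · contradiction
  · exact Or.inl ⟨y, h3, hy⟩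
  · exact Or.inr ⟨y, h3, hy⟩

/-- A closed set not adjacent to the center through petals, and meeting at most one interior,
contains at most two petals. -/
theorem petals_of_closed {T E : Set V} (hE : Closed G T E) {k : ι}
    (hEI : ∀ l, l ≠ k → ∀ x ∈ I l, x ∉ E ∧ x ∉ T) (hp : ∀ l, q l ∈ E → ¬ G.Adj p (q l)) {l : ι}
    (hl : q l ∈ E) : l = k ∨ l = σ k := by
  by_contra! hn
  rcases h.petal_interior (hp l hl) with ⟨y, hy, hly⟩ | ⟨y, hy, hly⟩
  · have := hEI l hn.1 y hy
    exact (hE.2 _ hl y hly).elim this.1 this.2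
  · have := hEI (σ.symm l) (fun e => hn.2 (by rw [← e, Equiv.apply_symm_apply])) y hy
    exact (hE.2 _ hl y hly).elim this.1 this.2

/-- The part before q k is empty, so its two petals are adjacent; the outer one is not in E and thus
belongs to T, with q k as its only neighbor in E. In a configuration only s₁ can be such a vertex.
-/
theorem end_petal {T E : Set V} (hE : Closed G T E) (hpE : p ∉ E) {k : ι}
    (hEI : ∀ l, l ≠ k → ∀ x ∈ I l, x ∉ E ∧ x ∉ T) (hp : ∀ l, q l ∈ E → ¬ G.Adj p (q l))
    (hk : q k ∈ E) :
    q (σ.symm k) ∈ T ∧ ∀ y ∈ E, G.Adj (q (σ.symm k)) y → y = q k := by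
  have hj : σ.symm k ≠ k := h.rev.ne1 k
  have hj2 : σ.symm (σ.symm k) ≠ k := h.rev.ne2 k
  have hI : ∀ x, x ∉ I (σ.symm k) := by
    intro x hx
    obtain ⟨-, -, y, hy, hqy⟩ := h.exists_adj_interior ⟨x, hx⟩
    rw [Equiv.apply_symm_apply] at hqy
    have := hEI _ hj y hy
    exact (hE.2 _ hk y hqy).elim this.1 this.2
  have hpet := fun l hl => h.petals_of_closed hE hEI hp (l := l) hl
  constructor
  · refine (hE.2 _ hk _ (h.link_symm hI)).resolve_left fun h1 => ?_
    rcases hpet _ h1 with h2 | h2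
    · exact hj h2
    · exact hj2 (by rw [h2, Equiv.symm_apply_apply])
  · intro y hy hqy
    rcases h.adj_petal hqy with rfl | h1 | rfl | h1 | h1
    · contradiction
    · rwa [Equiv.apply_symm_apply] at h1
    · exfalso
      rcases hpet _ hy with h2 | h2
      · exact hj2 h2
      · exact h.rev.ne3 k (by rw [h2, Equiv.symm_apply_apply])
    · exact absurd h1 (hI y)
    · exact absurd hy (hEI _ hj2 y h1).1

/-- Any closed set avoiding the center leads to a vertex of the cutset inside an interior. -/
theorem exists_interior_of_closed {T E : Set V} (hE : Closed G T E) (hp : p ∉ E) (hpT : p ∉ T)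
    {x : V} (hx : x ∈ E) : ∃ k, ∃ u ∈ I k, u ∈ T := by
  rcases h.cover x with rfl | ⟨l, rfl⟩ | ⟨l, hl⟩
  · contradiction
  · have hnp : ¬ G.Adj p (q l) := fun h' => (hE.2 _ hx p h'.symm).elim hp hpT
    rcases h.petal_interior hnp with ⟨z, hz, -⟩ | ⟨z, hz, -⟩
    · exact ⟨_, h.interior_of_petal hE hp hpT hz hx⟩
    · exact ⟨_, h.interior_of_petal_symm hE hp hpT hz hx⟩
  · exact ⟨l, h.interior_of_closed hE hp hpT hl hx⟩

end FlowerShape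

/-- `T` has one of the two forms that occur among the boundaries of flower complexes. -/
def FlowerBoundaryShape {ι : Type*} (σ : Equiv.Perm ι) (p : V) (q : ι → V) (I : ι → Set V)
    (W T : Set V) : Prop :=
  ∃ i, T = {p, q i, q (σ i)} ∨ ∃ u ∈ I i, u ∈ W ∧ T = {u, q i, q (σ i)}

theorem FlowerBoundaryShape.of_rev {ι : Type*} {σ : Equiv.Perm ι} {p : V} {q : ι → V}
    {I : ι → Set V} {W T : Set V}
    (h : FlowerBoundaryShape σ.symm p q (fun i => I (σ.symm i)) W T) :
    FlowerBoundaryShape σ p q I W T := by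
  obtain ⟨i, rfl | ⟨u, hu, huW, rfl⟩⟩ := h
  · exact ⟨σ.symm i, Or.inl (by rw [Equiv.apply_symm_apply, Set.pair_comm])⟩
  · exact ⟨σ.symm i, Or.inr ⟨u, hu, huW, by rw [Equiv.apply_symm_apply, Set.pair_comm]⟩⟩

theorem Config.eq_triple {T K₁ K₂ : Set V} {t₁ t₂ t₃ s₁ : V} (c : Config G T K₁ K₂ t₁ t₂ t₃ s₁)
    {x y z : V} (h₁ : t₁ = x ∨ t₁ = y ∨ t₁ = z) (h₂ : t₂ = x ∨ t₂ = y ∨ t₂ = z)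
    (h₃ : t₃ = x ∨ t₃ = y ∨ t₃ = z) : T = {x, y, z} := by
  refine Set.eq_of_subset_of_ncard_le (fun v hv => ?_) ?_ (Set.toFinite _)
  · rw [mem_triple]
    rcases c.mem_T.1 hv with rfl | rfl | rfl <;> assumption
  · rw [c.ncard_T]
    have h1 := Set.ncard_insert_le x {y, z}
    have h2 := Set.ncard_insert_le y {z}
    rw [Set.ncard_singleton] at h2
    omega

/-! ### Flowers whose center lies in T, in T' or in E -/

namespace FlowerShape

variable {ι : Type*} {σ : Equiv.Perm ι} {p : V} {q : ι → V} {I : ι → Set V} {W : Set V}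
  (h : FlowerShape G σ p q I W) {T K₁ K₂ : Set V} {t₁ t₂ t₃ s₁ : V}
  (c : Config G T K₁ K₂ t₁ t₂ t₃ s₁)
include h c

/-- The graph outside a part is connected and misses T, so it cannot meet both K₁ and K₂. -/
theorem side_subset {i : ι} (hTi : ∀ v ∈ T, v ∈ I i ∨ v = p ∨ v = q i ∨ v = q (σ i)) :
    (∀ v ∈ K₁, v ∈ I i ∨ v = p ∨ v = q i ∨ v = q (σ i)) ∨
      ∀ v ∈ K₂, v ∈ I i ∨ v = p ∨ v = q i ∨ v = q (σ i) := by
  by_contra! hno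
  obtain ⟨⟨v, hv, hvi⟩, w, hw, hwi⟩ := hno
  exact c.disj w (h.outside hTi c.comp1.2.1 hv (by tauto) (by tauto)) hw

/-- The component lying inside the part contains a neighbor of p. A neighborhood vertex t in I i is
the only neighbor of p there, so t would be in the component and not in T. -/
theorem notMem_interior_of_center_mem {i : ι}
    (hTi : ∀ v ∈ T, v ∈ I i ∨ v = p ∨ v = q i ∨ v = q (σ i)) (hp : p ∈ T) {t : V} (ht : t ∈ T)
    (htW : t ∈ W) : t ∉ I i := by
  intro hti
  rcases h.side_subset c hTi with h1 | h1
  · obtain ⟨y, hy, hpy⟩ := c.exists_adj1 hp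
    have hyp : y ≠ p := hpy.ne'
    have := h.W_uniq i t hti htW y hpy (by have := h1 y hy; tauto)
    exact c.comp1.2.1.1 y hy (this ▸ ht)
  · obtain ⟨y, hy, hpy⟩ := c.exists_adj2 hp
    have hyp : y ≠ p := hpy.ne'
    have := h.W_uniq i t hti htW y hpy (by have := h1 y hy; tauto)
    exact c.comp2.2.1.1 y hy (this ▸ ht)

theorem shape_of_center_eq_t1 {i : ι}
    (hTi : ∀ v ∈ T, v ∈ I i ∨ v = p ∨ v = q i ∨ v = q (σ i)) (hp : p = t₁)
    (hW : ∀ v, v = s₁ ∨ v = t₂ ∨ v = t₃ → v ∈ W) : FlowerBoundaryShape σ p q I W T := by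
  have hpT : p ∈ T := hp ▸ c.t1_mem
  have h2 := (hTi _ c.t2_mem).resolve_left
    (h.notMem_interior_of_center_mem c hTi hpT c.t2_mem (hW _ (by simp)))
  have h3 := (hTi _ c.t3_mem).resolve_left
    (h.notMem_interior_of_center_mem c hTi hpT c.t3_mem (hW _ (by simp)))
  exact ⟨i, Or.inl (c.eq_triple (Or.inl hp.symm) h2 h3)⟩

-- The case to exclude is t₁ in I i. Then s₁ must be a petal and T' = {p, q i, q (σ i)}; as T'
-- splits the neighborhood, p has a single neighbor in I i. But E lies in I i, and p = t₂ needs more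
-- than one neighbor in E.
set_option maxHeartbeats 1000000 in
theorem shape_of_center_eq_t2 {i : ι}
    (hTi : ∀ v ∈ T, v ∈ I i ∨ v = p ∨ v = q i ∨ v = q (σ i)) (hp : p = t₂)
    (hW : ∀ v, v = s₁ ∨ v = t₂ ∨ v = t₃ → v ∈ W) (hs : Splits G {s₁, t₂, t₃} W) :
    FlowerBoundaryShape σ p q I W T := by
  subst hp
  have h3 := (hTi _ c.t3_mem).resolve_left
    (h.notMem_interior_of_center_mem c hTi c.t2_mem c.t3_mem (hW _ (by simp)))
  have h3' := h3.resolve_left c.ne23.symm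
  by_cases h1 : t₁ ∈ I i
  swap
  · exact ⟨i, Or.inl (c.eq_triple ((hTi _ c.t1_mem).resolve_left h1) (Or.inl rfl) h3)⟩
  exfalso
  have hsi := h.I_adj i t₁ h1 s₁ c.adj
  have hs1 : s₁ ∉ I i := by
    intro hs1
    rcases h.side_subset c hTi with hK | hK
    · obtain ⟨y, hy, hys, hpy⟩ := c.exists_adj_K1 (Or.inr (Or.inl rfl))
      have hyp : y ≠ p := hpy.ne'
      exact hys (h.W_uniq i s₁ hs1 (hW _ (by simp)) y hpy (by have := hK y hy; tauto))
    · obtain ⟨y, hy, hpy⟩ := c.exists_adj2 c.t2_mem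
      have hyp : y ≠ p := hpy.ne'
      have := h.W_uniq i s₁ hs1 (hW _ (by simp)) y hpy (by have := hK y hy; tauto)
      exact c.s1_notMem (this ▸ hy)
  have hsi' := (hsi.resolve_left hs1).resolve_left c.s1_ne.2.1
  have hT' : ∀ v, v ∈ ({s₁, p, t₃} : Set V) ↔ v = p ∨ v = q i ∨ v = q (σ i) := by
    intro v
    have h1 := c.s1_ne.2.2
    rw [mem_triple]
    rcases hsi' with h4 | h4 <;> rcases h3' with h5 | h5
    · exact absurd (h4.trans h5.symm) h1
    · rw [h4, h5]; tauto
    · rw [h4, h5]; tauto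
    · exact absurd (h4.trans h5.symm) h1
  obtain ⟨u, hu, huW⟩ := h.exists_mem_of_splits hT' hs
  have hIcl : Closed G {s₁, p, t₃} (I i) := by
    refine ⟨fun x hx hx' => ?_, fun x hx y hxy => ?_⟩
    · rcases (hT' x).1 hx' with rfl | rfl | rfl
      · exact h.p_notMem _ hx
      · exact h.q_notMem _ _ hx
      · exact h.q_notMem _ _ hx
    · rw [hT']
      exact h.I_adj i x hx y hxy
  have hE : insert t₁ K₂ ⊆ I i := c.comp_E.subset_of_mem hIcl (Set.mem_insert _ _) h1
  have hpE : ∀ y ∈ insert t₁ K₂, G.Adj p y → y = u := fun y hy hpy =>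
    h.W_uniq i u hu huW y hpy (Or.inl (hE hy))
  obtain ⟨y, hy, hpy⟩ := c.exists_adj2 c.t2_mem
  obtain rfl := hpE y (Or.inr hy) hpy
  have hne := c.ne_of_mem (Or.inr hy)
  refine c.false_of_closed (a := s₁) (b := y) (c := t₃) (Z := insert t₁ K₂ \ {y}) (x := t₁)
    (y := p) (r := t₃) (fun h' => c.s1_notMem (h' ▸ hy)) c.s1_ne.2.2 hne.2.2 ?_
    ⟨Set.mem_insert _ _, hne.1.symm⟩ c.t1_mem ?_ c.t2_mem ?_ c.t3_mem (by simp)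
  · have hcl := c.closed_E
    refine closed_triple (fun h' => hcl.1 _ h'.1 (by simp)) (by simp)
      (fun h' => hcl.1 _ h'.1 (by simp)) ?_
    intro x hx z hxz
    by_cases hzy : z = y
    · tauto
    rcases hcl.2 x hx.1 z hxz with h4 | h4
    · exact Or.inl ⟨h4, hzy⟩
    · rw [mem_triple] at h4
      rcases h4 with h4 | rfl | h4
      · tauto
      · exact absurd (hpE x hx.1 hxz.symm) hx.2
      · tauto
  · exact fun h' => c.closed_E.1 _ h'.1 (by simp)
  · rw [mem_triple]
    have h4 := c.s1_ne.2.1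
    have h5 := c.ne23
    have h6 := hne.2.1
    tauto

/-- By `single_of_adj`, an interior t₂ would either have both petals in T', where only t₃ is left
for them, or have just one petal as its neighbor in E, where two neighbors are needed. -/
theorem t2_notMem_of_center_eq_s1 (hp : p = s₁) (hW : ∀ v, v = s₁ ∨ v = t₂ ∨ v = t₃ → v ∈ W)
    (k : ι) : t₂ ∉ I k := by
  intro hk
  have hpE : ∀ y, (y = t₁ ∨ y ∈ K₂) → y ≠ p := by
    rintro y hy rfl
    exact c.closed_E.1 y (by simpa using hy) (by simp [hp])
  obtain ⟨y, hy, h2y, -⟩ := c.exists_adj_t2 p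
  obtain ⟨y', hy', h2y', hne⟩ := c.exists_adj_t2 y
  obtain ⟨z, hz, hzs, h2z⟩ := c.exists_adj_K1 (Or.inr (Or.inl rfl) : t₂ = s₁ ∨ t₂ = t₂ ∨ t₂ = t₃)
  have hzE : z ∉ insert t₁ K₂ := by
    rintro (rfl | hz')
    · exact c.t1_notMem.1 hz
    · exact c.disj z hz hz'
  have hq : ∀ j, q j ≠ t₂ := fun j e => h.q_notMem k j (e ▸ hk)
  rcases h.single_of_adj (T := {s₁, t₂, t₃}) (fun v hv => hW v (mem_triple.1 hv)) hk (by simp)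
    c.closed_E (y := y) (z := z) (by simpa using hy) h2y (hpE y hy) hzE (c.closed_K1.1 z ⟨hz, hzs⟩) h2z
    (hp ▸ hzs) with ⟨h1, h2⟩ | ⟨-, hN, hside⟩
  · rw [mem_triple] at h1 h2
    have e1 := h.q_ne k
    have e2 := h.q_ne (σ k)
    have e3 := h.q_ne_succ k
    rw [hp] at e1 e2
    have h1' := (h1.resolve_left e1).resolve_left (hq _)
    have h2' := (h2.resolve_left e2).resolve_left (hq _)
    exact e3 (h1'.trans h2'.symm)
  · have hyE : y ∈ insert t₁ K₂ := by simpa using hy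
    have hyE' : y' ∈ insert t₁ K₂ := by simpa using hy'
    have h1 := (hN y h2y).resolve_left (hpE y hy)
    have h2 := (hN y' h2y').resolve_left (hpE y' hy')
    rcases h1 with rfl | rfl <;> rcases h2 with rfl | rfl
    · exact hne rfl
    · tauto
    · tauto
    · exact hne rfl

/-- The center s₁ has t₁ as its only neighbor in E, so E meets only one interior I k, the one
containing t₁. No petal is in E, since `end_petal` would give a vertex of T' other than s₁ with one
neighbor in E. So E lies in I k, the vertices t₂, t₃ are the petals of the part, and the
neighborhood vertex in I k, which exists because T' splits the neighborhood, is t₁. -/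
theorem shape_of_center_eq_s1 (hp : p = s₁) (hW : ∀ v, v = s₁ ∨ v = t₂ ∨ v = t₃ → v ∈ W)
    (hs : Splits G {s₁, t₂, t₃} W) : FlowerBoundaryShape σ p q I W T := by
  have ht2 := h.t2_notMem_of_center_eq_s1 c hp hW
  have ht3 := h.t2_notMem_of_center_eq_s1 c.swap hp (fun v hv => hW v (by tauto))
  have hE := c.closed_E
  have hmemE : ∀ {y}, y ∈ insert t₁ K₂ ↔ y = t₁ ∨ y ∈ K₂ := Set.mem_insert_iff
  have hpE : p ∉ insert t₁ K₂ := fun h' => hE.1 p h' (by simp [hp])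
  have hTI : ∀ l, ∀ x ∈ I l, x ∉ ({s₁, t₂, t₃} : Set V) := by
    intro l x hx hxT
    rw [mem_triple] at hxT
    rcases hxT with h1 | h1 | h1
    · exact h.p_notMem l (hp.trans h1.symm ▸ hx)
    · exact ht2 l (h1 ▸ hx)
    · exact ht3 l (h1 ▸ hx)
  have hadj : ∀ y ∈ insert t₁ K₂, G.Adj p y → y = t₁ := fun y hy hpy =>
    c.adj_uniq (hmemE.1 hy) (hp ▸ hpy)
  have hone : ∀ l, ∀ x ∈ I l, x ∈ insert t₁ K₂ → t₁ ∈ I l := by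
    intro l x hx hxE
    obtain ⟨⟨y, hy, hpy⟩, -⟩ := h.exists_adj_of_subset (X := insert t₁ K₂ ∩ I l)
      Set.inter_subset_right ⟨hxE, hx⟩ (fun x hx y hxy => by
        rcases h.I_adj l x hx.2 y hxy with h1 | h1
        · exact Or.inl ⟨(hE.2 x hx.1 y hxy).resolve_right (hTI l y h1), h1⟩
        · exact Or.inr h1)
    exact hadj y hy.1 hpy ▸ hy.2
  obtain ⟨k, hk⟩ : ∃ k, t₁ ∈ I k := by
    by_contra! hno
    obtain ⟨y, hy⟩ := c.comp2.1
    have hyE : y ∈ insert t₁ K₂ := Or.inr hy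
    rcases h.cover y with rfl | ⟨l, rfl⟩ | ⟨l, hl⟩
    · exact hpE hyE
    · have hnp : ¬ G.Adj p (q l) := fun h' =>
        c.t1_notMem.2 (hadj _ hyE h' ▸ hy)
      rcases h.petal_interior hnp with ⟨z, hz, hqz⟩ | ⟨z, hz, hqz⟩
      · exact hno l (hone l z hz ((hE.2 _ hyE z hqz).resolve_right (hTI l z hz)))
      · exact hno _ (hone _ z hz ((hE.2 _ hyE z hqz).resolve_right (hTI _ z hz)))
    · exact hno l (hone l y hl hyE)
  have hEI : ∀ l, l ≠ k → ∀ x ∈ I l, x ∉ insert t₁ K₂ ∧ x ∉ ({s₁, t₂, t₃} : Set V) :=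
    fun l hl x hx => ⟨fun h' => hl (h.idx _ _ _ (hone l x hx h') hk), hTI l x hx⟩
  have hnp : ∀ l, q l ∈ insert t₁ K₂ → ¬ G.Adj p (q l) := fun l hl hpl =>
    h.q_notMem k l (hadj _ hl hpl ▸ hk)
  have hend : ∀ x y, x ∈ ({s₁, t₂, t₃} : Set V) → x ≠ p →
      (∀ z ∈ insert t₁ K₂, G.Adj x z → z = y) → False := by
    intro x y hx hxp hu
    rw [mem_triple] at hx
    rcases hx with rfl | rfl | rfl
    · exact hxp hp.symm
    · obtain ⟨z, hz, hxz, hzy⟩ := c.exists_adj_t2 y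
      exact hzy (hu z (hmemE.2 hz) hxz)
    · obtain ⟨z, hz, hxz, hzy⟩ := c.exists_adj_t3 y
      exact hzy (hu z (hmemE.2 hz) hxz)
  have hk1 : q k ∉ insert t₁ K₂ := fun h' => by
    have := h.end_petal hE hpE hEI hnp h'
    exact hend _ _ this.1 (h.q_ne _) this.2
  have hk2 : q (σ k) ∉ insert t₁ K₂ := fun h' => by
    have := h.rev.end_petal (k := σ k) hE hpE (fun l hl => hEI _ fun e => hl (by
      rw [← e, Equiv.apply_symm_apply])) hnp h'
    exact hend _ _ this.1 (h.q_ne _) this.2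
  have hEk : ∀ y ∈ insert t₁ K₂, y ∈ I k := by
    intro y hy
    rcases h.cover y with rfl | ⟨l, rfl⟩ | ⟨l, hl⟩
    · contradiction
    · rcases h.petals_of_closed hE hEI hnp hy with rfl | rfl <;> contradiction
    · rwa [h.idx k l t₁ hk (hone l y hl hy)]
  have htk : ∀ t, t = t₂ ∨ t = t₃ → t = q k ∨ t = q (σ k) := by
    intro t ht
    obtain ⟨y, hy, hty⟩ := c.exists_adj2 (c.mem_T.2 (Or.inr ht))
    rcases h.I_adj k y (hEk y (Or.inr hy)) t hty.symm with h1 | h1 | h1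
    · rcases ht with rfl | rfl
      · exact absurd h1 (ht2 k)
      · exact absurd h1 (ht3 k)
    · rw [hp] at h1
      rcases ht with rfl | rfl
      · exact absurd h1.symm c.s1_ne.2.1
      · exact absurd h1.symm c.s1_ne.2.2
    · exact h1
  have h2 := htk t₂ (Or.inl rfl)
  have h3 := htk t₃ (Or.inr rfl)
  have hT' : ∀ v, v ∈ ({s₁, t₂, t₃} : Set V) ↔ v = p ∨ v = q k ∨ v = q (σ k) := by
    intro v
    have := c.ne23
    rw [mem_triple, hp]
    rcases h2 with h2 | h2 <;> rcases h3 with h3 | h3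
    · exact absurd (h2.trans h3.symm) c.ne23
    · rw [h2, h3]
    · rw [h2, h3]; tauto
    · exact absurd (h2.trans h3.symm) c.ne23
  obtain ⟨u, hu, huW⟩ := h.exists_mem_of_splits hT' hs
  have ht1 : t₁ = u := h.W_uniq k u hu huW t₁ (hp ▸ c.adj.symm) (Or.inl hk)
  exact ⟨k, Or.inr ⟨u, hu, huW, c.eq_triple (Or.inl ht1) (Or.inr h2) (Or.inr h3)⟩⟩

/-- A vertex u of T' in an interior is adjacent to p, while s₁ has no neighbor in E besides t₁; so u
is t₂ or t₃. It has a neighbor in E other than p and a neighbor in K₁, which is the input of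
`single_of_adj`. -/
theorem false_of_center_mem_aux (hW : ∀ v, v = s₁ ∨ v = t₂ ∨ v = t₃ → v ∈ W)
    (hns : ∀ i, ∀ u ∈ I i, u ∈ ({s₁, t₂, t₃} : Set V) →
      ¬ (q i ∈ ({s₁, t₂, t₃} : Set V) ∧ q (σ i) ∈ ({s₁, t₂, t₃} : Set V)))
    (hpT : p ∉ T) (hpE : p ∈ insert t₁ K₂) :
    ∀ i, ∀ u ∈ I i, u ∈ ({s₁, t₂, t₃} : Set V) → (∀ x ∈ I i, x = u) ∧
      ((q i ∈ insert t₁ K₂ ∧ q (σ i) ∉ insert t₁ K₂ ∧ q (σ i) ∉ ({s₁, t₂, t₃} : Set V)) ∨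
        (q (σ i) ∈ insert t₁ K₂ ∧ q i ∉ insert t₁ K₂ ∧ q i ∉ ({s₁, t₂, t₃} : Set V))) := by
  intro i u hu huT
  have huT' := mem_triple.1 huT
  have hpt : p ≠ t₁ := fun e => hpT (e ▸ c.t1_mem)
  have hus : u ≠ s₁ := by
    rintro rfl
    exact hpt (c.adj_uniq (Set.mem_insert_iff.1 hpE) (h.W_adj i u hu (hW u huT')).symm)
  obtain ⟨y, hy, huy, hyp⟩ : ∃ y, (y = t₁ ∨ y ∈ K₂) ∧ G.Adj u y ∧ y ≠ p := by
    rcases huT'.resolve_left hus with rfl | rfl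
    · exact c.exists_adj_t2 p
    · exact c.exists_adj_t3 p
  obtain ⟨z, hz, hzs, huz⟩ := c.exists_adj_K1 huT'
  have hzE : z ∉ insert t₁ K₂ := by
    rintro (rfl | hz')
    · exact c.t1_notMem.1 hz
    · exact c.disj z hz hz'
  have := h.single_of_adj (T := {s₁, t₂, t₃}) (fun v hv => hW v (mem_triple.1 hv)) hu huT
    c.closed_E (y := y) (z := z) (by simpa using hy) huy hyp hzE (c.closed_K1.1 z ⟨hz, hzs⟩) huz
    (fun e => hzE (e ▸ hpE))
  rcases this with h1 | ⟨h1, -, h2⟩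
  · exact absurd h1 (hns i u hu huT)
  · exact ⟨h1, h2⟩

/-- The petal q k lies on the far side of T', and I k = {u}. A third neighbor forces a vertex u' of
T' in the preceding part, whose interior is then {u'} and whose other petal is in E. So q k has no
neighbors but u and u'. -/
theorem false_of_center_mem_dir (hW : ∀ v, v = s₁ ∨ v = t₂ ∨ v = t₃ → v ∈ W)
    (hns : ∀ i, ∀ u ∈ I i, u ∈ ({s₁, t₂, t₃} : Set V) →
      ¬ (q i ∈ ({s₁, t₂, t₃} : Set V) ∧ q (σ i) ∈ ({s₁, t₂, t₃} : Set V)))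
    (hpT : p ∉ T) (hpE : p ∈ insert t₁ K₂) {k : ι} {u : V} (hu : u ∈ I k)
    (huT : u ∈ ({s₁, t₂, t₃} : Set V)) (hq' : q (σ k) ∈ insert t₁ K₂)
    (hq : q k ∉ insert t₁ K₂) (hqT : q k ∉ ({s₁, t₂, t₃} : Set V)) : False := by
  have haux := h.false_of_center_mem_aux c hW hns hpT hpE
  have hD := c.closed_E.compl
  have hpT' : p ∉ ({s₁, t₂, t₃} : Set V) := c.closed_E.1 p hpE
  have hpD : p ∉ (insert t₁ K₂ ∪ {s₁, t₂, t₃})ᶜ := fun h' => h' (Or.inl hpE)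
  have hqD : q k ∈ (insert t₁ K₂ ∪ {s₁, t₂, t₃})ᶜ := fun h' => h'.elim hq hqT
  have hnE : ∀ y, G.Adj (q k) y → y ∉ insert t₁ K₂ := fun y hy hyE =>
    (hD.2 _ hqD y hy).elim (fun h' => h' (Or.inl hyE)) (fun h' => c.closed_E.1 y hyE h')
  have hone := (haux k u hu huT).1
  obtain ⟨y, hy, hyu, hyj⟩ := h.tri.exists_adj_ne (q k) u (q (σ.symm k))
  have hyI : y ∈ I (σ.symm k) := by
    rcases h.adj_petal hy with rfl | rfl | h1 | h1 | h1
    · exact absurd hpE (hnE _ hy)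
    · exact absurd hq' (hnE _ hy)
    · contradiction
    · exact absurd (hone y h1) hyu
    · exact h1
  obtain ⟨u', hu', huT'⟩ := h.interior_of_petal_symm hD hpD hpT' hyI hqD
  have haux' := haux _ u' hu' huT'
  rw [Equiv.apply_symm_apply] at haux'
  have hj : q (σ.symm k) ∈ insert t₁ K₂ := by
    rcases haux'.2 with h1 | h1
    · exact h1.1
    · exact absurd h1.1 hq
  obtain ⟨w, hw, hwu, hwu'⟩ := h.tri.exists_adj_ne (q k) u u'
  rcases h.adj_petal hw with rfl | rfl | rfl | h1 | h1
  · exact hnE _ hw hpE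
  · exact hnE _ hw hq'
  · exact hnE _ hw hj
  · exact hwu (hone w h1)
  · exact hwu' (haux'.1 w h1)

theorem false_of_center_mem (hW : ∀ v, v = s₁ ∨ v = t₂ ∨ v = t₃ → v ∈ W)
    (hns : ∀ i, ∀ u ∈ I i, u ∈ ({s₁, t₂, t₃} : Set V) →
      ¬ (q i ∈ ({s₁, t₂, t₃} : Set V) ∧ q (σ i) ∈ ({s₁, t₂, t₃} : Set V)))
    (hpT : p ∉ T) (hpE : p ∈ insert t₁ K₂) : False := by
  have hpT' : p ∉ ({s₁, t₂, t₃} : Set V) := c.closed_E.1 p hpE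
  have hpK : p ∉ K₁ \ {s₁} := by
    rintro ⟨h1, -⟩
    rcases hpE with rfl | h2
    · exact c.t1_notMem.1 h1
    · exact c.disj p h1 h2
  obtain ⟨y, hy, hys⟩ := c.more
  obtain ⟨k, u, hu, huT⟩ := h.exists_interior_of_closed c.closed_K1 hpK hpT' (x := y) ⟨hy, hys⟩
  rcases (h.false_of_center_mem_aux c hW hns hpT hpE k u hu huT).2 with ⟨h1, h2, h3⟩ | ⟨h1, h2, h3⟩
  · refine h.rev.false_of_center_mem_dir c hW ?_ hpT hpE (k := σ k) (u := u) ?_ huT ?_ h2 h3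
    · intro i u hu huT h'
      have := hns _ u hu huT
      rw [Equiv.apply_symm_apply] at this
      exact this ⟨h'.2, h'.1⟩
    · rwa [Equiv.symm_apply_apply]
    · rwa [Equiv.symm_apply_apply]
  · exact h.false_of_center_mem_dir c hW hns hpT hpE hu huT h1 h2 h3

end FlowerShape

/-- The remaining vertex `p` of the component `K₁` has only neighbors in the cutset, if two of the
vertices of the cutset have no further neighbors in `K₁`. -/
theorem Config.eq_center {T K₁ K₂ : Set V} {t₁ t₂ t₃ s₁ : V} (c : Config G T K₁ K₂ t₁ t₂ t₃ s₁)
    {p r : V} (hpE : p ∉ insert t₁ K₂) (hpT : p ∉ ({s₁, t₂, t₃} : Set V))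
    (hr : r ∈ ({s₁, t₂, t₃} : Set V))
    (hcl : ∀ x ∈ ({s₁, t₂, t₃} : Set V), x ≠ r → ∀ y, G.Adj x y →
      y = p ∨ y ∈ ({s₁, t₂, t₃} : Set V) ∨ y ∈ insert t₁ K₂) :
    (∀ v, v = p ∨ v ∈ insert t₁ K₂ ∨ v ∈ ({s₁, t₂, t₃} : Set V)) ∧
      ∀ y ∈ ({s₁, t₂, t₃} : Set V), G.Adj p y := by
  have hD := c.closed_E.compl
  have hcov : ∀ v, v = p ∨ v ∈ insert t₁ K₂ ∨ v ∈ ({s₁, t₂, t₃} : Set V) := by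
    by_contra! hno
    obtain ⟨v, hv, hvE, hvT⟩ := hno
    have hpr : p ≠ r := fun e => hpT (e ▸ hr)
    refine c.tri.pair (D := (insert t₁ K₂ ∪ {s₁, t₂, t₃})ᶜ \ {p}) (a := p) (b := r) (z := t₁)
      (x := v) ?_ ⟨fun h' => h'.elim hvE hvT, hv⟩ (by simp) (fun h' => h'.1 (Or.inr hr))
      (fun h' => h'.1 (Or.inl (Set.mem_insert _ _))) ?_ ?_
    · intro x hx y hxy
      by_cases hyp : y = p
      · tauto
      rcases hD.2 x hx.1 y hxy with h1 | h1
      · exact Or.inl ⟨h1, hyp⟩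
      · by_cases hyr : y = r
        · tauto
        · rcases hcl y h1 hyr x hxy.symm with h2 | h2 | h2
          · exact absurd h2 hx.2
          · exact absurd (Or.inr h2) hx.1
          · exact absurd (Or.inl h2) hx.1
    · exact fun e => hpE (e ▸ Set.mem_insert _ _)
    · exact fun e => c.closed_E.1 t₁ (Set.mem_insert _ _) (e ▸ hr)
  refine ⟨hcov, fun y hy => ?_⟩
  have hDp : ∀ v ∈ (insert t₁ K₂ ∪ {s₁, t₂, t₃})ᶜ, v = p := fun v hv =>
    (hcov v).resolve_right fun h' => hv (h'.imp id id)
  obtain ⟨z, hz, hyz⟩ := c.tri.exists_adj_of_closed c.ncard_T' hD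
    ⟨p, fun h' => h'.elim hpE hpT⟩ hy
  exact hDp z hz ▸ hyz.symm

/-- A configuration whose cutset `{s₁, t₂, t₃}` lies in the neighborhood of a flower and whose
component `K₂ ∪ {t₁}` avoids the center of the flower. -/
structure OffCenter (G : SimpleGraph V) {ι : Type*} (σ : Equiv.Perm ι) (p : V) (q : ι → V)
    (I : ι → Set V) (W T K₁ K₂ : Set V) (t₁ t₂ t₃ s₁ : V) : Prop where
  shape : FlowerShape G σ p q I W
  conf : Config G T K₁ K₂ t₁ t₂ t₃ s₁
  sub : ∀ v, v = s₁ ∨ v = t₂ ∨ v = t₃ → v ∈ W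
  nospecial : ∀ i, ∀ u ∈ I i, u ∈ ({s₁, t₂, t₃} : Set V) →
    ¬ (q i ∈ ({s₁, t₂, t₃} : Set V) ∧ q (σ i) ∈ ({s₁, t₂, t₃} : Set V))
  notMem : p ∉ insert t₁ K₂
  notMem' : p ∉ ({s₁, t₂, t₃} : Set V)

/-! ### Flowers whose center lies in K₁ without s₁ -/

namespace OffCenter

variable {ι : Type*} {σ : Equiv.Perm ι} {p : V} {q : ι → V} {I : ι → Set V} {W T K₁ K₂ : Set V}
  {t₁ t₂ t₃ s₁ : V} (h : OffCenter G σ p q I W T K₁ K₂ t₁ t₂ t₃ s₁)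
include h

theorem rev : OffCenter G σ.symm p q (fun i => I (σ.symm i)) W T K₁ K₂ t₁ t₂ t₃ s₁ :=
  { h with
    shape := h.shape.rev
    nospecial := fun i u hu huT h' => by
      have := h.nospecial _ u hu huT
      rw [Equiv.apply_symm_apply] at this
      exact this ⟨h'.2, h'.1⟩ }

theorem swap : OffCenter G σ p q I W T K₁ K₂ t₁ t₃ t₂ s₁ where
  shape := h.shape
  conf := h.conf.swap
  sub := fun v hv => h.sub v (by tauto)
  nospecial := by
    rw [Set.pair_comm t₃ t₂]
    exact h.nospecial
  notMem := h.notMem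
  notMem' := by
    rw [Set.pair_comm t₃ t₂]
    exact h.notMem'

theorem not_adj {y : V} (hy : y ∈ insert t₁ K₂) : ¬ G.Adj p y := fun h' =>
  (h.conf.closed_E.2 y hy p h'.symm).elim h.notMem h.notMem'

theorem exists_two (x w : V) (hx : x = t₂ ∨ x = t₃) : ∃ y ∈ insert t₁ K₂, G.Adj x y ∧ y ≠ w := by
  rcases hx with rfl | rfl
  · obtain ⟨y, hy, h1⟩ := h.conf.exists_adj_t2 w
    exact ⟨y, hy, h1⟩
  · obtain ⟨y, hy, h1⟩ := h.conf.exists_adj_t3 w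
    exact ⟨y, hy, h1⟩

/-- A vertex of the cutset with a unique neighbor in the component is `s₁`. -/
theorem eq_s1 {x y : V} (hx : x ∈ ({s₁, t₂, t₃} : Set V))
    (hu : ∀ z ∈ insert t₁ K₂, G.Adj x z → z = y) : x = s₁ := by
  refine (mem_triple.1 hx).resolve_right fun h1 => ?_
  obtain ⟨z, hz, hxz, hne⟩ := h.exists_two x y h1
  exact hne (hu z hz hxz)

theorem interior_of_mem {l : ι} {x : V} (hx : x ∈ I l) (hxE : x ∈ insert t₁ K₂) :
    ∃ u ∈ I l, u ∈ ({s₁, t₂, t₃} : Set V) :=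
  h.shape.interior_of_closed h.conf.closed_E h.notMem h.notMem' hx hxE

/-- Otherwise t₁ lies in an interior, and `ends_mem` puts both petals of its part into T', which
`nospecial` forbids. -/
theorem exists_petal : ∃ l, q l ∈ insert t₁ K₂ := by
  by_contra! hno
  have hE := h.conf.closed_E
  have h0 : ∃ l, t₁ ∈ I l := by
    have : t₁ ∈ insert t₁ K₂ := Set.mem_insert _ _
    rcases h.shape.cover t₁ with h1 | ⟨l, h1⟩ | h1
    · exact absurd (h1 ▸ this) h.notMem
    · exact absurd (h1 ▸ this) (hno l)
    · exact h1
  obtain ⟨l, hl⟩ := h0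
  obtain ⟨u, hu, huT⟩ := h.interior_of_mem hl (Set.mem_insert _ _)
  have := h.shape.ends_mem (fun v hv => h.sub v (mem_triple.1 hv)) hu huT hE hl
    (Set.mem_insert _ _)
  exact h.nospecial l u hu huT ⟨this.1.resolve_left (hno _), this.2.resolve_left (hno _)⟩

/-- A far neighbor z other than p would allow `single_of_adj`, after which only one petal remains as
a neighbor of w in E; but w has two neighbors there. -/
theorem adj_interior {w : V} (hw : w = t₂ ∨ w = t₃) {l : ι} (hl : w ∈ I l) {z : V}
    (hz : G.Adj w z) : z = p ∨ z ∈ ({s₁, t₂, t₃} : Set V) ∨ z ∈ insert t₁ K₂ := by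
  by_contra! hno
  have hwT : w ∈ ({s₁, t₂, t₃} : Set V) := mem_triple.2 (Or.inr hw)
  obtain ⟨y, hy, hwy, -⟩ := h.exists_two w w hw
  obtain ⟨y', hy', hwy', hne⟩ := h.exists_two w y hw
  have hyp : ∀ y ∈ insert t₁ K₂, y ≠ p := fun y hy e => h.notMem (e ▸ hy)
  rcases h.shape.single_of_adj (fun v hv => h.sub v (mem_triple.1 hv)) hl hwT h.conf.closed_E
    hy hwy (hyp y hy) hno.2.2 hno.2.1 hz hno.1 with h1 | ⟨-, hN, hside⟩
  · exact h.nospecial l w hl hwT h1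
  · have h1 := (hN y hwy).resolve_left (hyp y hy)
    have h2 := (hN y' hwy').resolve_left (hyp y' hy')
    rcases h1 with rfl | rfl <;> rcases h2 with rfl | rfl
    · exact hne rfl
    · tauto
    · tauto
    · exact hne rfl

/-- E contains a petal at an end of the only part it may enter, and by `end_petal` the next petal
outwards must be s₁; but s₁ lies in an interior. -/
theorem false_of_petals {k : ι} (h2 : ∀ l, t₂ ∉ I l) (h3 : ∀ l, t₃ ∉ I l) (hk : s₁ ∈ I k) :
    False := by
  have hTI : ∀ l, ∀ x ∈ I l, x ∈ ({s₁, t₂, t₃} : Set V) → l = k := by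
    intro l x hx hxT
    rcases mem_triple.1 hxT with rfl | rfl | rfl
    · exact h.shape.idx _ _ _ hx hk
    · exact absurd hx (h2 l)
    · exact absurd hx (h3 l)
  have hEI : ∀ l, l ≠ k → ∀ x ∈ I l, x ∉ insert t₁ K₂ ∧ x ∉ ({s₁, t₂, t₃} : Set V) := by
    refine fun l hl x hx => ⟨fun hxE => ?_, fun hxT => hl (hTI l x hx hxT)⟩
    obtain ⟨u, hu, huT⟩ := h.interior_of_mem hx hxE
    exact hl (hTI l u hu huT)
  have hnp : ∀ l, q l ∈ insert t₁ K₂ → ¬ G.Adj p (q l) := fun l hl => h.not_adj hl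
  have hqs : ∀ l, q l ≠ s₁ := fun l e => h.shape.q_notMem k l (e ▸ hk)
  obtain ⟨l, hl⟩ := h.exists_petal
  rcases h.shape.petals_of_closed h.conf.closed_E hEI hnp hl with rfl | rfl
  · have := h.shape.end_petal h.conf.closed_E h.notMem hEI hnp hl
    exact hqs _ (h.eq_s1 this.1 this.2)
  · have := h.shape.rev.end_petal (k := σ k) h.conf.closed_E h.notMem (fun l hl => hEI _ fun e =>
      hl (by rw [← e, Equiv.apply_symm_apply])) hnp hl
    exact hqs _ (h.eq_s1 this.1 this.2)

/-- The petal before q k is s₁ and q k is its only neighbor in E, so t₁ = q k. Then q (σ k) is not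
in E, since s₁ cannot also be the petal after it, and a second neighbor of t₃ in E lies in I k,
which leaves only q (σ k) for t₃. -/
theorem eq_of_petals_dir {k : ι} (h1 : ∀ l, s₁ ∉ I l) (h2 : t₂ ∈ I k) (h3 : ∀ l, t₃ ∉ I l)
    (hk : q k ∈ insert t₁ K₂) : T = {t₂, q k, q (σ k)} := by
  have hTI : ∀ l, ∀ x ∈ I l, x ∈ ({s₁, t₂, t₃} : Set V) → l = k := by
    intro l x hx hxT
    rcases mem_triple.1 hxT with rfl | rfl | rfl
    · exact absurd hx (h1 l)
    · exact h.shape.idx _ _ _ hx h2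
    · exact absurd hx (h3 l)
  have hEI : ∀ l, l ≠ k → ∀ x ∈ I l, x ∉ insert t₁ K₂ ∧ x ∉ ({s₁, t₂, t₃} : Set V) := by
    refine fun l hl x hx => ⟨fun hxE => ?_, fun hxT => hl (hTI l x hx hxT)⟩
    obtain ⟨u, hu, huT⟩ := h.interior_of_mem hx hxE
    exact hl (hTI l u hu huT)
  have hnp : ∀ l, q l ∈ insert t₁ K₂ → ¬ G.Adj p (q l) := fun l hl => h.not_adj hl
  have hend := h.shape.end_petal h.conf.closed_E h.notMem hEI hnp hk
  have hs := h.eq_s1 hend.1 hend.2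
  have ht1 : t₁ = q k := hend.2 t₁ (Set.mem_insert _ _) (hs ▸ h.conf.adj.symm)
  have hk' : q (σ k) ∉ insert t₁ K₂ := fun hk' => by
    have hend' := h.shape.rev.end_petal (k := σ k) h.conf.closed_E h.notMem (fun l hl => hEI _
      fun e => hl (by rw [← e, Equiv.apply_symm_apply])) hnp hk'
    have := h.shape.q_inj (hs.trans (h.eq_s1 hend'.1 hend'.2).symm)
    refine h.shape.ne3 (σ.symm k) ?_
    rw [Equiv.apply_symm_apply]
    exact this.symm
  obtain ⟨y, hy, h3y, hyk⟩ := h.exists_two t₃ (q k) (Or.inr rfl)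
  have hyk' : y ∈ I k := by
    rcases h.shape.cover y with rfl | ⟨l, rfl⟩ | ⟨l, hl⟩
    · exact absurd hy h.notMem
    · rcases h.shape.petals_of_closed h.conf.closed_E hEI hnp hy with rfl | rfl
      · contradiction
      · contradiction
    · by_cases hlk : l = k
      · rwa [← hlk]
      · exact absurd hy (hEI l hlk y hl).1
  refine h.conf.eq_triple (Or.inr (Or.inl ht1)) (Or.inl rfl) ?_
  rcases h.shape.I_adj k y hyk' t₃ h3y.symm with h4 | h4 | h4 | h4
  · exact absurd h4 (h3 k)
  · exact absurd (by rw [h4]; simp) h.notMem'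
  · exact absurd (h4.trans ht1.symm) h.conf.ne13.symm
  · exact Or.inr (Or.inr h4)

theorem shape_of_petals {k : ι} (h1 : ∀ l, s₁ ∉ I l) (h2 : t₂ ∈ I k) (h3 : ∀ l, t₃ ∉ I l) :
    FlowerBoundaryShape σ p q I W T := by
  have hTI : ∀ l, ∀ x ∈ I l, x ∈ ({s₁, t₂, t₃} : Set V) → l = k := by
    intro l x hx hxT
    rcases mem_triple.1 hxT with rfl | rfl | rfl
    · exact absurd hx (h1 l)
    · exact h.shape.idx _ _ _ hx h2
    · exact absurd hx (h3 l)
  have hEI : ∀ l, l ≠ k → ∀ x ∈ I l, x ∉ insert t₁ K₂ ∧ x ∉ ({s₁, t₂, t₃} : Set V) := by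
    refine fun l hl x hx => ⟨fun hxE => ?_, fun hxT => hl (hTI l x hx hxT)⟩
    obtain ⟨u, hu, huT⟩ := h.interior_of_mem hx hxE
    exact hl (hTI l u hu huT)
  obtain ⟨l, hl⟩ := h.exists_petal
  have h2W := h.sub t₂ (by simp)
  refine ⟨k, Or.inr ⟨t₂, h2, h2W, ?_⟩⟩
  rcases h.shape.petals_of_closed h.conf.closed_E hEI (fun l hl => h.not_adj hl) hl with rfl | rfl
  · exact h.eq_of_petals_dir h1 h2 h3 hl
  · have := h.rev.eq_of_petals_dir (k := σ k) (fun l => h1 _)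
      (by rwa [Equiv.symm_apply_apply]) (fun l => h3 _) hl
    rw [this, Equiv.symm_apply_apply, Set.pair_comm]

/-- Neither t₂ nor t₃ has far neighbors besides p, so p is the whole far side and is adjacent to all
of T'. If s₁ were adjacent to t₂ or t₃, it would be a second neighbor of p in that part; hence s₁
has only the neighbors p and t₁. -/
theorem false_of_interiors {k l : ι} (h2 : t₂ ∈ I k) (h3 : t₃ ∈ I l) : False := by
  obtain ⟨hcov, hadj⟩ := h.conf.eq_center h.notMem h.notMem' (r := s₁) (by simp) (by
    intro x hx hxs y hxy
    rcases (mem_triple.1 hx).resolve_left hxs with rfl | rfl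
    · exact h.adj_interior (Or.inl rfl) h2 hxy
    · exact h.adj_interior (Or.inr rfl) h3 hxy)
  have hsp : s₁ ≠ p := fun e => h.notMem' (by simp [← e])
  have key : ∀ t, t = t₂ ∨ t = t₃ → (∃ j, t ∈ I j) → ¬ G.Adj s₁ t := by
    rintro t ht ⟨j, hj⟩ hst
    have := h.shape.W_uniq j t hj (h.sub t (by tauto)) s₁ (hadj _ (by simp))
      (by have := h.shape.I_adj j t hj s₁ hst.symm; tauto)
    have hs1 := h.conf.s1_ne
    rcases ht with rfl | rfl
    · exact hs1.2.1 this
    · exact hs1.2.2 this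
  obtain ⟨y, hy, hyp, hyt⟩ := h.shape.tri.exists_adj_ne s₁ p t₁
  rcases hcov y with h4 | h4 | h4
  · contradiction
  · exact hyt (h.conf.adj_uniq h4 hy)
  · rcases mem_triple.1 h4 with rfl | rfl | rfl
    · exact G.loopless.irrefl _ hy
    · exact key y (Or.inl rfl) ⟨k, h2⟩ hy
    · exact key y (Or.inr rfl) ⟨l, h3⟩ hy

/-- Otherwise `eq_center` with r = t₃ makes p the whole far side. Then s₁ is adjacent neither to t₂,
which lies in another interior, nor to t₃, which would be a second neighbor of p in the part of s₁,
and its degree is at most two. -/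
theorem exists_adj_outside {k l b : ι} (h2 : t₂ ∈ I k) (h3 : t₃ = q b) (h1 : s₁ ∈ I l) :
    ∃ z, G.Adj s₁ z ∧ z ≠ p ∧ z ∉ ({s₁, t₂, t₃} : Set V) ∧ z ∉ insert t₁ K₂ := by
  by_contra! hno
  have hs := h.conf.s1_ne
  obtain ⟨hcov, hadj⟩ := h.conf.eq_center h.notMem h.notMem' (r := t₃) (by simp) (by
    intro x hx hxs y hxy
    rcases mem_triple.1 hx with rfl | rfl | rfl
    · have := hno y hxy
      tauto
    · exact h.adj_interior (Or.inl rfl) h2 hxy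
    · contradiction)
  have hsW := h.sub s₁ (by simp)
  have hkl : k ≠ l := fun e => hs.2.1 (h.shape.W_eq h1 hsW (e ▸ h2) (h.sub t₂ (by simp)))
  obtain ⟨y, hy, hyp, hyt⟩ := h.shape.tri.exists_adj_ne s₁ p t₁
  rcases hcov y with h4 | h4 | h4
  · contradiction
  · exact hyt (h.conf.adj_uniq h4 hy)
  · have hI := h.shape.I_adj l s₁ h1 y hy
    rcases mem_triple.1 h4 with rfl | rfl | rfl
    · exact G.loopless.irrefl _ hy
    · rcases hI with h5 | h5 | h5 | h5
      · exact hkl (h.shape.idx _ _ _ h2 h5)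
      · exact hyp h5
      · exact h.shape.q_notMem k _ (h5 ▸ h2)
      · exact h.shape.q_notMem k _ (h5 ▸ h2)
    · exact hs.2.2 (h.shape.W_uniq l s₁ h1 hsW y (hadj _ (by simp)) (by tauto)).symm

theorem shape_of_mixed_dir {k l b : ι} (h2 : t₂ ∈ I k) (h3 : t₃ = q b) (h1 : s₁ ∈ I l)
    (hI : ∀ x ∈ I l, x = s₁) (hN : ∀ w, G.Adj s₁ w → w = p ∨ w = q l ∨ w = q (σ l))
    (hl : q l ∈ insert t₁ K₂) (hl' : q (σ l) ∉ insert t₁ K₂)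
    (hl'' : q (σ l) ∉ ({s₁, t₂, t₃} : Set V)) : FlowerBoundaryShape σ p q I W T := by
  have hE := h.conf.closed_E
  have h2W := h.sub t₂ (by simp)
  have hs := h.conf.s1_ne
  have h3I : ∀ i, t₃ ∉ I i := fun i h' => h.shape.q_notMem i b (h3 ▸ h')
  have hkl : k ≠ l := fun e => hs.2.1 (hI _ (e ▸ h2)).symm
  have hTI : ∀ i, ∀ x ∈ I i, x ∈ ({s₁, t₂, t₃} : Set V) → i = l ∨ i = k := by
    intro i x hx hxT
    rcases mem_triple.1 hxT with rfl | rfl | rfl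
    · exact Or.inl (h.shape.idx _ _ _ hx h1)
    · exact Or.inr (h.shape.idx _ _ _ hx h2)
    · exact absurd hx (h3I i)
  have ht1 : t₁ = q l := by
    rcases hN t₁ h.conf.adj.symm with h4 | h4 | h4
    · exact absurd (h4 ▸ Set.mem_insert _ _) h.notMem
    · exact h4
    · exact absurd (h4 ▸ Set.mem_insert _ _) hl'
  -- the part before `q l` contains `t₂`
  obtain ⟨y, hy, hyj, hys⟩ := h.shape.tri.exists_adj_ne (q l) (q (σ.symm l)) s₁
  have hyI : y ∈ I (σ.symm l) := by
    rcases h.shape.adj_petal hy with rfl | rfl | h4 | h4 | h4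
    · exact absurd hy.symm (h.not_adj hl)
    · exact absurd (hE.2 _ hl _ hy) (not_or.2 ⟨hl', hl''⟩)
    · contradiction
    · exact absurd (hI y h4) hys
    · exact h4
  have hk : k = σ.symm l := by
    obtain ⟨u, hu, huT⟩ := h.shape.interior_of_petal_symm hE h.notMem h.notMem' hyI hl
    exact ((hTI _ u hu huT).resolve_left (h.shape.rev.ne1 l)).symm
  have hσk : σ k = l := by rw [hk, Equiv.apply_symm_apply]
  refine ⟨k, Or.inr ⟨t₂, h2, h2W, ?_⟩⟩
  refine h.conf.eq_triple (Or.inr (Or.inr (by rw [hσk]; exact ht1))) (Or.inl rfl)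
    (Or.inr (Or.inl ?_))
  by_cases hkT : q k ∈ ({s₁, t₂, t₃} : Set V)
  · rcases mem_triple.1 hkT with h4 | h4 | h4
    · exact absurd (h4 ▸ h1) (h.shape.q_notMem l k)
    · exact absurd (h4 ▸ h2) (h.shape.q_notMem k k)
    · exact h4.symm
  -- Otherwise q k is in E as well, the part before it is empty, and the preceding petal is t₃,
  -- whose only neighbor in E would be q k.
  exfalso
  have hkE : q k ∈ insert t₁ K₂ := by
    obtain ⟨y, hy, h2y, hyl⟩ := h.exists_two t₂ (q l) (Or.inl rfl)
    rcases h.shape.I_adj k t₂ h2 y h2y with h4 | rfl | rfl | rfl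
    · have := (h.shape.ends_mem (fun v hv => h.sub v (mem_triple.1 hv)) h2 (by simp) hE h4 hy).1
      exact this.resolve_right hkT
    · exact absurd hy h.notMem
    · exact hy
    · rw [hσk] at hyl
      contradiction
  -- the only petals in the component are `q k` and `q l`
  have hpet : ∀ i, q i ∈ insert t₁ K₂ → i = k ∨ i = l := by
    intro i hi
    have hor : (i = l ∨ i = k) ∨ σ.symm i = l ∨ σ.symm i = k := by
      rcases h.shape.petal_interior (h.not_adj hi) with ⟨z, hz, -⟩ | ⟨z, hz, -⟩
      · obtain ⟨u, hu, huT⟩ := h.shape.interior_of_petal hE h.notMem h.notMem' hz hi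
        exact Or.inl (hTI _ u hu huT)
      · obtain ⟨u, hu, huT⟩ := h.shape.interior_of_petal_symm hE h.notMem h.notMem' hz hi
        exact Or.inr (hTI _ u hu huT)
    rcases hor with (h4 | h4) | h4 | h4
    · exact Or.inr h4
    · exact Or.inl h4
    · rw [Equiv.symm_apply_eq] at h4
      exact absurd (h4 ▸ hi) hl'
    · rw [Equiv.symm_apply_eq] at h4
      exact Or.inr (h4.trans hσk)
  have hm1 : σ.symm k ≠ k := h.shape.rev.ne1 k
  have hm2 : σ.symm k ≠ l := fun e => h.shape.ne2 k (by
    rw [Equiv.symm_apply_eq, ← hσk] at e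
    exact e.symm)
  have hn2 : σ.symm (σ.symm k) ≠ k := h.shape.rev.ne2 k
  have hn3 : σ.symm (σ.symm k) ≠ l := fun e => h.shape.ne3 k (by
    rw [Equiv.symm_apply_eq, Equiv.symm_apply_eq, ← hσk] at e
    exact e.symm)
  have hImm : ∀ x, x ∉ I (σ.symm k) := by
    intro x hx
    obtain ⟨u, hu, huT⟩ := h.shape.interior_of_petal_symm hE h.notMem h.notMem' hx hkE
    exact (hTI _ u hu huT).elim hm2 hm1
  have hm : q (σ.symm k) ∈ ({s₁, t₂, t₃} : Set V) :=
    (hE.2 _ hkE _ (h.shape.link_symm hImm)).resolve_left fun h' => (hpet _ h').elim hm1 hm2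
  have hm3 : q (σ.symm k) = t₃ := by
    rcases mem_triple.1 hm with h4 | h4 | h4
    · exact absurd (h4 ▸ h1) (h.shape.q_notMem l _)
    · exact absurd (h4 ▸ h2) (h.shape.q_notMem k _)
    · exact h4
  obtain ⟨z, hz, h3z, hzk⟩ := h.exists_two t₃ (q k) (Or.inr rfl)
  rw [← hm3] at h3z
  rcases h.shape.adj_petal h3z with rfl | rfl | rfl | h4 | h4
  · exact h.notMem hz
  · rw [Equiv.apply_symm_apply] at hzk
    exact hzk rfl
  · exact (hpet _ hz).elim hn2 hn3
  · exact hImm z h4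
  · obtain ⟨u, hu, huT⟩ := h.interior_of_mem h4 hz
    exact (hTI _ u hu huT).elim hn3 hn2

theorem shape_of_mixed {k l b : ι} (h2 : t₂ ∈ I k) (h3 : t₃ = q b) (h1 : s₁ ∈ I l) :
    FlowerBoundaryShape σ p q I W T := by
  obtain ⟨z, hz, hzp, hzT, hzE⟩ := h.exists_adj_outside h2 h3 h1
  rcases h.shape.single_of_adj (fun v hv => h.sub v (mem_triple.1 hv)) h1 (by simp)
    h.conf.closed_E (y := t₁) (Set.mem_insert _ _) h.conf.adj.symm
    (fun e => h.notMem (e ▸ Set.mem_insert _ _)) hzE hzT hz hzp with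
    h4 | ⟨hI, hN, ⟨e1, e2, e3⟩ | ⟨e1, e2, e3⟩⟩
  · exact absurd h4 (h.nospecial l s₁ h1 (by simp))
  · exact h.shape_of_mixed_dir h2 h3 h1 hI hN e1 e2 e3
  · refine FlowerBoundaryShape.of_rev (h.rev.shape_of_mixed_dir (k := σ k) (l := σ l) ?_ h3 ?_ ?_
      ?_ e1 ?_ ?_)
    · rwa [Equiv.symm_apply_apply]
    · rwa [Equiv.symm_apply_apply]
    · rwa [Equiv.symm_apply_apply]
    · rw [Equiv.symm_apply_apply]
      intro w hw
      have := hN w hw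
      tauto
    · rwa [Equiv.symm_apply_apply]
    · rwa [Equiv.symm_apply_apply]

theorem boundaryShape : FlowerBoundaryShape σ p q I W T := by
  have hcase : ∀ x, x ∈ ({s₁, t₂, t₃} : Set V) → (∃ i, x = q i) ∨ ∃ i, x ∈ I i := fun x hx =>
    (h.shape.cover x).resolve_left fun e => h.notMem' (e ▸ hx)
  have hpet : ∀ x, (∃ i, x = q i) → ∀ l, x ∉ I l := by
    rintro _ ⟨i, rfl⟩ l
    exact h.shape.q_notMem l i
  rcases hcase t₂ (by simp) with h2 | ⟨k, h2⟩ <;> rcases hcase t₃ (by simp) with h3 | ⟨l, h3⟩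
  · obtain ⟨k, u, hu, huT⟩ := h.shape.exists_interior_of_closed h.conf.closed_E h.notMem h.notMem'
      (Set.mem_insert _ _)
    rcases mem_triple.1 huT with rfl | rfl | rfl
    · exact (h.false_of_petals (hpet _ h2) (hpet _ h3) hu).elim
    · exact absurd hu (hpet _ h2 k)
    · exact absurd hu (hpet _ h3 k)
  · rcases hcase s₁ (by simp) with h1 | ⟨m, h1⟩
    · exact h.swap.shape_of_petals (hpet _ h1) h3 (hpet _ h2)
    · obtain ⟨b, hb⟩ := h2
      exact h.swap.shape_of_mixed h3 hb h1
  · rcases hcase s₁ (by simp) with h1 | ⟨m, h1⟩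
    · exact h.shape_of_petals (hpet _ h1) h2 (hpet _ h3)
    · obtain ⟨b, hb⟩ := h3
      exact h.shape_of_mixed h2 hb h1
  · exact (h.false_of_interiors h2 h3).elim

end OffCenter

/-- The five positions of the center: in T (where `hpart` keeps T within one part), equal to s₁, in
E (impossible), or in the rest of K₁, the last being `OffCenter`; t₁, t₂ and t₃ are treated
separately within T up to symmetry. -/
theorem FlowerShape.boundaryShape {ι : Type*} {σ : Equiv.Perm ι} {p : V} {q : ι → V} {I : ι → Set V}
    {W : Set V} (h : FlowerShape G σ p q I W) {T K₁ K₂ : Set V} {t₁ t₂ t₃ s₁ : V}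
    (c : Config G T K₁ K₂ t₁ t₂ t₃ s₁) (hW : ∀ v, v = s₁ ∨ v = t₂ ∨ v = t₃ → v ∈ W)
    (hs : Splits G {s₁, t₂, t₃} W)
    (hpart : p ∈ T → ∃ i, ∀ v ∈ T, v ∈ I i ∨ v = p ∨ v = q i ∨ v = q (σ i)) :
    FlowerBoundaryShape σ p q I W T := by
  by_cases hpT : p ∈ T
  · obtain ⟨i, hi⟩ := hpart hpT
    rcases c.mem_T.1 hpT with h1 | h1 | h1
    · exact h.shape_of_center_eq_t1 c hi h1 hW
    · exact h.shape_of_center_eq_t2 c hi h1 hW hs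
    · refine h.shape_of_center_eq_t2 c.swap hi h1 (fun v hv => hW v (by tauto)) ?_
      rwa [Set.pair_comm]
  by_cases hps : p = s₁
  · exact h.shape_of_center_eq_s1 c hps hW hs
  have hpT' : p ∉ ({s₁, t₂, t₃} : Set V) := by
    rw [mem_triple]
    rw [c.mem_T] at hpT
    tauto
  -- With both petals, T' would equal {u, q i, q (σ i)}, which does not split the neighborhood.
  have hns : ∀ i, ∀ u ∈ I i, u ∈ ({s₁, t₂, t₃} : Set V) →
      ¬ (q i ∈ ({s₁, t₂, t₃} : Set V) ∧ q (σ i) ∈ ({s₁, t₂, t₃} : Set V)) := by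
    rintro i u hu huT ⟨h1, h2⟩
    refine h.not_splits_of_subset hu (hW u (mem_triple.1 huT)) huT h1 h2 hpT' ?_ hs
    have n1 : u ≠ q i := fun e => h.q_notMem i i (e ▸ hu)
    have n2 : u ≠ q (σ i) := fun e => h.q_notMem i _ (e ▸ hu)
    have hsub : ({u, q i, q (σ i)} : Set V) ⊆ {s₁, t₂, t₃} := by
      intro v hv
      rcases mem_triple.1 hv with rfl | rfl | rfl <;> assumption
    have heq := Set.eq_of_subset_of_ncard_le hsub (by
      rw [c.ncard_T', ncard_triple n1 n2 (h.q_ne_succ i)]) (Set.toFinite _)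
    intro v hv
    rwa [← heq, mem_triple] at hv
  by_cases hpE : p ∈ insert t₁ K₂
  · exact (h.false_of_center_mem c hW hns hpT hpE).elim
  · exact OffCenter.boundaryShape ⟨h, c, hW, hns, hpE, hpT'⟩


/-! ### Realizing the possible shapes as boundaries of the flower complex -/

namespace FlowerShape

variable {ι : Type*} {σ : Equiv.Perm ι} {p : V} {q : ι → V} {I : ι → Set V} {W : Set V}

/-- If the part behind `q (σ i)` is empty, then `u` can be separated from the center. -/
theorem exists_separator_dir (h : FlowerShape G σ p q I W) {i : ι} {u : V} (hu : u ∈ I i)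
    (huW : u ∈ W) (hI : I (σ i) = ∅) :
    ∃ R ∈ threeCutsets G, R ⊆ W ∧ u ∈ R ∧ ∃ D, Closed G R D ∧ p ∉ D ∧ p ∉ R ∧
      (∃ x ∈ W, x ∈ D) ∧ ∀ x ∈ I i, x ≠ u → x ∈ D := by
  have n1 : q i ≠ u := fun e => h.q_notMem i i (e ▸ hu)
  have n2 : u ≠ q (σ (σ i)) := fun e => h.q_notMem i _ (e ▸ hu)
  have n3 : q i ≠ q (σ (σ i)) := h.q_inj.ne (h.ne2 i).symm
  have n4 : p ≠ u := fun e => h.p_notMem i (e ▸ hu)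
  have n5 : q (σ i) ≠ u := fun e => h.q_notMem i _ (e ▸ hu)
  have hpD : p ∉ insert (q (σ i)) (I i \ {u}) := by
    rintro (h1 | h1)
    · exact h.q_ne _ h1.symm
    · exact h.p_notMem i h1.1
  have hpR : p ∉ ({q i, u, q (σ (σ i))} : Set V) := by
    rw [mem_triple]
    have := h.q_ne i
    have := h.q_ne (σ (σ i))
    grind
  have hD : Closed G {q i, u, q (σ (σ i))} (insert (q (σ i)) (I i \ {u})) := by
    refine closed_triple ?_ ?_ ?_ ?_
    · rintro (h1 | h1)
      · exact h.q_ne_succ i h1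
      · exact h.q_notMem _ _ h1.1
    · rintro (h1 | h1)
      · exact n5 h1.symm
      · exact h1.2 rfl
    · rintro (h1 | h1)
      · exact h.ne1 _ (h.q_inj h1)
      · exact h.q_notMem _ _ h1.1
    · rintro x hx y hxy
      by_cases hyu : y = u
      · tauto
      rcases hx with rfl | ⟨hx, hxu⟩
      · rcases h.adj_petal hxy with rfl | h1 | h1 | h1 | h1
        · exact absurd (h.W_uniq i u hu huW _ hxy.symm (Or.inr (Or.inr rfl))) n5
        · tauto
        · rw [Equiv.symm_apply_apply] at h1
          tauto
        · rw [hI] at h1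
          exact h1.elim
        · rw [Equiv.symm_apply_apply] at h1
          exact Or.inl (Or.inr ⟨h1, hyu⟩)
      · rcases h.I_adj i x hx y hxy with h1 | rfl | h1 | h1
        · exact Or.inl (Or.inr ⟨h1, hyu⟩)
        · exact absurd (h.W_uniq i u hu huW x hxy.symm (Or.inl hx)) hxu
        · tauto
        · exact Or.inl (Or.inl h1)
  refine ⟨{q i, u, q (σ (σ i))}, triple_mem_threeCutsets n1 n3 n2 hD (Set.mem_insert _ _) hpD hpR,
    ?_, by simp, _, hD, hpD, hpR, ⟨q (σ i), h.W_q _, Set.mem_insert _ _⟩,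
    fun x hx hxu => Or.inr ⟨hx, hxu⟩⟩
  intro x hx
  rcases mem_triple.1 hx with rfl | rfl | rfl
  · exact h.W_q _
  · exact huW
  · exact h.W_q _

/-- If a neighboring part is empty, the triple passes through u and the petal beyond that part.
Otherwise p is cubic and its three neighbors, in consecutive parts, isolate it. Either triple
separates p from the rest of I i. -/
theorem exists_separator (h : FlowerShape G σ p q I W) {i : ι} {u : V} (hu : u ∈ I i)
    (huW : u ∈ W) :
    ∃ R ∈ threeCutsets G, R ⊆ W ∧ Splits G R W ∧ u ∈ R ∧
      ∀ X ⊆ I i, X.Nonempty → (∀ x ∈ X, x ∉ R) → ∀ A, X ⊆ A → p ∈ A → Splits G R A := by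
  have key : (∃ R ∈ threeCutsets G, R ⊆ W ∧ u ∈ R ∧ ∃ D, Closed G R D ∧ p ∉ D ∧ p ∉ R ∧
      (∃ x ∈ W, x ∈ D) ∧ ∀ x ∈ I i, x ≠ u → x ∈ D) →
      ∃ R ∈ threeCutsets G, R ⊆ W ∧ Splits G R W ∧ u ∈ R ∧
      ∀ X ⊆ I i, X.Nonempty → (∀ x ∈ X, x ∉ R) → ∀ A, X ⊆ A → p ∈ A → Splits G R A := by
    rintro ⟨R, hR, hRW, huR, D, hD, hpD, hpR, hWD, hID⟩
    refine ⟨R, hR, hRW, splits_iff.2 ⟨D, hD, hWD, p, h.W_p, hpD, hpR⟩, huR, ?_⟩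
    rintro X hX ⟨x, hx⟩ hXR A hXA hpA
    exact splits_iff.2 ⟨D, hD, ⟨x, hXA hx, hID x (hX hx) fun e => hXR x hx (e ▸ huR)⟩, p, hpA,
      hpD, hpR⟩
  by_cases h1 : I (σ i) = ∅
  · exact key (h.exists_separator_dir hu huW h1)
  by_cases h2 : I (σ.symm i) = ∅
  · have := h.rev.exists_separator_dir (i := σ i) (u := u) (by rwa [Equiv.symm_apply_apply]) huW
      (by rwa [Equiv.symm_apply_apply])
    simp only [Equiv.symm_apply_apply] at this
    exact key this
  have hc : IsCubicVertex G p := (h.W_cond i u hu huW).resolve_right fun h' => h1 h'.2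
  obtain ⟨⟨a, ha, hpa⟩, -⟩ := h.exists_adj_interior (Set.nonempty_iff_ne_empty.2 h1)
  obtain ⟨⟨b, hb, hpb⟩, -⟩ := h.exists_adj_interior (Set.nonempty_iff_ne_empty.2 h2)
  have hpu := h.W_adj i u hu huW
  have i1 : σ i ≠ i := h.ne1 i
  have i2 : σ.symm i ≠ i := h.rev.ne1 i
  have i3 : σ i ≠ σ.symm i := fun e => h.ne2 i (by rw [e, Equiv.apply_symm_apply])
  have nau : a ≠ u := fun e => i1 (h.idx _ _ u (e ▸ ha) hu)
  have nbu : b ≠ u := fun e => i2 (h.idx _ _ u (e ▸ hb) hu)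
  have nab : a ≠ b := fun e => i3 (h.idx _ _ b (e ▸ ha) hb)
  have hN : {u, a, b} = G.neighborSet p := by
    refine Set.eq_of_subset_of_ncard_le ?_ ?_ (Set.finite_of_ncard_ne_zero (by
      rw [show (G.neighborSet p).ncard = 3 from hc]; omega))
    · intro x hx
      rcases mem_triple.1 hx with rfl | rfl | rfl <;> assumption
    · rw [ncard_triple nau.symm nbu.symm nab, show (G.neighborSet p).ncard = 3 from hc]
  have hmem : ∀ y, G.Adj p y → y = u ∨ y = a ∨ y = b := fun y hy => by
    rw [← mem_triple, hN]
    exact hy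
  have hq : ∀ j, q j ∉ ({u, a, b} : Set V) := by
    intro j hj
    rcases mem_triple.1 hj with e | e | e
    · exact h.q_notMem _ _ (e ▸ hu)
    · exact h.q_notMem _ _ (e ▸ ha)
    · exact h.q_notMem _ _ (e ▸ hb)
  have hW : ∀ k v, v ∈ I k → G.Adj p v → (∀ y, y ∈ I k → (y = u ∨ y = a ∨ y = b) → y = v) →
      v ∈ W := by
    intro k v hv hpv huv
    refine h.W_mem k v hv hc hpv fun y hpy hy => ?_
    have hy' := hmem y hpy
    rcases hy with h3 | rfl | rfl
    · exact huv y h3 hy'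
    · exact absurd (mem_triple.2 hy') (hq _)
    · exact absurd (mem_triple.2 hy') (hq _)
  have hpR : p ∉ ({u, a, b} : Set V) := by
    rw [hN]
    exact G.loopless.irrefl p
  have hD : Closed G {u, a, b} {p} := by
    refine ⟨fun x hx => by rw [Set.mem_singleton_iff.1 hx]; exact hpR, fun x hx y hxy => ?_⟩
    rw [Set.mem_singleton_iff.1 hx] at hxy
    exact Or.inr (mem_triple.2 (hmem y hxy))
  refine ⟨{u, a, b}, triple_mem_threeCutsets nau.symm nbu.symm nab hD rfl (z := q i)
    (h.q_ne i) (hq i), ?_, splits_iff.2 ⟨_, hD, ⟨p, h.W_p, rfl⟩, q i, h.W_q i, h.q_ne i, hq i⟩,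
    by simp, ?_⟩
  · intro x hx
    rcases mem_triple.1 hx with rfl | rfl | rfl
    · exact huW
    · refine hW _ x ha hpa fun y hy hy' => ?_
      rcases hy' with rfl | rfl | rfl
      · exact absurd (h.idx _ _ _ hy hu) i1
      · rfl
      · exact absurd (h.idx _ _ _ hy hb) i3
    · refine hW _ x hb hpb fun y hy hy' => ?_
      rcases hy' with rfl | rfl | rfl
      · exact absurd (h.idx _ _ _ hy hu) i2
      · exact absurd (h.idx _ _ _ ha hy) i3
      · rfl
  · rintro X hX ⟨x, hx⟩ hXR A hXA hpA
    exact splits_iff.2 ⟨_, hD, ⟨p, hpA, rfl⟩, x, hXA hx,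
      fun e => h.p_notMem i (hX (e ▸ hx : p ∈ X)), hXR x hx⟩

/-- As T does not split the neighborhood W, some component K of G - T misses W and lies in I i. The
members of C lie in W, so none of them splits K ∪ T, and a maximal unsplit set containing K ∪ T is
the required part. -/
theorem exists_part_boundary (h : FlowerShape G σ p q I W) {C : Set (Set V)}
    (hC : ∀ R, R ∈ C ↔ R ∈ threeCutsets G ∧ R ⊆ W ∧ Splits G R W)
    (hp : p ∈ ⋃₀ C) (hq : ∀ i, q i ∈ ⋃₀ C)
    (hparts : ∀ X, (∀ R ∈ C, ¬ Splits G R X) →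
      ∃ i, ∀ v ∈ X, v ∈ I i ∨ v = p ∨ v = q i ∨ v = q (σ i))
    {T : Set V} (hT : T ∈ threeCutsets G) (hTW : T ⊆ W) (hs : FlowerBoundaryShape σ p q I W T)
    (hns : ¬ Splits G T W) : ∃ A ∈ parts G C, 3 ≤ A.ncard ∧ T = partBoundary C A := by
  have hfin : Finite V := h.tri.finite
  obtain ⟨i, hi⟩ := hs
  have hTi : ∀ v ∈ T, v ∈ I i ∨ v = p ∨ v = q i ∨ v = q (σ i) := by
    rcases hi with rfl | ⟨u, hu, -, rfl⟩ <;> intro v hv <;> rcases mem_triple.1 hv with rfl | hv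
    · tauto
    · tauto
    · exact Or.inl hu
    · tauto
  have hqT : q i ∈ T ∧ q (σ i) ∈ T := by
    rcases hi with rfl | ⟨u, hu, -, rfl⟩ <;> simp
  have hooT : q (σ (σ i)) ∉ T := by
    intro h'
    rcases hTi _ h' with h1 | h1 | h1 | h1
    · exact h.q_notMem _ _ h1
    · exact h.q_ne _ h1
    · exact h.ne2 _ (h.q_inj h1)
    · exact h.ne1 _ (h.q_inj h1)
  obtain ⟨hT3, D, hD, ⟨x, hx⟩, z, hzD, hzT⟩ := mem_threeCutsets_iff.1 hT
  obtain ⟨K, hK, hKo⟩ : ∃ K, Comp G T K ∧ q (σ (σ i)) ∉ K := by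
    by_cases ho : q (σ (σ i)) ∈ D
    · obtain ⟨K, hK, hzK⟩ := exists_comp_mem hzT
      refine ⟨K, hK, fun h' => hzD ?_⟩
      exact hK.subset_of_mem hD h' ho hzK
    · obtain ⟨K, hK, hxK⟩ := exists_comp_mem (hD.1 x hx)
      refine ⟨K, hK, fun h' => ho ?_⟩
      exact hK.subset_of_mem hD hxK hx h'
  have hKW : ∀ v ∈ K, v ∉ W := fun v hv hvW =>
    ((not_splits_iff.1 hns) K hK.2.1 v hvW hv _ (h.W_q _)).elim hKo hooT
  have hKi : K ⊆ I i := by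
    intro v hv
    rcases h.cover v with rfl | ⟨l, rfl⟩ | ⟨l, hl⟩
    · exact absurd h.W_p (hKW _ hv)
    · exact absurd (h.W_q l) (hKW _ hv)
    · by_contra hvi
      refine hKo (h.outside hTi hK.2.1 hv ?_ ?_)
      · rintro (h1 | rfl | rfl | rfl)
        · exact hvi h1
        · exact h.p_notMem _ hl
        · exact h.q_notMem _ _ hl
        · exact h.q_notMem _ _ hl
      · rintro (h1 | h1 | h1 | h1)
        · exact h.q_notMem _ _ h1
        · exact h.q_ne _ h1
        · exact h.ne2 _ (h.q_inj h1)
        · exact h.ne1 _ (h.q_inj h1)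
  have hKT := fun t (ht : t ∈ T) => h.tri.exists_adj_of_closed hT3 hK.2.1 hK.1 ht
  have hun : ∀ R ∈ C, ¬ Splits G R (K ∪ T) := by
    intro R hR
    have hRK : ∀ v ∈ K, v ∉ R := fun v hv hvR => hKW v hv (((hC R).1 hR).2.1 hvR)
    rw [not_splits_iff]
    intro D hD
    have hcl : Closed G T (K ∩ D) := by
      refine ⟨fun x hx => hK.2.1.1 x hx.1, fun x hx y hxy => ?_⟩
      rcases hK.2.1.2 x hx.1 y hxy with h1 | h1
      · exact Or.inl ⟨h1, (hD.2 x hx.2 y hxy).resolve_right (hRK y h1)⟩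
      · exact Or.inr h1
    have hsub : ∀ x ∈ K, x ∈ D → K ⊆ D := fun x hx hxD => by
      rw [← hK.2.2 _ Set.inter_subset_left ⟨x, hx, hxD⟩ hcl]
      exact Set.inter_subset_right
    intro x hx hxD y hy
    have hKD : K ⊆ D := by
      rcases hx with hx | hx
      · exact hsub x hx hxD
      · obtain ⟨k, hk, hxk⟩ := hKT x hx
        exact hsub k hk ((hD.2 x hxD k hxk).resolve_right (hRK k hk))
    rcases hy with hy | hy
    · exact Or.inl (hKD hy)
    · obtain ⟨k, hk, hyk⟩ := hKT y hy
      exact hD.2 k (hKD hk) y hyk.symm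
  obtain ⟨A, hA, hAmax⟩ := Finite.exists_le_maximal
    (p := fun B : Set V => ∀ R ∈ C, ¬ Splits G R B) hun
  have hKA : K ⊆ A := Set.subset_union_left.trans hA
  have hTA : T ⊆ A := Set.subset_union_right.trans hA
  obtain ⟨j, hj⟩ := hparts A hAmax.1
  obtain ⟨k, hk⟩ := hK.1
  have hji : j = i := by
    rcases hj k (hKA hk) with h1 | rfl | rfl | rfl
    · exact h.idx _ _ k h1 (hKi hk)
    · exact absurd (hKi hk) (h.p_notMem _)
    · exact absurd (hKi hk) (h.q_notMem _ _)
    · exact absurd (hKi hk) (h.q_notMem _ _)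
  subst hji
  have hCW : ∀ v ∈ ⋃₀ C, v ∈ W := by
    rintro v ⟨R, hR, hvR⟩
    exact ((hC R).1 hR).2.1 hvR
  refine ⟨A, hAmax, hT3 ▸ Set.ncard_le_ncard hTA, ?_⟩
  apply Set.Subset.antisymm
  · refine fun v hv => ⟨hTA hv, ?_⟩
    rcases hi with rfl | ⟨u, hu, huW, rfl⟩ <;> rcases mem_triple.1 hv with rfl | rfl | rfl
    · exact hp
    · exact hq _
    · exact hq _
    · obtain ⟨R, hR, hRW, hRs, huR, -⟩ := h.exists_separator hu huW
      exact ⟨R, (hC R).2 ⟨hR, hRW, hRs⟩, huR⟩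
    · exact hq _
    · exact hq _
  -- No further vertex of W belongs to A: if p is in T, such a vertex of I i would be the only
  -- neighbor of p there and thus lie in K; if u replaces p in T, then `exists_separator` splits p
  -- from K.
  · rintro v ⟨hvA, hvC⟩
    by_contra hvT
    have hvW := hCW v hvC
    rcases hi with rfl | ⟨u, hu, huW, rfl⟩
    · rcases hj v hvA with h1 | rfl | rfl | rfl
      · obtain ⟨y, hy, hpy⟩ := hKT p (by simp)
        have := h.W_uniq j v h1 hvW y hpy (Or.inl (hKi hy))
        exact hKW y hy (this ▸ hvW)
      · exact hvT (by simp)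
      · exact hvT hqT.1
      · exact hvT hqT.2
    · rcases hj v hvA with h1 | rfl | rfl | rfl
      · exact hvT (h.W_eq hu huW h1 hvW ▸ Set.mem_insert _ _)
      · obtain ⟨R, hR, hRW, hRs, huR, hsep⟩ := h.exists_separator hu huW
        exact hAmax.1 R ((hC R).2 ⟨hR, hRW, hRs⟩) (hsep K hKi hK.1
          (fun x hx hxR => hKW x hx (hRW hxR)) A hKA hvA)
      · exact hvT hqT.1
      · exact hvT hqT.2

end FlowerShape

/-! ### From flowers to their cyclic structure -/

theorem zmod_small_ne {m : ℕ} (hm : 4 ≤ m) :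
    (1 : ZMod m) ≠ 0 ∧ (1 + 1 : ZMod m) ≠ 0 ∧ (1 + 1 + 1 : ZMod m) ≠ 0 := by
  have key : ∀ k : ℕ, 0 < k → k < 4 → ((k : ℕ) : ZMod m) ≠ 0 := by
    intro k hk hk4 e
    rw [ZMod.natCast_eq_zero_iff] at e
    have := Nat.le_of_dvd hk e
    omega
  have h1 := key 1 (by omega) (by omega)
  have h2 := key 2 (by omega) (by omega)
  have h3 := key 3 (by omega) (by omega)
  refine ⟨by simpa using h1, fun e => h2 ?_, fun e => h3 ?_⟩
  · push_cast
    rw [← e]; ring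
  · push_cast
    rw [← e]; ring

/-- The rotation of the petals of a flower. -/
def FlowerData.rot (F : FlowerData V) : Equiv.Perm (ZMod F.m) := Equiv.addRight 1

theorem FlowerData.rot_apply (F : FlowerData V) (i : ZMod F.m) : F.rot i = i + 1 := rfl

theorem FlowerData.rot_symm_apply (F : FlowerData V) (i : ZMod F.m) : F.rot.symm i = i - 1 :=
  (Equiv.symm_apply_eq _).2 (by rw [F.rot_apply, sub_add_cancel])

theorem not_splits_pair {R : Set V} {x y : V} (hxy : G.Adj x y) : ¬ Splits G R {x, y} := by
  rw [not_splits_iff]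
  rintro D hD a (rfl | rfl) ha b (rfl | rfl)
  · exact Or.inl ha
  · exact hD.2 _ ha _ hxy
  · exact hD.2 _ ha _ hxy.symm
  · exact Or.inl ha

theorem not_splits_singleton {R : Set V} {x : V} : ¬ Splits G R {x} := by
  rw [not_splits_iff]
  rintro D hD a rfl ha b rfl
  exact Or.inl ha

theorem not_splits_union {R X Y : Set V} (hX : ¬ Splits G R X) (hY : ¬ Splits G R Y) {v : V}
    (hvX : v ∈ X) (hvY : v ∈ Y) (hv : v ∉ R) : ¬ Splits G R (X ∪ Y) := by
  rw [not_splits_iff] at *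
  intro D hD x hx hxD y hy
  have hvD : v ∈ D := by
    rcases hx with hx | hx
    · exact (hX D hD x hx hxD v hvX).resolve_right hv
    · exact (hY D hD x hx hxD v hvY).resolve_right hv
  rcases hy with hy | hy
  · exact hX D hD v hvX hvD y hy
  · exact hY D hD v hvY hvD y hy

theorem exists_part {𝔖 : Set (Set V)} [Finite V] {X : Set V} (hX : ∀ S ∈ 𝔖, ¬ Splits G S X) :
    ∃ A ∈ parts G 𝔖, X ⊆ A := by
  obtain ⟨A, hA, hmax⟩ := Finite.exists_le_maximal (p := fun B : Set V => ∀ S ∈ 𝔖, ¬ Splits G S B) hX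
  exact ⟨A, hmax, hA⟩

/-- Two unsplit sets sharing a vertex outside all cutsets have an unsplit union, so two parts
sharing such a vertex coincide. -/
theorem parts_eq_of_mem {𝔖 : Set (Set V)} {A B : Set V} (hA : A ∈ parts G 𝔖) (hB : B ∈ parts G 𝔖)
    {v : V} (hvA : v ∈ A) (hvB : v ∈ B) (hv : v ∉ ⋃₀ 𝔖) : A = B := by
  have hu : ∀ S ∈ 𝔖, ¬ Splits G S (A ∪ B) := fun S hS =>
    not_splits_union (hA.1 S hS) (hB.1 S hS) hvA hvB fun h' => hv ⟨S, hS, h'⟩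
  exact (Set.subset_union_left.antisymm (hA.2 hu Set.subset_union_left)).trans
    ((hB.2 hu Set.subset_union_right).antisymm Set.subset_union_right)

namespace IsFlower

variable {F : FlowerData V} {𝔖 : Set (Set V)}

theorem sUnion_eq [Finite V] (h1 : parts G 𝔖 = Set.range F.part)
    (h2 : ∀ i, partBoundary 𝔖 (F.part i) = F.set i (i + 1)) : ⋃₀ 𝔖 = F.verts := by
  apply Set.Subset.antisymm
  · intro v hv
    obtain ⟨A, hA, hvA⟩ := exists_part (G := G) (𝔖 := 𝔖) (X := {v}) fun S _ => not_splits_singleton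
    rw [h1] at hA
    obtain ⟨i, rfl⟩ := hA
    have : v ∈ partBoundary 𝔖 (F.part i) := ⟨hvA rfl, hv⟩
    rw [h2, FlowerData.set, mem_triple] at this
    rcases this with rfl | rfl | rfl
    · exact Or.inr ⟨_, rfl⟩
    · exact Or.inr ⟨_, rfl⟩
    · exact Or.inl rfl
  · have key : ∀ i, ∀ v ∈ F.set i (i + 1), v ∈ ⋃₀ 𝔖 := fun i v hv => by
      rw [← h2] at hv
      exact hv.2
    rintro v (rfl | ⟨i, rfl⟩)
    · exact key 0 _ (by simp [FlowerData.set])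
    · exact key i _ (by simp [FlowerData.set])

theorem mem_part [Finite V] (h1 : parts G 𝔖 = Set.range F.part)
    (h2 : ∀ i, partBoundary 𝔖 (F.part i) = F.set i (i + 1)) {i : ZMod F.m} {v : V} :
    v ∈ F.part i ↔ v ∈ F.interior i ∨ v = F.center ∨ v = F.petal i ∨ v = F.petal (i + 1) := by
  have hu := sUnion_eq h1 h2
  have h3 : v ∈ F.part i ∧ v ∈ F.verts ↔ v = F.petal i ∨ v = F.petal (i + 1) ∨ v = F.center := by
    rw [← mem_triple, ← hu]
    exact Set.ext_iff.1 (h2 i) v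
  have h4 : v ∈ F.interior i ↔ v ∈ F.part i ∧ v ∉ F.verts := Iff.rfl
  rw [h4]
  tauto

/-- No cutset splits the two ends of an edge, so each edge lies in one part; all adjacency
conditions of a flower shape follow from this. The generating cutsets are kept for the later use of
their parts. -/
theorem shape_and_cutsets (tri : TriCond G) (hF : IsFlower G F) :
    FlowerShape G F.rot F.center F.petal F.interior (flowerNeighborhood G F) ∧
      ∃ 𝔖 : Set (Set V), 𝔖 ⊆ threeCutsets G ∧ 𝔖 ⊆ F.innerSets ∧ ⋃₀ 𝔖 = F.verts ∧
        ∀ X, (∀ S ∈ 𝔖, ¬ Splits G S X) → ∃ i, ∀ v ∈ X, v ∈ F.interior i ∨ v = F.center ∨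
          v = F.petal i ∨ v = F.petal (F.rot i) := by
  have hfin : Finite V := tri.finite
  obtain ⟨hm, hinj, hne, 𝔖, hS, hSc, h1, h2⟩ := hF
  have hu := sUnion_eq h1 h2
  have hmem := fun i v => mem_part (i := i) (v := v) h1 h2
  obtain ⟨z1, z2, z3⟩ := zmod_small_ne hm
  have hpart : ∀ i, F.part i ∈ parts G 𝔖 := fun i => h1 ▸ ⟨i, rfl⟩
  have hext : ∀ X, (∀ S ∈ 𝔖, ¬ Splits G S X) → ∃ i, X ⊆ F.part i := by
    intro X hX
    obtain ⟨A, hA, hXA⟩ := exists_part hX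
    rw [h1] at hA
    obtain ⟨i, rfl⟩ := hA
    exact ⟨i, hXA⟩
  have hedge : ∀ x y, G.Adj x y → ∃ i, x ∈ F.part i ∧ y ∈ F.part i := by
    intro x y hxy
    obtain ⟨i, hi⟩ := hext {x, y} fun S _ => not_splits_pair hxy
    exact ⟨i, hi (by simp), hi (by simp)⟩
  have hpv : F.center ∈ F.verts := Or.inl rfl
  have hqv : ∀ i, F.petal i ∈ F.verts := fun i => Or.inr ⟨i, rfl⟩
  have hidx : ∀ i j v, v ∈ F.interior i → v ∈ F.part j → i = j := by
    intro i j v hi hj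
    have heq := parts_eq_of_mem (hpart i) (hpart j) hi.1 hj (hu ▸ hi.2)
    have e1 : F.petal i ∈ F.part j := heq ▸ (hmem i _).2 (by simp)
    have e2 : F.petal (i + 1) ∈ F.part j := heq ▸ (hmem i _).2 (by simp)
    have e3 : ∀ k, F.petal k ∈ F.part j → k = j ∨ k = j + 1 := by
      intro k hk
      rcases (hmem j _).1 hk with h3 | h3 | h3 | h3
      · exact absurd (hqv k) h3.2
      · exact absurd h3 (hne k)
      · exact Or.inl (hinj h3)
      · exact Or.inr (hinj h3)
    rcases e3 _ e1 with h3 | h3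
    · exact h3
    · rcases e3 _ e2 with h4 | h4
      -- Here i = j + 1 and i + 1 = j, impossible with at least four petals.
      · rw [h3, add_assoc] at h4
        exact absurd (add_eq_left.1 h4) z2
      · exact add_right_cancel h4
  have hnb : ∀ i, ∀ u ∈ F.interior i, u ∈ flowerNeighborhood G F → IsFlowerNeighbor G F i u := by
    rintro i u hi (h3 | ⟨j, hj⟩)
    · exact absurd h3 hi.2
    · have : u ∈ F.part j ∩ G.neighborSet F.center := by
        rw [hj.1]; rfl
      rwa [hidx i j u hi this.1]
  refine ⟨{
    tri := tri
    cyc := ?_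
    ne1 := fun i e => z1 (add_eq_left.1 e)
    ne2 := fun i e => z2 (by
      rw [F.rot_apply, F.rot_apply, add_assoc] at e
      exact add_eq_left.1 e)
    ne3 := fun i e => z3 (by
      rw [F.rot_apply, F.rot_apply, F.rot_apply, add_assoc, add_assoc, ← add_assoc 1 1 1] at e
      exact add_eq_left.1 e)
    q_inj := hinj
    q_ne := hne
    p_notMem := fun i h' => h'.2 hpv
    q_notMem := fun i j h' => h'.2 (hqv j)
    idx := fun i j v hi hj => hidx i j v hi hj.1
    cover := ?_
    I_adj := ?_
    q_adj := ?_
    W_p := Or.inl hpv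
    W_q := fun i => Or.inl (hqv i)
    W_adj := ?_
    W_uniq := ?_
    W_cond := ?_
    W_mem := ?_ }, 𝔖, hSc, hS, hu, ?_⟩
  · intro J ⟨j, hj⟩ hJ k
    have : NeZero F.m := ⟨by omega⟩
    have key : ∀ n : ℕ, j + (n : ZMod F.m) ∈ J := by
      intro n
      induction n with
      | zero => simpa using hj
      | succ n ih =>
        have := hJ _ ih
        rwa [F.rot_apply, add_assoc, ← Nat.cast_succ] at this
    have := key (k - j).val
    rwa [ZMod.natCast_zmod_val, add_sub_cancel] at this
  · intro v
    obtain ⟨i, hi⟩ := hext {v} fun S _ => not_splits_singleton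
    rcases (hmem i v).1 (hi rfl) with h3 | h3 | h3 | h3
    · exact Or.inr (Or.inr ⟨i, h3⟩)
    · exact Or.inl h3
    · exact Or.inr (Or.inl ⟨_, h3⟩)
    · exact Or.inr (Or.inl ⟨_, h3⟩)
  · intro i x hx y hxy
    obtain ⟨j, hxj, hyj⟩ := hedge x y hxy
    have := hidx i j x hx hxj
    subst this
    exact (hmem i y).1 hyj
  · intro i j hij
    obtain ⟨k, hik, hjk⟩ := hedge _ _ hij
    have e3 : ∀ l, F.petal l ∈ F.part k → l = k ∨ l = k + 1 := by
      intro l hl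
      rcases (hmem k _).1 hl with h3 | h3 | h3 | h3
      · exact absurd (hqv l) h3.2
      · exact absurd h3 (hne l)
      · exact Or.inl (hinj h3)
      · exact Or.inr (hinj h3)
    rcases e3 _ hik with rfl | rfl <;> rcases e3 _ hjk with rfl | rfl
    · exact absurd hij (G.loopless.irrefl _)
    · exact Or.inl rfl
    · exact Or.inr rfl
    · exact absurd hij (G.loopless.irrefl _)
  · intro i u hi hW
    have := (hnb i u hi hW).1
    have h3 : u ∈ F.part i ∩ G.neighborSet F.center := by rw [this]; rfl
    exact h3.2
  · intro i u hi hW y hpy hy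
    have := (hnb i u hi hW).1
    have h3 : y ∈ F.part i ∩ G.neighborSet F.center := ⟨(hmem i y).2 (by
      rw [F.rot_apply] at hy; tauto), hpy⟩
    rw [this] at h3
    exact h3
  · intro i u hi hW
    rw [F.rot_apply, F.rot_symm_apply]
    rcases (hnb i u hi hW).2 with h3 | h3
    · exact Or.inl h3.1
    · exact Or.inr h3.2
  · intro i u hi hc hpu huniq
    refine Or.inr ⟨i, ?_, Or.inl ⟨hc, u, hi⟩⟩
    apply Set.Subset.antisymm
    · rintro y ⟨hy, hpy⟩
      refine huniq y hpy ?_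
      have := (hmem i y).1 hy
      have hne : y ≠ F.center := fun e => G.loopless.irrefl _ (e ▸ hpy : G.Adj F.center F.center)
      rw [F.rot_apply]
      tauto
    · rintro y rfl
      exact ⟨hi.1, hpu⟩
  · intro X hX
    obtain ⟨i, hi⟩ := hext X hX
    exact ⟨i, fun v hv => (hmem i v).1 (hi hv)⟩

end IsFlower

/-- Closed sets of a center and non-neighboring petals contain petals. -/
theorem FlowerShape.exists_petal_of_closed {ι : Type*} {σ : Equiv.Perm ι} {p : V} {q : ι → V}
    {I : ι → Set V} {W : Set V} (h : FlowerShape G σ p q I W) {R D : Set V} (hD : Closed G R D)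
    (hp : p ∈ R) (hRI : ∀ l, ∀ x ∈ I l, x ∉ R) (hR : ∀ l, ¬ (q l ∈ R ∧ q (σ l) ∈ R)) {x : V}
    (hx : x ∈ D) : ∃ l, q l ∈ D := by
  rcases h.cover x with rfl | ⟨l, rfl⟩ | ⟨l, hl⟩
  · exact absurd hp (hD.1 _ hx)
  · exact ⟨l, hx⟩
  · obtain ⟨-, ⟨y, hy, hqy⟩, z, hz, hqz⟩ := h.exists_adj_of_subset (X := D ∩ I l)
      Set.inter_subset_right ⟨hx, hl⟩ (fun x hx y hxy => by
        rcases h.I_adj l x hx.2 y hxy with h1 | h1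
        · exact Or.inl ⟨(hD.2 x hx.1 y hxy).resolve_right (hRI l y h1), h1⟩
        · exact Or.inr h1)
    rcases hD.2 y hy.1 _ hqy.symm with h1 | h1
    · exact ⟨_, h1⟩
    rcases hD.2 z hz.1 _ hqz.symm with h2 | h2
    · exact ⟨_, h2⟩
    exact absurd ⟨h1, h2⟩ (hR l)

/-! ### Membership in flower complexes -/

theorem IsFlower.innerSets_subset {F : FlowerData V}
    (h : FlowerShape G F.rot F.center F.petal F.interior (flowerNeighborhood G F)) {S : Set V}
    (hS : S ∈ F.innerSets) (hSc : S ∈ threeCutsets G) : S ∈ flowerComplex G F := by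
  obtain ⟨i, j, hij, hij1, hij2, rfl⟩ := hS
  have hsub : ∀ v ∈ F.set i j, v ∈ F.verts := by
    intro v hv
    rcases mem_triple.1 hv with rfl | rfl | rfl
    · exact Or.inr ⟨_, rfl⟩
    · exact Or.inr ⟨_, rfl⟩
    · exact Or.inl rfl
  have hp : F.center ∈ F.set i j := by simp [FlowerData.set]
  have hRI : ∀ l, ∀ x ∈ F.interior l, x ∉ F.set i j := fun l x hx hxS => hx.2 (hsub x hxS)
  have hqS : ∀ l, F.petal l ∈ F.set i j → l = i ∨ l = j := by
    intro l hl
    rcases mem_triple.1 hl with h1 | h1 | h1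
    · exact Or.inl (h.q_inj h1)
    · exact Or.inr (h.q_inj h1)
    · exact absurd h1 (h.q_ne l)
  have hR : ∀ l, ¬ (F.petal l ∈ F.set i j ∧ F.petal (F.rot l) ∈ F.set i j) := by
    rintro l ⟨h1, h2⟩
    have hn := h.ne1 l
    rw [F.rot_apply] at h2 hn
    rcases hqS _ h1 with rfl | rfl <;> rcases hqS _ h2 with h3 | h3
    · exact hn h3
    · exact hij1 h3.symm
    · exact hij2 h3.symm
    · exact hn h3
  refine ⟨hSc, fun v hv => Or.inl (hsub v hv), ?_⟩
  -- Since the two petals in the set are not consecutive, both sides of the cutset contain petals,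
  -- so it splits the neighborhood.
  obtain ⟨-, D, hD, ⟨x, hx⟩, z, hzD, hzS⟩ := mem_threeCutsets_iff.1 hSc
  obtain ⟨k, hk⟩ := h.exists_petal_of_closed hD hp hRI hR hx
  obtain ⟨l, hl⟩ := h.exists_petal_of_closed hD.compl hp hRI hR (x := z) fun h' => h'.elim hzD hzS
  exact splits_iff.2 ⟨D, hD, ⟨_, h.W_q k, hk⟩, _, h.W_q l, fun h' => hl (Or.inl h'),
    fun h' => hl (Or.inr h')⟩

theorem TriCond.flowerComplex_ne_singleton (tri : TriCond G) {F : FlowerData V}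
    (hF : IsFlower G F) (T : Set V) : flowerComplex G F ≠ {T} := by
  intro he
  obtain ⟨h, 𝔖, hSc, hS, hu, -⟩ := hF.shape_and_cutsets tri
  have key : ∀ v ∈ F.verts, v ∈ T := by
    intro v hv
    rw [← hu] at hv
    obtain ⟨S, hSS, hvS⟩ := hv
    have := IsFlower.innerSets_subset h (hS hSS) (hSc hSS)
    rw [he] at this
    exact (Set.mem_singleton_iff.1 this) ▸ hvS
  have hfin : Finite V := tri.finite
  have hT3 : T.ncard = 3 := by
    have : T ∈ flowerComplex G F := he ▸ rfl
    exact this.1.1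
  have h4 : ({F.center, F.petal 0, F.petal (F.rot 0), F.petal (F.rot (F.rot 0))} : Set V).ncard
      = 4 := by
    rw [Set.ncard_insert_of_notMem, ncard_triple (h.q_inj.ne (h.ne1 _).symm)
      (h.q_inj.ne (h.ne2 _).symm) (h.q_inj.ne (h.ne1 _).symm)]
    rw [mem_triple]
    rintro (e | e | e) <;> exact h.q_ne _ e.symm
  have := Set.ncard_le_ncard (s := {F.center, F.petal 0, F.petal (F.rot 0),
    F.petal (F.rot (F.rot 0))}) (t := T) (by
      rintro v (rfl | rfl | rfl | rfl)
      · exact key _ (Or.inl rfl)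
      · exact key _ (Or.inr ⟨_, rfl⟩)
      · exact key _ (Or.inr ⟨_, rfl⟩)
      · exact key _ (Or.inr ⟨_, rfl⟩))
  omega

theorem Config.mem_or_boundary_of_flower {T K₁ K₂ : Set V} {t₁ t₂ t₃ s₁ : V}
    (c : Config G T K₁ K₂ t₁ t₂ t₃ s₁) {F : FlowerData V} (hF : IsFlower G F)
    (hT : {s₁, t₂, t₃} ∈ flowerComplex G F) : T ∈ flowerComplex G F ∨ T ∈ flowerBoundaries G F := by
  obtain ⟨h, 𝔖, hSc, hS, hu, hext⟩ := hF.shape_and_cutsets c.tri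
  have hSC : ∀ S ∈ 𝔖, S ∈ flowerComplex G F := fun S hSS =>
    IsFlower.innerSets_subset h (hS hSS) (hSc hSS)
  have hC : ∀ v ∈ F.verts, v ∈ ⋃₀ flowerComplex G F := by
    intro v hv
    rw [← hu] at hv
    obtain ⟨S, hSS, hvS⟩ := hv
    exact ⟨S, hSC S hSS, hvS⟩
  -- The generating cutsets all contain the center. If the center is in T, they are independent with
  -- T, and T lies in one part.
  have hb := h.boundaryShape c (fun v hv => hT.2.1 (mem_triple.2 hv)) hT.2.2 fun hp =>
    hext T fun S hSS => c.indep S (hSc hSS) ⟨F.center, by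
      obtain ⟨i, j, -, -, -, rfl⟩ := hS hSS
      simp [FlowerData.set], hp⟩
  have hTW : T ⊆ flowerNeighborhood G F := by
    obtain ⟨i, rfl | ⟨u, hu, huW, rfl⟩⟩ := hb <;> intro v hv <;>
      rcases mem_triple.1 hv with rfl | rfl | rfl
    · exact h.W_p
    · exact h.W_q _
    · exact h.W_q _
    · exact huW
    · exact h.W_q _
    · exact h.W_q _
  by_cases hs : Splits G T (flowerNeighborhood G F)
  · exact Or.inl ⟨c.T_mem, hTW, hs⟩
  · exact Or.inr (h.exists_part_boundary (C := flowerComplex G F) (fun R => Iff.rfl)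
      (hC _ (Or.inl rfl)) (fun i => hC _ (Or.inr ⟨i, rfl⟩))
      (fun X hX => hext X fun S hSS => hX S (hSC S hSS)) c.T_mem hTW hb hs)


/-- If the second boundary of the cut of a configuration belongs to a big complex, then the first
boundary belongs to this complex or is one of its boundaries. -/
theorem Config.inBigComplex_or_boundary {T K₁ K₂ : Set V} {t₁ t₂ t₃ s₁ : V}
    (c : Config G T K₁ K₂ t₁ t₂ t₃ s₁) (hT : InBigComplex G {s₁, t₂, t₃}) :
    InBigComplex G T ∨ IsBigComplexBoundary G T := by
  obtain ⟨C, B, hC, hTC⟩ := hT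
  rcases hC with ⟨S, hS⟩ | ⟨F, hF, hF'⟩ | ⟨M, hM⟩
  · exact (c.mem_or_boundary_of_triple hS hTC).imp (fun h' => ⟨_, _, .triple S hS, h'⟩)
      fun h' => ⟨_, _, .triple S hS, h'⟩
  · exact (c.mem_or_boundary_of_flower hF.1 hTC).imp (fun h' => ⟨_, _, .flower F hF hF', h'⟩)
      fun h' => ⟨_, _, .flower F hF hF', h'⟩
  · exact Or.inr ⟨_, _, .bigCut M hM, c.boundary_of_bigCut hM hTC⟩

theorem inBigComplex_or_boundary_of_subset_triple {S T : Set V} (hS : S ∈ tripleLines G)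
    (hT : T ∈ threeCutsets G) (hsub : T ⊆ tripleNeighborhood G S) :
    InBigComplex G T ∨ IsBigComplexBoundary G T :=
  (mem_tripleComplex_or_boundary hT hsub).imp (fun h' => ⟨_, _, .triple S hS, h'⟩)
    fun h' => ⟨_, _, .triple S hS, h'⟩

/-! ### Dependent cutsets with a common vertex -/

/-- Every component of `G - S` meets the cutsets splitting `S`. -/
theorem TriCond.exists_mem_comp (tri : TriCond G) {S T H : Set V} (hS : S.ncard = 3)
    (hH : Comp G S H) (hs : Splits G T S) : ∃ t ∈ T, t ∈ H := by
  by_contra! hno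
  obtain ⟨K, hK, ⟨x, hx, hxK⟩, y, hy, hyK, hyT⟩ := splits_iff.1 hs
  obtain ⟨u, hu, hxu⟩ := tri.exists_adj_of_closed hS hH.2.1 hH.1 hx
  obtain ⟨v, hv, hyv⟩ := tri.exists_adj_of_closed hS hH.2.1 hH.1 hy
  have hcl : Closed G S (K ∩ H) := by
    refine ⟨fun x hx => hH.2.1.1 x hx.2, fun x hx y hxy => ?_⟩
    rcases hH.2.1.2 x hx.2 y hxy with h1 | h1
    · exact Or.inl ⟨(hK.2 x hx.1 y hxy).resolve_right fun h' => hno y h' h1, h1⟩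
    · exact Or.inr h1
  have huK : u ∈ K := (hK.2 x hxK u hxu).resolve_right fun h' => hno u h' hu
  have hvK := (hH.subset_of_mem hcl hu ⟨huK, hu⟩ hv).1
  exact (hK.2 v hvK y hyv.symm).elim hyK hyT

/-- The vertices t and s anchor the corner: an unsplit set containing them cannot leave D ∪ S or K ∪
T. -/
theorem corner_mem_parts {S T D K : Set V} (hD : Comp G S D) (hK : Comp G T K) {s t : V}
    (ht : t ∈ T) (htD : t ∈ D) (hs : s ∈ S) (hsK : s ∈ K) :
    (D ∪ S) ∩ (K ∪ T) ∈ parts G {S, T} := by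
  refine ⟨?_, fun B hB hle v hv => ⟨?_, ?_⟩⟩
  · rintro R (rfl | rfl) h'
    · exact hD.not_splits (h'.mono Set.inter_subset_left)
    · exact hK.not_splits (h'.mono Set.inter_subset_right)
  · exact subset_of_not_splits hD (hB S (by simp)) (hle ⟨Or.inl htD, Or.inr ht⟩) htD hv
  · exact subset_of_not_splits hK (hB T (by simp)) (hle ⟨Or.inr hs, Or.inl hsK⟩) hsK hv

theorem eq_triple_of_mem {X : Set V} (hX : X.ncard = 3) {a b c : V} (ha : a ∈ X) (hb : b ∈ X)
    (hc : c ∈ X) (hab : a ≠ b) (hac : a ≠ c) (hbc : b ≠ c) : X = {a, b, c} := by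
  ext v
  rw [mem_triple]
  refine ⟨fun hv => eq_of_ncard_three hX ha hb hc hv hab hac hbc, ?_⟩
  rintro (rfl | rfl | rfl) <;> assumption

/-- Two dependent cutsets `{p, s₁, s₂}` and `{p, t₁, t₂}`, where `D₁`, `D₂` are the components of
the complement of the former, and `K₁`, `K₂` those of the latter. -/
structure CrossPair (G : SimpleGraph V) (S T D₁ D₂ K₁ K₂ : Set V) (p s₁ s₂ t₁ t₂ : V) : Prop where
  S_mem : S ∈ threeCutsets G
  T_mem : T ∈ threeCutsets G
  S_eq : S = {p, s₁, s₂}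
  T_eq : T = {p, t₁, t₂}
  D₁_comp : Comp G S D₁
  D₂_comp : Comp G S D₂
  K₁_comp : Comp G T K₁
  K₂_comp : Comp G T K₂
  t₁_mem : t₁ ∈ D₁
  t₂_mem : t₂ ∈ D₂
  s₁_mem : s₁ ∈ K₁
  s₂_mem : s₂ ∈ K₂
  t₂_notMem : t₂ ∉ D₁
  t₁_notMem : t₁ ∉ D₂
  s₂_notMem : s₂ ∉ K₁
  s₁_notMem : s₁ ∉ K₂
  S_cover : ∀ v, v ∈ S ∨ v ∈ D₁ ∨ v ∈ D₂
  T_cover : ∀ v, v ∈ T ∨ v ∈ K₁ ∨ v ∈ K₂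
  ne_s : s₁ ≠ s₂
  ne_t : t₁ ≠ t₂

/-- T splits S, so every component of G - S meets T; since p is in S, only t₁ and t₂ are available,
and there are exactly two components. -/
theorem TriCond.exists_crossPair_half (tri : TriCond G) {S T : Set V} {p : V}
    (hS : S ∈ threeCutsets G) (hT : T ∈ threeCutsets G) (hpS : p ∈ S) (hpT : p ∈ T)
    (hs : Splits G S T) : ∃ t₁ t₂ D₁ D₂, T = {p, t₁, t₂} ∧ Comp G S D₁ ∧ Comp G S D₂ ∧
      t₁ ∈ D₁ ∧ t₂ ∈ D₂ ∧ t₂ ∉ D₁ ∧ t₁ ∉ D₂ ∧ (∀ v, v ∈ S ∨ v ∈ D₁ ∨ v ∈ D₂) ∧ t₁ ≠ t₂ := by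
  have hs' := tri.splits_symm hT hs
  obtain ⟨D, hD, ⟨t₁, ht₁, ht₁D⟩, t₂, ht₂, ht₂D, ht₂S⟩ := splits_iff.1 hs
  have ht₁S := hD.1 _ ht₁D
  obtain ⟨D₁, hD₁, h1⟩ := exists_comp_mem (G := G) ht₁S
  obtain ⟨D₂, hD₂, h2⟩ := exists_comp_mem (G := G) ht₂S
  have hne : t₁ ≠ t₂ := fun e => ht₂D (e ▸ ht₁D)
  have hTe := eq_triple_of_mem hT.1 hpT ht₁ ht₂ (fun e => ht₁S (e ▸ hpS))
    (fun e => ht₂S (e ▸ hpS)) hne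
  have hsub := hD₁.subset_of_mem hD h1 ht₁D
  have hn : t₂ ∉ D₁ := fun h' => ht₂D (hsub h')
  refine ⟨t₁, t₂, D₁, D₂, hTe, hD₁, hD₂, h1, h2, hn, fun h' => hn ?_, fun v => ?_, hne⟩
  · rw [hD₁.eq_of_mem hD₂ h1 h']
    exact h2
  · by_cases hv : v ∈ S
    · exact Or.inl hv
    obtain ⟨H, hH, hvH⟩ := exists_comp_mem (G := G) hv
    obtain ⟨t, ht, htH⟩ := tri.exists_mem_comp hS.1 hH hs'
    rw [hTe, mem_triple] at ht
    rcases ht with rfl | rfl | rfl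
    · exact absurd hpS (hH.2.1.1 _ htH)
    · exact Or.inr (Or.inl (hH.eq_of_mem hD₁ htH h1 ▸ hvH))
    · exact Or.inr (Or.inr (hH.eq_of_mem hD₂ htH h2 ▸ hvH))

theorem TriCond.exists_crossPair (tri : TriCond G) {S T : Set V} {p : V}
    (hS : S ∈ threeCutsets G) (hT : T ∈ threeCutsets G) (hpS : p ∈ S) (hpT : p ∈ T)
    (hs : Splits G S T) :
    ∃ D₁ D₂ K₁ K₂ s₁ s₂ t₁ t₂, CrossPair G S T D₁ D₂ K₁ K₂ p s₁ s₂ t₁ t₂ := by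
  obtain ⟨t₁, t₂, D₁, D₂, hTe, a1, a2, a3, a4, a5, a6, a7, a8⟩ :=
    tri.exists_crossPair_half hS hT hpS hpT hs
  obtain ⟨s₁, s₂, K₁, K₂, hSe, b1, b2, b3, b4, b5, b6, b7, b8⟩ :=
    tri.exists_crossPair_half hT hS hpT hpS (tri.splits_symm hT hs)
  exact ⟨D₁, D₂, K₁, K₂, s₁, s₂, t₁, t₂, hS, hT, hSe, hTe, a1, a2, b1, b2, a3, a4, b3, b4, a5, a6,
    b5, b6, a7, b7, b8, a8⟩

namespace CrossPair

variable {S T D₁ D₂ K₁ K₂ : Set V} {p s₁ s₂ t₁ t₂ : V}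
  (h : CrossPair G S T D₁ D₂ K₁ K₂ p s₁ s₂ t₁ t₂)
include h

theorem p_mem : p ∈ S ∧ p ∈ T := by
  rw [h.S_eq, h.T_eq]
  simp

theorem mem_S {v : V} : v ∈ S ↔ v = p ∨ v = s₁ ∨ v = s₂ := by rw [h.S_eq, mem_triple]

theorem mem_T {v : V} : v ∈ T ↔ v = p ∨ v = t₁ ∨ v = t₂ := by rw [h.T_eq, mem_triple]

theorem s_notMem : s₁ ∉ T ∧ s₂ ∉ T :=
  ⟨h.K₁_comp.2.1.1 _ h.s₁_mem, h.K₂_comp.2.1.1 _ h.s₂_mem⟩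

theorem t_notMem : t₁ ∉ S ∧ t₂ ∉ S :=
  ⟨h.D₁_comp.2.1.1 _ h.t₁_mem, h.D₂_comp.2.1.1 _ h.t₂_mem⟩

theorem corner_boundary {D K : Set V} {s t : V} (hs : s = s₁ ∨ s = s₂) (ht : t = t₁ ∨ t = t₂)
    (hD : ∀ v, v = t₁ ∨ v = t₂ → (v ∈ D ↔ v = t)) (hK : ∀ v, v = s₁ ∨ v = s₂ → (v ∈ K ↔ v = s)) :
    partBoundary {S, T} ((D ∪ S) ∩ (K ∪ T)) = {s, t, p} := by
  have hst := h.s_notMem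
  have hts := h.t_notMem
  have hp := h.p_mem
  ext v
  rw [mem_triple]
  simp only [partBoundary, Set.sUnion_insert, Set.sUnion_singleton, Set.mem_inter_iff,
    Set.mem_union]
  constructor
  · rintro ⟨⟨h1, h2⟩, h3 | h3⟩
    · rcases h.mem_S.1 h3 with rfl | h4
      · simp
      · refine Or.inl ((hK v h4).1 (h2.resolve_right fun h' => ?_))
        rcases h4 with rfl | rfl
        · exact hst.1 h'
        · exact hst.2 h'
    · rcases h.mem_T.1 h3 with rfl | h4
      · simp
      · refine Or.inr (Or.inl ((hD v h4).1 (h1.resolve_right fun h' => ?_)))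
        rcases h4 with rfl | rfl
        · exact hts.1 h'
        · exact hts.2 h'
  · rintro (rfl | rfl | rfl)
    · have : v ∈ S := h.mem_S.2 (Or.inr hs)
      exact ⟨⟨Or.inr this, Or.inl ((hK v hs).2 rfl)⟩, Or.inl this⟩
    · have : v ∈ T := h.mem_T.2 (Or.inr ht)
      exact ⟨⟨Or.inl ((hD v ht).2 rfl), Or.inr this⟩, Or.inr this⟩
    · exact ⟨⟨Or.inr hp.1, Or.inr hp.2⟩, Or.inl hp.1⟩

end CrossPair

/-- The flower with four petals defined by two dependent cutsets with a common vertex. -/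
def crossFlower (S T D₁ D₂ K₁ K₂ : Set V) (p s₁ s₂ t₁ t₂ : V) : FlowerData V where
  m := 4
  center := p
  petal := ![s₁, t₁, s₂, t₂]
  part := ![(D₁ ∪ S) ∩ (K₁ ∪ T), (D₁ ∪ S) ∩ (K₂ ∪ T), (D₂ ∪ S) ∩ (K₂ ∪ T), (D₂ ∪ S) ∩ (K₁ ∪ T)]

theorem CrossPair.isFlower {S T D₁ D₂ K₁ K₂ : Set V} {p s₁ s₂ t₁ t₂ : V}
    (h : CrossPair G S T D₁ D₂ K₁ K₂ p s₁ s₂ t₁ t₂) :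
    IsFlower G (crossFlower S T D₁ D₂ K₁ K₂ p s₁ s₂ t₁ t₂) := by
  have hts := h.t_notMem
  have hst := h.s_notMem
  have hp := h.p_mem
  have hsT : s₁ ∈ S ∧ s₂ ∈ S := ⟨h.mem_S.2 (by simp), h.mem_S.2 (by simp)⟩
  have htT : t₁ ∈ T ∧ t₂ ∈ T := ⟨h.mem_T.2 (by simp), h.mem_T.2 (by simp)⟩
  have n1 : s₁ ≠ t₁ := fun e => hst.1 (e ▸ htT.1)
  have n2 : s₁ ≠ t₂ := fun e => hst.1 (e ▸ htT.2)
  have n3 : s₂ ≠ t₁ := fun e => hst.2 (e ▸ htT.1)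
  have n4 : s₂ ≠ t₂ := fun e => hst.2 (e ▸ htT.2)
  have p1 : s₁ ≠ p := fun e => hst.1 (e ▸ hp.2)
  have p2 : s₂ ≠ p := fun e => hst.2 (e ▸ hp.2)
  have p3 : t₁ ≠ p := fun e => hts.1 (e ▸ hp.1)
  have p4 : t₂ ≠ p := fun e => hts.2 (e ▸ hp.1)
  have hD1 : ∀ v, v = t₁ ∨ v = t₂ → (v ∈ D₁ ↔ v = t₁) := by
    have := h.t₁_mem; have := h.t₂_notMem; have := h.ne_t
    rintro v (rfl | rfl) <;> tauto
  have hD2 : ∀ v, v = t₁ ∨ v = t₂ → (v ∈ D₂ ↔ v = t₂) := by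
    have := h.t₂_mem; have := h.t₁_notMem; have := h.ne_t
    rintro v (rfl | rfl) <;> tauto
  have hK1 : ∀ v, v = s₁ ∨ v = s₂ → (v ∈ K₁ ↔ v = s₁) := by
    have := h.s₁_mem; have := h.s₂_notMem; have := h.ne_s
    rintro v (rfl | rfl) <;> tauto
  have hK2 : ∀ v, v = s₁ ∨ v = s₂ → (v ∈ K₂ ↔ v = s₂) := by
    have := h.s₂_mem; have := h.s₁_notMem; have := h.ne_s
    rintro v (rfl | rfl) <;> tauto
  refine ⟨le_rfl, ?_, ?_, {S, T}, ?_, ?_, ?_, ?_⟩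
  · show Function.Injective (![s₁, t₁, s₂, t₂] : Fin 4 → V)
    have := h.ne_s
    have := h.ne_t
    intro i j hij
    fin_cases i <;> fin_cases j <;> simp_all [eq_comm]
  · show ∀ i : Fin 4, (![s₁, t₁, s₂, t₂] : Fin 4 → V) i ≠ p
    intro i
    fin_cases i <;> assumption
  · rintro R (rfl | rfl)
    · refine ⟨(0 : Fin 4), (2 : Fin 4), (by decide : (2 : Fin 4) ≠ 0),
        (by decide : (2 : Fin 4) ≠ 0 + 1), (by decide : (0 : Fin 4) ≠ 2 + 1), ?_⟩
      show R = {s₁, s₂, p}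
      ext v
      rw [h.mem_S, mem_triple]
      tauto
    · refine ⟨(1 : Fin 4), (3 : Fin 4), (by decide : (3 : Fin 4) ≠ 1),
        (by decide : (3 : Fin 4) ≠ 1 + 1), (by decide : (1 : Fin 4) ≠ 3 + 1), ?_⟩
      show R = {t₁, t₂, p}
      ext v
      rw [h.mem_T, mem_triple]
      tauto
  · rintro R (rfl | rfl)
    · exact h.S_mem
    · exact h.T_mem
  · have c1 := corner_mem_parts h.D₁_comp h.K₁_comp htT.1 h.t₁_mem hsT.1 h.s₁_mem
    have c2 := corner_mem_parts h.D₁_comp h.K₂_comp htT.1 h.t₁_mem hsT.2 h.s₂_mem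
    have c3 := corner_mem_parts h.D₂_comp h.K₂_comp htT.2 h.t₂_mem hsT.2 h.s₂_mem
    have c4 := corner_mem_parts h.D₂_comp h.K₁_comp htT.2 h.t₂_mem hsT.1 h.s₁_mem
    apply Set.Subset.antisymm
    · intro A hA
      have hA' : Maximal (fun B : Set V => ∀ R ∈ ({S, T} : Set (Set V)), ¬ Splits G R B) A := hA
      have key : ∀ {R H H' : Set V}, Comp G R H → Comp G R H' → ¬ Splits G R A →
          (∀ v, v ∈ R ∨ v ∈ H ∨ v ∈ H') → A ⊆ H ∪ R ∨ A ⊆ H' ∪ R := by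
        intro R H H' hH hH' hAR hcov
        by_cases hA : A ⊆ R
        · exact Or.inl fun v hv => Or.inr (hA hv)
        obtain ⟨x, hx, hxR⟩ := Set.not_subset.1 hA
        rcases (hcov x).resolve_left hxR with h1 | h1
        · exact Or.inl (subset_of_not_splits hH hAR hx h1)
        · exact Or.inr (subset_of_not_splits hH' hAR hx h1)
      rcases key h.D₁_comp h.D₂_comp (hA.1 S (by simp)) h.S_cover with h1 | h1 <;>
        rcases key h.K₁_comp h.K₂_comp (hA.1 T (by simp)) h.T_cover with h2 | h2
      · exact ⟨(0 : Fin 4), (hA'.eq_of_le c1.1 fun v hv => ⟨h1 hv, h2 hv⟩).symm⟩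
      · exact ⟨(1 : Fin 4), (hA'.eq_of_le c2.1 fun v hv => ⟨h1 hv, h2 hv⟩).symm⟩
      · exact ⟨(3 : Fin 4), (hA'.eq_of_le c4.1 fun v hv => ⟨h1 hv, h2 hv⟩).symm⟩
      · exact ⟨(2 : Fin 4), (hA'.eq_of_le c3.1 fun v hv => ⟨h1 hv, h2 hv⟩).symm⟩
    · rintro _ ⟨i, rfl⟩
      change Fin 4 at i
      fin_cases i <;> assumption
  · have b1 := h.corner_boundary (Or.inl rfl) (Or.inl rfl) hD1 hK1
    have b2 := h.corner_boundary (Or.inr rfl) (Or.inl rfl) hD1 hK2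
    have b3 := h.corner_boundary (Or.inr rfl) (Or.inr rfl) hD2 hK2
    have b4 := h.corner_boundary (Or.inl rfl) (Or.inr rfl) hD2 hK1
    intro i
    change Fin 4 at i
    fin_cases i
    · exact b1
    · exact b2.trans (Set.insert_comm _ _ _)
    · exact b3
    · exact b4.trans (Set.insert_comm _ _ _)

theorem exists_isMaximalFlower [Finite V] {F : FlowerData V} (hF : IsFlower G F) :
    ∃ F', IsMaximalFlower G F' ∧ F.verts ⊆ F'.verts := by
  obtain ⟨X, hX, hmax⟩ := Finite.exists_le_maximal
    (p := fun X : Set V => ∃ F', IsFlower G F' ∧ F'.center = F.center ∧ F'.verts = X)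
    (a := F.verts) ⟨F, hF, rfl, rfl⟩
  obtain ⟨F', hF', hc, rfl⟩ := hmax.1
  exact ⟨F', ⟨hF', fun F'' h1 h2 h3 => h3.antisymm (hmax.2 ⟨F'', h1, h2.trans hc, rfl⟩ h3) |>.symm⟩,
    hX⟩

/-- A cutset that is dependent with a cutset meeting it belongs to a big complex or is one of its
boundaries. -/
theorem TriCond.inBigComplex_or_boundary (tri : TriCond G) {S T : Set V} {p : V}
    (hS : S ∈ threeCutsets G) (hT : T ∈ threeCutsets G) (hpS : p ∈ S) (hpT : p ∈ T)
    (hs : Splits G S T) : InBigComplex G T ∨ IsBigComplexBoundary G T := by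
  have hfin : Finite V := tri.finite
  have hsT := tri.splits_symm hT hs
  obtain ⟨D₁, D₂, K₁, K₂, s₁, s₂, t₁, t₂, h⟩ := tri.exists_crossPair hS hT hpS hpT hs
  obtain ⟨F, hF, hsub⟩ := exists_isMaximalFlower h.isFlower
  have hmem : ∀ i : Fin 4, (![s₁, t₁, s₂, t₂] : Fin 4 → V) i ∈ F.verts := fun i =>
    hsub (Or.inr ⟨i, rfl⟩)
  have hpF : p ∈ F.verts := hsub (Or.inl rfl)
  have hSF : S ⊆ F.verts := by
    intro v hv
    rcases h.mem_S.1 hv with rfl | rfl | rfl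
    · exact hpF
    · exact hmem 0
    · exact hmem 2
  have hTF : T ⊆ F.verts := by
    intro v hv
    rcases h.mem_T.1 hv with rfl | rfl | rfl
    · exact hpF
    · exact hmem 1
    · exact hmem 3
  have hflower : ∀ F : FlowerData V, IsMaximalFlower G F → IsNondegenerateFlower G F →
      S ⊆ flowerNeighborhood G F → T ⊆ flowerNeighborhood G F → InBigComplex G T :=
    fun F hF hF' h1 h2 => ⟨_, _, .flower F hF hF', hT, h2, hsT.mono h1⟩
  by_cases hnd : IsNondegenerateFlower G F
  · exact Or.inl (hflower F hF hnd (fun v hv => Or.inl (hSF hv)) fun v hv => Or.inl (hTF hv))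
  simp only [IsNondegenerateFlower, not_forall, not_not] at hnd
  obtain ⟨M, hM, hFM⟩ := hnd
  -- V(M) contains the center and four petals, five vertices in all.
  have hnt : ¬ IsTrivialCut G M := by
    classical
    have hinj : Function.Injective (![s₁, t₁, s₂, t₂] : Fin 4 → V) := h.isFlower.2.1
    refine tri.not_isTrivialCut hM (s := insert p (Finset.univ.image ![s₁, t₁, s₂, t₂])) ?_ ?_
    · rw [Finset.card_insert_of_notMem, Finset.card_image_of_injective _ hinj]
      · simp
      · simp only [Finset.mem_image, Finset.mem_univ, true_and, not_exists]
        exact h.isFlower.2.2.1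
    · intro x hx
      rw [Finset.mem_insert, Finset.mem_image] at hx
      rcases hx with rfl | ⟨i, -, rfl⟩
      · exact hFM hpF
      · exact hFM (hmem i)
  by_cases hbig : IsBigCut G M
  · by_cases hb : IsCutBoundary G M T
    · exact Or.inr ⟨_, _, .bigCut M hbig, hb⟩
    · exact Or.inl ⟨_, _, .bigCut M hbig, hT, hTF.trans hFM, hb⟩
  -- A nontrivial cut that is not big lies in the neighborhood of a triple cut or of a maximal
  -- nondegenerate flower, and so do S and T; in the flower case T splits that neighborhood because
  -- it splits S.
  simp only [IsBigCut, hM, hnt, not_false_eq_true, true_and, not_and_or, not_forall, not_not]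
    at hbig
  rcases hbig with ⟨R, hR, hMR⟩ | ⟨F', h1, h2, h3⟩
  · exact inBigComplex_or_boundary_of_subset_triple hR hT ((hTF.trans hFM).trans hMR)
  · exact Or.inl (hflower F' h1 h2 ((hSF.trans hFM).trans h3) ((hTF.trans hFM).trans h3))


/-! ### Dependent disjoint cutsets -/

theorem exists_third {T : Set V} (hT : T.ncard = 3) (x y : V) : ∃ z ∈ T, z ≠ x ∧ z ≠ y := by
  by_contra! hno
  have hsub : T ⊆ {x, y} := fun z hz => by
    by_cases h : z = x
    · exact Or.inl h
    · exact Or.inr (hno z hz h)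
  have h1 := Set.ncard_le_ncard hsub (Set.toFinite _)
  have h2 := Set.ncard_insert_le x {y}
  rw [Set.ncard_singleton] at h2
  omega

/-- Two disjoint cutsets, where `t₁` is the only vertex of `T = {t₁, t₂, t₃}` in `D`, a union of
components of `G - S`. -/
structure DisjointPair (G : SimpleGraph V) (S T D : Set V) (t₁ t₂ t₃ : V) : Prop where
  tri : TriCond G
  S_mem : S ∈ threeCutsets G
  T_mem : T ∈ threeCutsets G
  disj : ∀ x ∈ S, x ∉ T
  eq : T = {t₁, t₂, t₃}
  ne12 : t₁ ≠ t₂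
  ne13 : t₁ ≠ t₃
  ne23 : t₂ ≠ t₃
  closed : Closed G S D
  t₁_mem : t₁ ∈ D
  t₂_notMem : t₂ ∉ D
  t₃_notMem : t₃ ∉ D

theorem TriCond.exists_disjointPair (tri : TriCond G) {S T : Set V} (hS : S ∈ threeCutsets G)
    (hT : T ∈ threeCutsets G) (hdisj : ∀ x ∈ S, x ∉ T) (hs : Splits G S T) :
    ∃ D t₁ t₂ t₃, DisjointPair G S T D t₁ t₂ t₃ := by
  obtain ⟨D, hD, ⟨x, hx, hxD⟩, y, hy, hyD, hyS⟩ := splits_iff.1 hs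
  obtain ⟨z, hz, hzx, hzy⟩ := exists_third hT.1 x y
  have hxy : x ≠ y := fun e => hyD (e ▸ hxD)
  by_cases hzD : z ∈ D
  · exact ⟨(D ∪ S)ᶜ, y, x, z, tri, hS, hT, hdisj,
      eq_triple_of_mem hT.1 hy hx hz hxy.symm hzy.symm hzx.symm, hxy.symm, hzy.symm, hzx.symm,
      hD.compl, fun h' => h'.elim hyD hyS, fun h' => h' (Or.inl hxD), fun h' => h' (Or.inl hzD)⟩
  · exact ⟨D, x, y, z, tri, hS, hT, hdisj, eq_triple_of_mem hT.1 hx hy hz hxy hzx.symm hzy.symm,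
      hxy, hzx.symm, hzy.symm, hD, hxD, hyD, hzD⟩

namespace DisjointPair

variable {S T D : Set V} {t₁ t₂ t₃ : V} (h : DisjointPair G S T D t₁ t₂ t₃)
include h

theorem mem_T {v : V} : v ∈ T ↔ v = t₁ ∨ v = t₂ ∨ v = t₃ := by rw [h.eq, mem_triple]

theorem notMem_S {v : V} (hv : v = t₁ ∨ v = t₂ ∨ v = t₃) : v ∉ S := fun h' =>
  h.disj v h' (h.mem_T.2 hv)

theorem splits {X : Set V} {t : V} (h1 : t₁ ∈ X) (h2 : t ∈ X) (ht : t = t₂ ∨ t = t₃) :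
    Splits G S X := by
  refine splits_iff.2 ⟨D, h.closed, ⟨t₁, h1, h.t₁_mem⟩, t, h2, ?_, h.notMem_S (Or.inr ht)⟩
  rcases ht with rfl | rfl
  · exact h.t₂_notMem
  · exact h.t₃_notMem

theorem not_adj {t : V} (ht : t ∈ T) : ¬ G.Adj t₁ t := by
  intro hadj
  have h1 := (h.closed.2 _ h.t₁_mem t hadj).resolve_right (h.notMem_S (h.mem_T.1 ht))
  rcases h.mem_T.1 ht with rfl | rfl | rfl
  · exact G.loopless.irrefl _ hadj
  · exact h.t₂_notMem h1
  · exact h.t₃_notMem h1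

/-- A neighbor of t₁ in D ∩ K would be separated from t₂ by s and t₁ alone. -/
theorem adj_uniq {K : Set V} (hK : Closed G T K) {s : V} (hs : s ∈ S)
    (hKS : ∀ v ∈ S, v ∈ K → v = s) {y : V} (hy : y ∈ K) (hadj : G.Adj t₁ y) : y = s := by
  rcases h.closed.2 _ h.t₁_mem y hadj with hyD | hyS
  · exfalso
    refine h.tri.pair (D := D ∩ K) (a := s) (b := t₁) (z := t₂) (x := y) ?_ ⟨hyD, hy⟩
      (fun h' => h.closed.1 _ h'.1 hs) (fun h' => hK.1 _ h'.2 (h.mem_T.2 (Or.inl rfl)))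
      (fun h' => h.t₂_notMem h'.1) (fun e => h.notMem_S (Or.inr (Or.inl rfl)) (e ▸ hs)) h.ne12.symm
    intro x hx z hxz
    rcases h.closed.2 x hx.1 z hxz with h1 | h1 <;> rcases hK.2 x hx.2 z hxz with h2 | h2
    · exact Or.inl ⟨h1, h2⟩
    · rcases h.mem_T.1 h2 with rfl | rfl | rfl
      · exact Or.inr (Or.inr rfl)
      · exact absurd h1 h.t₂_notMem
      · exact absurd h1 h.t₃_notMem
    · exact Or.inr (Or.inl (hKS z h1 h2))
    · exact absurd h2 (h.disj z h1)
  · exact hKS y hyS hy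

theorem exists_mem_comp {H : Set V} (hH : Comp G T H) : ∃ s ∈ S, s ∈ H :=
  h.tri.exists_mem_comp h.T_mem.1 hH (h.splits (t := t₂) (h.mem_T.2 (by simp))
    (h.mem_T.2 (by simp)) (Or.inl rfl))

theorem exists_config {a b c : V} {A B : Set V} (hS : S = {a, b, c}) (hA : Comp G T A)
    (hB : Comp G T B) (haA : a ∈ A) (hbB : b ∈ B) (hcB : c ∈ B) (hAB : A ≠ B)
    (hnt : ¬ IsTrivialCutset G T)
    (hindep : ∀ R ∈ threeCutsets G, (∃ x ∈ R, x ∈ T) → ¬ Splits G R T) :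
    Config G T A B t₁ t₂ t₃ a := by
  have haS : a ∈ S := by simp [hS]
  have hdisj : ∀ v ∈ A, v ∉ B := fun v hv hv' => hAB (hA.eq_of_mem hB hv hv')
  have huniq : ∀ y ∈ A, G.Adj t₁ y → y = a := fun y hy hadj => h.adj_uniq hA.2.1 haS (by
    intro v hv hvA
    rw [hS, mem_triple] at hv
    rcases hv with rfl | rfl | rfl
    · rfl
    · exact absurd hbB (hdisj _ hvA)
    · exact absurd hcB (hdisj _ hvA)) hy hadj
  obtain ⟨y, hy, hadj⟩ := h.tri.exists_adj_of_closed h.T_mem.1 hA.2.1 hA.1 (h.mem_T.2 (Or.inl rfl))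
  refine ⟨h.tri, h.eq, h.ne12, h.ne13, h.ne23, hA, hB, fun v => ?_, hdisj, haA,
    huniq y hy hadj ▸ hadj, huniq, ?_, hindep, hnt⟩
  · by_cases hv : v ∈ T
    · exact Or.inl hv
    obtain ⟨H, hH, hvH⟩ := exists_comp_mem (G := G) hv
    obtain ⟨s, hs, hsH⟩ := h.exists_mem_comp hH
    rw [hS, mem_triple] at hs
    rcases hs with rfl | rfl | rfl
    · exact Or.inr (Or.inl (hH.eq_of_mem hA hsH haA ▸ hvH))
    · exact Or.inr (Or.inr (hH.eq_of_mem hB hsH hbB ▸ hvH))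
    · exact Or.inr (Or.inr (hH.eq_of_mem hB hsH hcB ▸ hvH))
  · by_contra! hno
    refine hnt ⟨h.T_mem, a, isComponent_vset_iff.2 ?_⟩
    rwa [show ({a} : Set V) = A from Set.Subset.antisymm (Set.singleton_subset_iff.2 haA) hno]

/-- With one vertex of S in each component of G - T, the vertex t₁ has all its neighbors in S, so S
isolates t₁ and meets the interior of every part. -/
theorem subordinated {a b c : V} {A B C : Set V} (hS : S = {a, b, c}) (hA : Comp G T A)
    (hB : Comp G T B) (hC : Comp G T C) (haA : a ∈ A) (hbB : b ∈ B) (hcC : c ∈ C) (hAB : A ≠ B)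
    (hAC : A ≠ C) (hBC : B ≠ C) : Subordinated G S T := by
  have hne := h.tri.ne_univ h.T_mem.1
  have hall : ∀ {H : Set V}, Comp G T H → H = A ∨ H = B ∨ H = C := by
    intro H hH
    obtain ⟨s, hs, hsH⟩ := h.exists_mem_comp hH
    rw [hS, mem_triple] at hs
    rcases hs with rfl | rfl | rfl
    · exact Or.inl (hH.eq_of_mem hA hsH haA)
    · exact Or.inr (Or.inl (hH.eq_of_mem hB hsH hbB))
    · exact Or.inr (Or.inr (hH.eq_of_mem hC hsH hcC))
  have hd : ∀ {H H' : Set V}, Comp G T H → Comp G T H' → H ≠ H' → ∀ v ∈ H, v ∉ H' :=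
    fun hH hH' hn v hv hv' => hn (hH.eq_of_mem hH' hv hv')
  have hT1 := h.mem_T.2 (Or.inl rfl)
  refine ⟨h.S_mem, h.T_mem, parts_ncard_eq hne (H := ![A, B, C]) ?_ ?_ ?_, ⟨t₁, hT1, ?_⟩, ?_⟩
  · intro i
    fin_cases i <;> assumption
  · intro i j hij
    fin_cases i <;> fin_cases j <;> simp_all [eq_comm]
  · intro H hH
    rcases hall hH with h1 | h1 | h1
    · exact ⟨0, h1⟩
    · exact ⟨1, h1⟩
    · exact ⟨2, h1⟩
  · refine isComponent_vset_iff.2 ⟨⟨t₁, rfl⟩, ⟨?_, ?_⟩, fun Z hZ hZne _ =>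
      hZne.subset_singleton_iff.1 hZ⟩
    · rintro x rfl
      exact h.closed.1 _ h.t₁_mem
    · rintro x rfl y hxy
      have hyT : y ∉ T := fun h' => h.not_adj h' hxy
      obtain ⟨H, hH, hyH⟩ := exists_comp_mem (G := G) hyT
      obtain ⟨s, hs, hsH⟩ := h.exists_mem_comp hH
      have := h.adj_uniq hH.2.1 hs (fun v hv hvH => by
        have e1 := hd hA hB hAB
        have e2 := hd hA hC hAC
        have e3 := hd hB hC hBC
        rw [hS, mem_triple] at hv hs
        rcases hall hH with rfl | rfl | rfl <;> rcases hv with rfl | rfl | rfl <;>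
          rcases hs with rfl | rfl | rfl <;> first | rfl | (exfalso; grind)) hyH hxy
      exact Or.inr (this ▸ hs)
  · intro P hP
    obtain ⟨H, hH, rfl⟩ := (mem_parts_singleton hne).1 hP
    obtain ⟨s, hs, hsH⟩ := h.exists_mem_comp hH
    exact ⟨s, by rwa [partInterior_singleton hH], hs⟩

/-- Either `T` is the line of a triple cut, or it can be complemented by an edge at `t₁`. -/
theorem mem_tripleLines_or_config (hnt : ¬ IsTrivialCutset G T)
    (hindep : ∀ R ∈ threeCutsets G, (∃ x ∈ R, x ∈ T) → ¬ Splits G R T) :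
    T ∈ tripleLines G ∨ ∃ K₁ K₂ s₁, Config G T K₁ K₂ t₁ t₂ t₃ s₁ := by
  obtain ⟨a, b, c, -, -, -, hS⟩ := Set.ncard_eq_three.1 h.S_mem.1
  have hcomp : ∀ s ∈ S, ∃ H, Comp G T H ∧ s ∈ H := fun s hs => exists_comp_mem (h.disj s hs)
  obtain ⟨A, hA, haA⟩ := hcomp a (by simp [hS])
  obtain ⟨B, hB, hbB⟩ := hcomp b (by simp [hS])
  obtain ⟨C, hC, hcC⟩ := hcomp c (by simp [hS])
  by_cases hAB : A = B
  · by_cases hAC : A = C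
    · exfalso
      -- If S lay in one component of G - T, T would not split S, against the symmetry of
      -- dependence.
      obtain ⟨K, hK, ⟨x, hx, hxK⟩, y, hy, hyK, hyT⟩ := splits_iff.1
        (h.tri.splits_symm h.T_mem (h.splits (X := T) (t := t₂) (h.mem_T.2 (by simp))
          (h.mem_T.2 (by simp)) (Or.inl rfl)))
      have hmem : ∀ v ∈ S, v ∈ A := by
        subst hAB hAC
        intro v hv
        rw [hS, mem_triple] at hv
        rcases hv with rfl | rfl | rfl <;> assumption
      exact hyK (hA.subset_of_mem hK (hmem x hx) hxK (hmem y hy))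
    · subst hAB
      exact Or.inr ⟨C, A, c, h.exists_config (a := c) (b := a) (c := b)
        (by rw [hS]; ext v; simp only [mem_triple]; tauto) hC hA hcC haA hbB (Ne.symm hAC) hnt
        hindep⟩
  · by_cases hAC : A = C
    · subst hAC
      exact Or.inr ⟨B, A, b, h.exists_config (a := b) (b := a) (c := c)
        (by rw [hS]; ext v; simp only [mem_triple]; tauto) hB hA hbB haA hcC (Ne.symm hAB) hnt
        hindep⟩
    · by_cases hBC : B = C
      · subst hBC
        exact Or.inr ⟨A, B, a, h.exists_config hS hA hB haA hbB hcC hAB hnt hindep⟩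
      · exact Or.inl ⟨S, h.subordinated hS hA hB hC haA hbB hcC hAB hAC hBC⟩

end DisjointPair

/-- The line of a triple cut belongs to its complex or is one of its boundaries. -/
theorem TriCond.tripleLine_inBigComplex_or_boundary (tri : TriCond G) {T : Set V}
    (hT : T ∈ tripleLines G) : InBigComplex G T ∨ IsBigComplexBoundary G T := by
  obtain ⟨S, hST⟩ := hT
  obtain ⟨H, a, hl, -⟩ := tri.exists_tripleLine hST
  exact inBigComplex_or_boundary_of_subset_triple ⟨S, hST⟩ hST.2.1 fun v hv =>
    hl.mem_neighborhood.2 (Or.inl hv)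

/-! ### Cuts with one edge -/

/-- Replacing the vertex a of a cutset by the edge ab leaves the component K unchanged when b is the
only neighbor of a in K. -/
theorem Comp.mcomp_of_uniq {K : Set V} {X : Set V} {a b : V} (hK : Comp G (insert a X) K)
    (hu : ∀ y ∈ K, G.Adj a y → y = b) : MComp G ⟨X, {s(a, b)}⟩ K := by
  refine ⟨hK.1, ⟨fun x hx h' => hK.2.1.1 x hx (Or.inr h'), fun x hx y hxy hy he => ?_⟩,
    fun Z hZ hne hZc => hK.2.2 Z hZ hne ⟨fun x hx => hK.2.1.1 x (hZ hx), fun x hx y hxy => ?_⟩⟩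
  · rcases hK.2.1.2 x hx y hxy with h1 | rfl | h1
    · exact h1
    · exact absurd (by rw [hu x hx hxy.symm, Sym2.eq_swap]; rfl) he
    · exact absurd h1 hy
  · by_cases hya : y = a
    · exact Or.inr (Or.inl hya)
    by_cases hyX : y ∈ X
    · exact Or.inr (Or.inr hyX)
    refine Or.inl (hZc.2 x hx y hxy hyX fun he => ?_)
    rcases Sym2.eq_iff.1 (Set.mem_singleton_iff.1 he) with ⟨h1, -⟩ | ⟨-, h1⟩
    · exact hK.2.1.1 x (hZ hx) (Or.inl h1)
    · exact hya h1

namespace Config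

variable {T K₁ K₂ : Set V} {t₁ t₂ t₃ s₁ : V} (c : Config G T K₁ K₂ t₁ t₂ t₃ s₁)
include c

theorem sdiff_eq : T \ {t₁} = {t₂, t₃} := by
  ext v
  have := c.ne12
  have := c.ne13
  simp only [Set.mem_sdiff, c.mem_T, Set.mem_singleton_iff, Set.mem_insert_iff]
  grind

theorem mcomp_left : MComp G ⟨T \ {t₁}, {s(t₁, s₁)}⟩ K₁ := by
  refine Comp.mcomp_of_uniq ?_ c.uniq
  rw [c.sdiff_eq, ← c.eq]
  exact c.comp1

theorem mcomp_right : MComp G ⟨T \ {t₁}, {s(t₁, s₁)}⟩ (insert t₁ K₂) := by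
  rw [Sym2.eq_swap]
  refine Comp.mcomp_of_uniq ?_ fun y hy hadj => c.adj_uniq hy hadj
  rw [c.sdiff_eq]
  exact c.comp_E

theorem mcomp_iff {H : Set V} :
    MComp G ⟨T \ {t₁}, {s(t₁, s₁)}⟩ H ↔ H = K₁ ∨ H = insert t₁ K₂ := by
  constructor
  · intro hH
    obtain ⟨x, hx⟩ := hH.1
    have heq : ∀ {H' : Set V}, MComp G ⟨T \ {t₁}, {s(t₁, s₁)}⟩ H' → x ∈ H' → H = H' := by
      intro H' hH' hx'
      exact ((hH.subset_or_disjoint hH'.2.1).resolve_right fun h' => h' x hx hx').antisymm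
        ((hH'.subset_or_disjoint hH.2.1).resolve_right fun h' => h' x hx' hx)
    have hxT := hH.2.1.1 x hx
    by_cases hxt : x = t₁
    · exact Or.inr (heq c.mcomp_right (Or.inl hxt))
    rcases c.cover x with h1 | h1 | h1
    · exact absurd ⟨h1, hxt⟩ hxT
    · exact Or.inl (heq c.mcomp_left h1)
    · exact Or.inr (heq c.mcomp_right (Or.inr h1))
  · rintro (rfl | rfl)
    · exact c.mcomp_left
    · exact c.mcomp_right

theorem mem_support {v : V} : v ∈ (⟨T \ {t₁}, {s(t₁, s₁)}⟩ : MixedSet V).support ↔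
    v = s₁ ∨ v ∈ T := by
  simp only [MixedSet.support, Set.mem_union, Set.mem_sdiff, Set.mem_singleton_iff,
    Set.mem_ofPred_eq, exists_eq_left, Sym2.mem_iff]
  have := c.t1_mem
  constructor
  · rintro (h1 | rfl | rfl)
    · exact Or.inr h1.1
    · exact Or.inr this
    · exact Or.inl rfl
  · rintro (rfl | h1)
    · exact Or.inr (Or.inr rfl)
    · by_cases hv : v = t₁
      · exact Or.inr (Or.inl hv)
      · exact Or.inl ⟨h1, hv⟩

theorem isCutBoundary_iff {X : Set V} :
    IsCutBoundary G ⟨T \ {t₁}, {s(t₁, s₁)}⟩ X ↔ X = T ∨ X = {s₁, t₂, t₃} := by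
  have h1 : K₁ᶜ ∩ (⟨T \ {t₁}, {s(t₁, s₁)}⟩ : MixedSet V).support = T := by
    ext v
    rw [Set.mem_inter_iff, c.mem_support]
    constructor
    · rintro ⟨h1, rfl | h2⟩
      · exact absurd c.mem h1
      · exact h2
    · exact fun h1 => ⟨fun h' => c.comp1.2.1.1 v h' h1, Or.inr h1⟩
  have h2 : (insert t₁ K₂)ᶜ ∩ (⟨T \ {t₁}, {s(t₁, s₁)}⟩ : MixedSet V).support = {s₁, t₂, t₃} := by
    ext v
    rw [Set.mem_inter_iff, c.mem_support, mem_triple, c.mem_T]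
    constructor
    · rintro ⟨h1, h2⟩
      have : v ≠ t₁ := fun e => h1 (Or.inl e)
      tauto
    · intro h1
      exact ⟨fun h' => c.closed_E.1 v h' (mem_triple.2 h1), by tauto⟩
  constructor
  · rintro ⟨H, hH, rfl⟩
    rcases c.mcomp_iff.1 (isComponent_iff.1 hH) with rfl | rfl
    · exact Or.inl h1
    · exact Or.inr h2
  · rintro (rfl | rfl)
    · exact ⟨K₁, isComponent_iff.2 c.mcomp_left, h1.symm⟩
    · exact ⟨_, isComponent_iff.2 c.mcomp_right, h2.symm⟩

theorem mem_cutClass : (⟨T \ {t₁}, {s(t₁, s₁)}⟩ : MixedSet V) ∈ cutClass G 1 := by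
  refine ⟨by simpa using c.adj, Set.ncard_singleton _, ?_, disconnects_iff.2
    ⟨K₁, c.mcomp_left.2.1, c.comp1.1, t₁, c.t1_notMem.1, fun h' => h'.2 rfl⟩⟩
  show (T \ {t₁}).ncard + 1 = 3
  rw [c.sdiff_eq, Set.ncard_pair c.ne23]

theorem complementedTo : ComplementedTo G (vset T) s(t₁, s₁) ⟨T \ {t₁}, {s(t₁, s₁)}⟩ := by
  refine ⟨t₁, s₁, c.t1_mem, c.adj, rfl, ?_, 1, le_rfl, by norm_num, c.mem_cutClass⟩
  simp [vset]

/-- If the resulting cut is not small, then its second boundary is single. -/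
theorem isSingle (hns : ¬ IsSingle G T) (hbig : ¬ InBigComplex G T)
    (hbd : ¬ IsBigComplexBoundary G T)
    (hsmall : ∀ M, IsSmallCut G M → T ∉ smallCutComplex G M) : IsSingle G {s₁, t₂, t₃} := by
  by_contra hn
  refine hsmall ⟨T \ {t₁}, {s(t₁, s₁)}⟩ ⟨c.mem_cutClass, fun X hX => ?_⟩
    (c.isCutBoundary_iff.2 (Or.inl rfl))
  rcases c.isCutBoundary_iff.1 hX with rfl | rfl
  · exact ⟨c.T_mem, hns, hbig⟩
  · exact ⟨c.T'_mem, hn, fun h' => (c.inBigComplex_or_boundary h').elim hbig hbd⟩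

theorem move {b : V} (hb : b ∈ K₁) (hadj : G.Adj t₂ b) (hu : ∀ y ∈ K₁, G.Adj t₂ y → y = b) :
    Config G T K₁ K₂ t₂ t₁ t₃ b :=
  { c with
    eq := by rw [c.eq, Set.insert_comm]
    ne12 := c.ne12.symm
    ne13 := c.ne23
    ne23 := c.ne13
    mem := hb
    adj := hadj
    uniq := hu
    more := by
      by_contra! hno
      refine c.nontriv ⟨c.T_mem, b, isComponent_vset_iff.2 ?_⟩
      rw [show ({b} : Set V) = K₁ from Set.Subset.antisymm (Set.singleton_subset_iff.2 hb) hno]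
      exact c.comp1 }

theorem move_flip {b : V} (hb : b ∈ K₂) (hadj : G.Adj t₂ b) (hu : ∀ y ∈ K₂, G.Adj t₂ y → y = b) :
    Config G T K₂ K₁ t₂ t₁ t₃ b :=
  { c with
    eq := by rw [c.eq, Set.insert_comm]
    ne12 := c.ne12.symm
    ne13 := c.ne23
    ne23 := c.ne13
    comp1 := c.comp2
    comp2 := c.comp1
    cover := fun v => (c.cover v).imp_right Or.symm
    disj := fun v h1 h2 => c.disj v h2 h1
    mem := hb
    adj := hadj
    uniq := hu
    more := by
      by_contra! hno
      refine c.nontriv ⟨c.T_mem, b, isComponent_vset_iff.2 ?_⟩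
      rw [show ({b} : Set V) = K₂ from Set.Subset.antisymm (Set.singleton_subset_iff.2 hb) hno]
      exact c.comp2 }

end Config

/-- If `T` can be complemented by an edge `ab`, then `b` is the only neighbor of `a` in some
component of `G - T`. -/
theorem exists_closed_of_complementedTo {T : Set V} {e : Sym2 V} {M : MixedSet V}
    (h : ComplementedTo G (vset T) e M) : ∃ a b, a ∈ T ∧ G.Adj a b ∧ e = s(a, b) ∧
      ∃ Z, Closed G T Z ∧ Z.Nonempty ∧ ∀ y ∈ Z, G.Adj a y → y = b := by
  obtain ⟨a, b, ha, hab, rfl, rfl, i, -, -, hi⟩ := h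
  have hd := hi.2.2.2
  simp only [vset, insert_empty_eq] at hd ha
  refine ⟨a, b, ha, hab, rfl, ?_⟩
  have key : ∀ {Z : Set V}, MClosed G ⟨T \ {a}, {s(a, b)}⟩ Z → a ∉ Z →
      Closed G T Z ∧ ∀ y ∈ Z, G.Adj a y → y = b := by
    intro Z hZ haZ
    refine ⟨⟨fun x hx hxT => hZ.1 x hx ⟨hxT, fun e => haZ (e ▸ hx)⟩, fun x hx y hxy => ?_⟩,
      fun y hy hay => ?_⟩
    · by_cases hyT : y ∈ T
      · exact Or.inr hyT
      refine Or.inl (hZ.2 x hx y hxy (fun h' => hyT h'.1) fun he => ?_)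
      rcases Sym2.eq_iff.1 (Set.mem_singleton_iff.1 he) with ⟨rfl, -⟩ | ⟨-, rfl⟩
      · exact haZ hx
      · exact hyT ha
    · by_contra hyb
      refine haZ (hZ.2 y hy a hay.symm (fun h' => h'.2 rfl) fun he => ?_)
      rcases Sym2.eq_iff.1 (Set.mem_singleton_iff.1 he) with ⟨rfl, -⟩ | ⟨h1, -⟩
      · exact haZ hy
      · exact hyb h1
  obtain ⟨Z, hZ, hne, z, hzZ, hzT⟩ := disconnects_iff.1 hd
  by_cases haZ : a ∈ Z
  · have := key hZ.compl fun h' => h' (Or.inl haZ)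
    exact ⟨_, this.1, ⟨z, fun h' => h'.elim hzZ hzT⟩, this.2⟩
  · have := key hZ haZ
    exact ⟨Z, this.1, hne, this.2⟩

/-- The edge complementing `T` is unique. -/
theorem DisjointPair.edge_unique {S T D K₁ K₂ : Set V} {t₁ t₂ t₃ s₁ : V}
    (h : DisjointPair G S T D t₁ t₂ t₃) (c : Config G T K₁ K₂ t₁ t₂ t₃ s₁)
    (hns : ¬ IsSingle G T) (hbig : ¬ InBigComplex G T) (hbd : ¬ IsBigComplexBoundary G T)
    (hsmall : ∀ M, IsSmallCut G M → T ∉ smallCutComplex G M) {e : Sym2 V} {M : MixedSet V}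
    (he : ComplementedTo G (vset T) e M) : e = s(t₁, s₁) := by
  obtain ⟨a, b, ha, hab, rfl, Z, hZ, ⟨z, hz⟩, hu⟩ := exists_closed_of_complementedTo he
  obtain ⟨X, hX, hXZ⟩ : ∃ X, (X = K₁ ∨ X = K₂) ∧ X ⊆ Z := by
    rcases c.cover z with h1 | h1 | h1
    · exact absurd h1 (hZ.1 z hz)
    · exact ⟨K₁, Or.inl rfl, c.comp1.subset_of_mem hZ h1 hz⟩
    · exact ⟨K₂, Or.inr rfl, c.comp2.subset_of_mem hZ h1 hz⟩
  replace hu : ∀ y ∈ X, G.Adj a y → y = b := fun y hy => hu y (hXZ hy)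
  have hb : b ∈ X := by
    obtain ⟨y, hy, hay⟩ : ∃ y ∈ X, G.Adj a y := by
      rcases hX with rfl | rfl
      · exact c.exists_adj1 ha
      · exact c.exists_adj2 ha
    exact hu y hy hay ▸ hy
  -- A complementing edge at t₂ or t₃ yields a single second boundary containing t₁ and another
  -- vertex of T, and S separates these two.
  have hno : ∀ {L₁ L₂ : Set V} {t t' r : V}, Config G T L₁ L₂ t t₁ t' r →
      (t' = t₂ ∨ t' = t₃) → False := by
    intro L₁ L₂ t t' r c' ht'
    have hsg := c'.isSingle hns hbig hbd hsmall
    have hSne : S ≠ {r, t₁, t'} := fun e => h.notMem_S (Or.inl rfl) (by rw [e]; simp)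
    exact (hsg.2 S h.S_mem hSne).2 (h.splits (by simp) (by simp) ht')
  rcases c.mem_T.1 ha with rfl | rfl | rfl
  · rcases hX with rfl | rfl
    · rw [c.uniq b hb hab]
    · exfalso
      -- An edge from t₁ to K₂ would leave t₁ with only the neighbors s₁ and b, as it has none in T.
      obtain ⟨y, hy, hys, hyb⟩ := h.tri.exists_adj_ne a s₁ b
      rcases c.cover y with h1 | h1 | h1
      · exact h.not_adj h1 hy
      · exact hys (c.uniq y h1 hy)
      · exact hyb (hu y h1 hy)
  · exfalso
    rcases hX with rfl | rfl
    · exact hno (c.move hb hab hu) (Or.inr rfl)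
    · exact hno (c.move_flip hb hab hu) (Or.inr rfl)
  · exfalso
    rcases hX with rfl | rfl
    · exact hno (c.swap.move hb hab hu) (Or.inl rfl)
    · exact hno (c.swap.move_flip hb hab hu) (Or.inl rfl)

/-- A cutset belonging to no big complex and to no complex of a small cut. -/
theorem TriCond.exists_edge (tri : TriCond G) {T : Set V} (hT : T ∈ threeCutsets G)
    (hbig : ¬ InBigComplex G T) (hsmall : ∀ M, IsSmallCut G M → T ∉ smallCutComplex G M)
    (hns : ¬ IsSingle G T) (hnt : ¬ IsTrivialCutset G T) (hbd : ¬ IsBigComplexBoundary G T) :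
    ∃ (e : Sym2 V) (M : MixedSet V), ComplementedTo G (vset T) e M ∧
      (∀ (e' : Sym2 V) (M' : MixedSet V), ComplementedTo G (vset T) e' M' → e' = e) ∧
      IsCutBoundary G M T ∧ ∃ T' : Set V, IsCutBoundary G M T' ∧ T' ≠ T ∧ IsSingle G T' := by
  have hindep : ∀ R ∈ threeCutsets G, (∃ x ∈ R, x ∈ T) → ¬ Splits G R T := by
    rintro R hR ⟨x, hxR, hxT⟩ hs
    exact (tri.inBigComplex_or_boundary hR hT hxR hxT hs).elim hbig hbd
  obtain ⟨S, hS, hs⟩ : ∃ S ∈ threeCutsets G, Splits G S T := by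
    by_contra! hno
    exact hns ⟨hT, fun S hS _ => ⟨fun h' => hno S hS (tri.splits_symm hS h'), hno S hS⟩⟩
  have hdisj : ∀ x ∈ S, x ∉ T := fun x hx hxT => hindep S hS ⟨x, hx, hxT⟩ hs
  obtain ⟨D, t₁, t₂, t₃, h⟩ := tri.exists_disjointPair hS hT hdisj hs
  rcases h.mem_tripleLines_or_config hnt hindep with hl | ⟨K₁, K₂, s₁, c⟩
  · exact ((tri.tripleLine_inBigComplex_or_boundary hl).elim hbig hbd).elim
  · refine ⟨_, _, c.complementedTo, fun e' M' he => h.edge_unique c hns hbig hbd hsmall he,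
      c.isCutBoundary_iff.2 (Or.inl rfl), _, c.isCutBoundary_iff.2 (Or.inr rfl), fun e => ?_,
      c.isSingle hns hbig hbd hsmall⟩
    have : s₁ ∈ T := by rw [← e]; simp
    exact c.comp1.2.1.1 _ c.mem this

/-- The two boundaries of a cut with one edge are distinct. -/
theorem TriCond.smallCutComplex_ne_singleton (tri : TriCond G) {M : MixedSet V}
    (hM : M ∈ cutClass G 1) (T : Set V) : smallCutComplex G M ≠ {T} := by
  intro he
  -- If all boundaries coincide, all components contain the same vertices of V(M), and disjoint
  -- components contain none. Then no edge of M meets H, and the two vertices of M alone separate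
  -- the graph.
  have hsup : ∀ H H' : Set V, MComp G M H → MComp G M H' → ∀ v ∈ M.support, v ∈ H → v ∈ H' := by
    intro H H' hH hH' v hv hvH
    have h1 : Hᶜ ∩ M.support ∈ smallCutComplex G M := ⟨H, isComponent_iff.2 hH, rfl⟩
    have h2 : H'ᶜ ∩ M.support ∈ smallCutComplex G M := ⟨H', isComponent_iff.2 hH', rfl⟩
    rw [he, Set.mem_singleton_iff] at h1 h2
    by_contra hvH'
    have h3 : v ∈ Hᶜ ∩ M.support := by
      rw [h1, ← h2]
      exact ⟨hvH', hv⟩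
    exact h3.1 hvH
  obtain ⟨D, hD, ⟨x, hx⟩, z, hz, hzM⟩ := disconnects_iff.1 hM.2.2.2
  obtain ⟨H, hH, hxH⟩ := exists_mcomp_mem (G := G) (hD.1 x hx)
  obtain ⟨H', hH', hzH'⟩ := exists_mcomp_mem (G := G) hzM
  have hHD : H ⊆ D := (hH.subset_or_disjoint hD).resolve_right fun h' => h' x hxH hx
  have hzH : z ∉ H := fun h' => hz (hHD h')
  have hdisj : ∀ v ∈ H, v ∉ H' := by
    intro v hv hv'
    have := (hH'.subset_or_disjoint hH.2.1).resolve_right fun h' => h' v hv' hv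
    exact hzH (this hzH')
  have hcl : Closed G M.verts H := by
    refine ⟨hH.2.1.1, fun x hx y hxy => ?_⟩
    by_cases hy : y ∈ M.verts
    · exact Or.inr hy
    refine Or.inl (hH.2.1.2 x hx y hxy hy fun he => ?_)
    exact hdisj x hx (hsup H H' hH hH' x (Or.inr ⟨_, he, Sym2.mem_mk_left x y⟩) hx)
  have hc : M.verts.ncard + 1 = 3 := hM.2.2.1
  exact (tri.closed_univ M.verts H (by omega) hcl ⟨x, hxH⟩ z).elim hzH hzM

end ThreeCuts
-- The corollary, by kinds of complexes
theorem mainTheorem9 {V : Type*} [Finite V] (G : SimpleGraph V)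
    (hG : ThreeCuts.IsKConnected G 3) (hV : 6 < Nat.card V)
    (C : Set (Set V)) (hC : ThreeCuts.IsComplex G C) (T : Set V) (hT : C = {T}) :
    T ∈ ThreeCuts.threeCutsets G ∧
    (ThreeCuts.IsSingle G T ∨
      ThreeCuts.IsTrivialCutset G T ∨
      ThreeCuts.IsBigComplexBoundary G T ∨
      ∃ (e : Sym2 V) (M : ThreeCuts.MixedSet V),
        ThreeCuts.ComplementedTo G (ThreeCuts.vset T) e M ∧
        (∀ (e' : Sym2 V) (M' : ThreeCuts.MixedSet V),
          ThreeCuts.ComplementedTo G (ThreeCuts.vset T) e' M' → e' = e) ∧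
        ThreeCuts.IsCutBoundary G M T ∧
        ∃ T' : Set V, ThreeCuts.IsCutBoundary G M T' ∧ T' ≠ T ∧ ThreeCuts.IsSingle G T') := by
  have tri := hG.triCond hV
  rcases hC with ⟨C, B, hC⟩ | ⟨T₀, hT₀⟩ | ⟨M, hM⟩ | ⟨T₀, hT₀, hbig, hsmall⟩
  · rcases hC with ⟨S, hS⟩ | ⟨F, hF, hF'⟩ | ⟨M, hM⟩
    · have := tri.trivial_of_tripleComplex_eq hS hT
      exact ⟨this.1, Or.inr (Or.inl this)⟩
    · exact absurd hT (tri.flowerComplex_ne_singleton hF.1 T)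
    · exact absurd hT (tri.bigCutComplex_ne_singleton hM T)
  · rw [Set.singleton_eq_singleton_iff] at hT
    subst hT
    exact ⟨hT₀.1, Or.inl hT₀⟩
  · exact absurd hT (tri.smallCutComplex_ne_singleton hM.1 T)
  · rw [Set.singleton_eq_singleton_iff] at hT
    subst hT
    refine ⟨hT₀, ?_⟩
    by_cases h1 : ThreeCuts.IsSingle G T₀
    · exact Or.inl h1
    by_cases h2 : ThreeCuts.IsTrivialCutset G T₀
    · exact Or.inr (Or.inl h2)
    by_cases h3 : ThreeCuts.IsBigComplexBoundary G T₀
    · exact Or.inr (Or.inr (Or.inl h3))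
    exact Or.inr (Or.inr (Or.inr (tri.exists_edge hT₀ hbig hsmall h1 h2 h3)))
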